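/- Let $\Sigma$ be a closed (compact, boundaryless, smooth, Hausdorff) surface. A Finsler metric on $\Sigma$ is a function $F:T\Sigma\to[0,\infty)$ that vanishes on the zero section, is positive and $C^\infty$ off the zero section, satisfies $F(x,av)=aF(x,v)$ for $a>0$, and for which $(v_1,v_2)\mapsto\frac{d^2}{ds\,dt}\big|_{s=t=0}F^2(x,v+sv_1+tv_2)$ is positive definite for every $v\neq0$. It is symmetric if $F(x,av)=|a|F(x,v)$ for all $a\ne 0$, and Riemannian if $F(x,v)=\sqrt{g_x(v,v)}$ for a smooth Riemannian metric $g$. A closed geodesic of $F$ of length $T>0$ is a smooth $T$-periodic curve $\sigma:\mathbb R\to\Sigma$ with $F(\dot\sigma)=1$ that satisfies the Euler–Lagrange equation $\frac{d}{dt}\frac{\partial F}{\partial v}(\sigma,\dot\sigma)=\frac{\partial F}{\partial q}(\sigma,\dot\sigma)$ of the length functional ($T$ need not be the minimal period). Let $\mathcal L_F(v)=F(v)\frac{\partial F}{\partial v}(v)$ be the Legendre transformation $T\Sigma\to T^*\Sigma$, $F^*=F\circ\mathcal L_F^{-1}$ the dual metric, $S^*_F\Sigma=\{F^*=1\}$,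 $\lambda$ the restriction to $S^*_F\Sigma$ of the Liouville form of $T^*\Sigma$, $\xi_F=\ker\lambda$, and $\varphi^t$ the Reeb flow of $\lambda$ (the flow of the vector field $R$ with $\lambda(R)=1$, $d\lambda(R,\cdot)=0$). A closed geodesic $\sigma$ of length $T$ corresponds to the $T$-periodic Reeb orbit $\mathcal L_F(\dot\sigma)$; it is called nondegenerate if $1$ is not in the spectrum of the linearized Poincaré map $P_\sigma=d\varphi^T|_{\xi_F}:\xi_F\to\xi_F$ at $\mathcal L_F(\dot\sigma(0))$. Fix a reference Finsler metric $F_0$ on $\Sigma$ and finitely many charts of $\Sigma$ together with compact subsets of their domains that cover $\Sigma$. For a smooth function $u$ on the sphere bundle of $\Sigma$ (a function on $T\Sigma$ minus the zero section that is positively homogeneous of degree $0$) put $$\|u\|_{C^\infty}=\sum_{k=0}^\infty 2^{-k}\frac{\|\nabla^ku\|_{C^0}}{1+\|\nabla^ku\|_{C^0}},$$ where $\|\nabla^k u\|_{C^0}$ is the supremum of the norm of the $k$-th derivative of $u$ in the induced charts of $T\Sigma$, taken over the vectors of coordinate length $1$ over these compact sets. For Finsler metrics $F,F'$ put $\|F-F'\|_{C^\infty}:=\|F/F_0-F'/F_0\|_{C^\infty}$.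 **Lemma.** Let $F$ be a Finsler metric on $\Sigma$ and let $\sigma_1,\dots,\sigma_k$ be finitely many closed geodesics of $F$, of lengths $T_1,\dots,T_k$. Then for every $\epsilon>0$ there is a Finsler metric $F'$ on $\Sigma$ with $\|F-F'\|_{C^\infty}<\epsilon$ such that every $\sigma_i$ is a closed geodesic of $F'$ of length $T_i$ and is nondegenerate for $F'$. Moreover, if $F$ is symmetric then so is $F'$, and if $F$ is Riemannian then so is $F'$. -/

import Mathlib

open Bundle Set Filter Topology
open scoped Manifold ContDiff ENNReal

namespace FinslerSurface

noncomputable section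

/-- The model plane `ℝ²` of a surface. -/
abbrev Plane : Type := EuclideanSpace ℝ (Fin 2)

/-- The dual of the model plane. -/
abbrev DualPlane : Type := Plane →L[ℝ] ℝ

variable {M : Type*} [TopologicalSpace M] [ChartedSpace Plane M] [IsManifold (𝓡 2) ∞ M]

variable (M) in
/-- The cotangent bundle `T*M`, with Mathlib's topology and manifold structure on a bundle of
continuous linear maps. -/
abbrev CotangentBundle : Type _ :=
  TotalSpace DualPlane (fun x : M => TangentSpace (𝓡 2) x →L[ℝ] ℝ)

/-- The model with corners of the cotangent bundle. -/
abbrev cotangentModel : ModelWithCorners ℝ (Plane × DualPlane) (ModelProd Plane DualPlane) :=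
  (𝓡 2).prod 𝓘(ℝ, DualPlane)

/-! ### Finsler metrics -/

/-- `F : TM → ℝ` is a Finsler metric: zero on the zero section, positive and smooth off it,
positively homogeneous of degree one on the fibres, and such that
`(v₁, v₂) ↦ d²/dsdt|₀ F²(x, v + s v₁ + t v₂)` is positive definite for `v ≠ 0`. -/
structure IsFinslerMetric (F : TangentBundle (𝓡 2) M → ℝ) : Prop where
  map_zero : ∀ x : M, F ⟨x, 0⟩ = 0
  pos : ∀ (x : M) (v : TangentSpace (𝓡 2) x), v ≠ 0 → 0 < F ⟨x, v⟩
  smooth : ContMDiffOn (𝓡 2).tangent 𝓘(ℝ, ℝ) ∞ F {p | p.2 ≠ 0}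
  homogeneous : ∀ (x : M) (v : TangentSpace (𝓡 2) x) (a : ℝ), 0 < a →
    F ⟨x, a • v⟩ = a * F ⟨x, v⟩
  strongly_convex : ∀ (x : M) (v w : TangentSpace (𝓡 2) x), v ≠ 0 → w ≠ 0 →
    0 < deriv (fun s : ℝ => deriv (fun t : ℝ => F ⟨x, v + s • w + t • w⟩ ^ 2) 0) 0

/-- A Finsler metric is symmetric if `F(x, a v) = |a| F(x, v)` for all `a ≠ 0`. -/
def IsSymmetric (F : TangentBundle (𝓡 2) M → ℝ) : Prop :=
  ∀ (x : M) (v : TangentSpace (𝓡 2) x) (a : ℝ), a ≠ 0 → F ⟨x, a • v⟩ = |a| * F ⟨x, v⟩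

/-- `F` is Riemannian if it is the norm of a smooth Riemannian metric on the surface. -/
def IsRiemannian (F : TangentBundle (𝓡 2) M → ℝ) : Prop :=
  ∃ g : ContMDiffRiemannianMetric (𝓡 2) ∞ Plane (fun x : M => TangentSpace (𝓡 2) x),
    ∀ (x : M) (v : TangentSpace (𝓡 2) x), F ⟨x, v⟩ = √(g.inner x v v)

/-! ### The `C^∞`-norm of functions on the sphere bundle -/

variable (M) in
/-- A finite family of charts together with compact subsets of their domains covering `M`. -/
structure ChartCover where
  /-- The number of charts. -/
  card : ℕ
  /-- The points at which the charts are centred. -/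
  center : Fin card → M
  /-- The compact sets. -/
  piece : Fin card → Set M
  isCompact_piece : ∀ i, IsCompact (piece i)
  piece_subset : ∀ i, piece i ⊆ (chartAt Plane (center i)).source
  iUnion_piece : ⋃ i, piece i = univ

/-- The coordinate expression `(y, v) ↦ u` of `u : TM → ℝ` in the chart of `TM` which is induced
by the preferred chart of `M` at `c`. -/
def chartExpr (u : TangentBundle (𝓡 2) M → ℝ) (c : M) : Plane × Plane → ℝ :=
  fun z => u ((extChartAt (𝓡 2).tangent (⟨c, 0⟩ : TangentBundle (𝓡 2) M)).symm z)

/-- `‖∇ᵏ u‖_{C⁰}` for a function `u` on the sphere bundle, regarded as a function on `TM` minus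
the zero section which is positively homogeneous of degree zero. The derivatives are
taken in the given charts, at the vectors over the given compact sets of coordinate length one. -/
def derivNorm (A : ChartCover M) (k : ℕ) (u : TangentBundle (𝓡 2) M → ℝ) : ℝ≥0∞ :=
  ⨆ i : Fin A.card, ⨆ x ∈ A.piece i, ⨆ v ∈ Metric.sphere (0 : Plane) 1,
    ‖iteratedFDeriv ℝ k (chartExpr u (A.center i)) (extChartAt (𝓡 2) (A.center i) x, v)‖ₑ

/-- `‖u‖_{C^∞} = ∑ₖ 2⁻ᵏ ‖∇ᵏ u‖ / (1 + ‖∇ᵏ u‖)`. The quotient `a / (1 + a)` is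
written as `1 - (1 + a)⁻¹`, which is also right for `a = ∞`. -/
def cInftyNorm (A : ChartCover M) (u : TangentBundle (𝓡 2) M → ℝ) : ℝ≥0∞ :=
  ∑' k : ℕ, (2⁻¹ : ℝ≥0∞) ^ k * (1 - (1 + derivNorm A k u)⁻¹)

/-- The `C^∞`-distance of two Finsler metrics: with a reference Finsler metric `F₀` they are
identified with the functions `F₁ / F₀` and `F₂ / F₀` on the sphere bundle. -/
def cInftyDist (A : ChartCover M) (F₀ F₁ F₂ : TangentBundle (𝓡 2) M → ℝ) : ℝ≥0∞ :=
  cInftyNorm A (fun p => F₁ p / F₀ p - F₂ p / F₀ p)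

/-! ### Closed geodesics -/

/-- The velocity lift `(σ, σ')` of a curve to the tangent bundle. -/
def velocity (σ : ℝ → M) (t : ℝ) : TangentBundle (𝓡 2) M :=
  ⟨σ t, mfderiv 𝓘(ℝ, ℝ) (𝓡 2) σ t (1 : ℝ)⟩

/-- The Euler-Lagrange equation `d/dt (∂F/∂v) (σ, σ') = (∂F/∂q) (σ, σ')` of the length functional
at time `t₀`, in the coordinates `(q, v)` of the chart at `σ t₀` (the equation does not depend on
the chart). -/
def EulerLagrangeAt (F : TangentBundle (𝓡 2) M → ℝ) (σ : ℝ → M) (t₀ : ℝ) : Prop :=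
  let L : Plane × Plane → ℝ := chartExpr F (σ t₀)
  let c : ℝ → Plane × Plane := fun t =>
    extChartAt (𝓡 2).tangent (⟨σ t₀, 0⟩ : TangentBundle (𝓡 2) M) (velocity σ t)
  HasDerivAt (fun t => (fderiv ℝ L (c t)).comp (ContinuousLinearMap.inr ℝ Plane Plane))
    ((fderiv ℝ L (c t₀)).comp (ContinuousLinearMap.inl ℝ Plane Plane)) t₀

/-- `σ : ℝ → M` is a closed geodesic of `F` of length `T`, parametrized by arc length. The period
`T` need not be the smallest one, so that iterates are included. -/
structure IsClosedGeodesic (F : TangentBundle (𝓡 2) M → ℝ) (σ : ℝ → M) (T : ℝ) : Prop where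
  length_pos : 0 < T
  smooth : ContMDiff 𝓘(ℝ, ℝ) (𝓡 2) ∞ σ
  periodic : Function.Periodic σ T
  unit_speed : ∀ t, F (velocity σ t) = 1
  geodesic : ∀ t, EulerLagrangeAt F σ t

/-! ### The Legendre transformation and the unit cotangent bundle -/

/-- The Legendre transformation on the fibre over `x`: `v ↦ F(v) · ∂F/∂v (v)`. -/
def legendreFiber (F : TangentBundle (𝓡 2) M → ℝ) (x : M) (v : TangentSpace (𝓡 2) x) :
    TangentSpace (𝓡 2) x →L[ℝ] ℝ :=
  F ⟨x, v⟩ • fderiv ℝ (fun w : Plane => F ⟨x, w⟩) v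

/-- The Legendre transformation `TM → T*M`. -/
def legendre (F : TangentBundle (𝓡 2) M → ℝ) (p : TangentBundle (𝓡 2) M) : CotangentBundle M :=
  ⟨p.1, legendreFiber F p.1 p.2⟩

/-- The dual metric `F* = F ∘ (Legendre transformation)⁻¹` on `T*M`. For a Finsler metric the
Legendre transformation is a bijection on each fibre. -/
def dualMetric (F : TangentBundle (𝓡 2) M → ℝ) (e : CotangentBundle M) : ℝ :=
  F ⟨e.1, Function.invFun (legendreFiber F e.1) e.2⟩

/-- The unit cotangent bundle `S*_F M`. -/
def unitCotangent (F : TangentBundle (𝓡 2) M → ℝ) : Set (CotangentBundle M) :=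
  {e | dualMetric F e = 1}

/-- The Liouville form `λ_e = e ∘ π_*` on `T*M`. -/
def liouville (e : CotangentBundle M) : TangentSpace cotangentModel e →L[ℝ] ℝ :=
  e.2.comp (mfderiv cotangentModel (𝓡 2) (fun e' : CotangentBundle M => e'.1) e)

/-- The canonical symplectic form `dλ = dp ∧ dq` on `T*M`. A tangent vector of `T*M` at `e` is,
in Mathlib, the pair `(dq, dp)` of its components in the bundle chart `(q, p)` of `T*M` at `e`,
which is induced by the chart `q` of `M` at the base point of `e`. -/
def symplecticForm (e : CotangentBundle M) (a b : TangentSpace cotangentModel e) : ℝ :=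
  let a' : Plane × DualPlane := a
  let b' : Plane × DualPlane := b
  a'.2 b'.1 - b'.2 a'.1

/-- The tangent space of the level set of `F*` through `e`; for `e` in the unit cotangent bundle
this is the tangent space of `S*_F M`. -/
def tangentUnitCotangent (F : TangentBundle (𝓡 2) M → ℝ) (e : CotangentBundle M) :
    Submodule ℝ (TangentSpace cotangentModel e) :=
  LinearMap.ker
    (mfderiv cotangentModel 𝓘(ℝ, ℝ) (dualMetric F) e :
      TangentSpace cotangentModel e →L[ℝ] ℝ).toLinearMap

/-- The contact plane `ξ_F = ker (λ|_{S*_F M})` at `e`. -/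
def contactPlane (F : TangentBundle (𝓡 2) M → ℝ) (e : CotangentBundle M) :
    Submodule ℝ (TangentSpace cotangentModel e) :=
  tangentUnitCotangent F e ⊓ LinearMap.ker (liouville e).toLinearMap

/-- `R` is the value at `e ∈ S*_F M` of the Reeb vector field of the contact form `λ|_{S*_F M}`:
it is tangent to `S*_F M`, `λ(R) = 1`, and `dλ(R, ·)` vanishes on the tangent space. -/
structure IsReebVector (F : TangentBundle (𝓡 2) M → ℝ) (e : CotangentBundle M)
    (R : TangentSpace cotangentModel e) : Prop where
  tangent : R ∈ tangentUnitCotangent F e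
  liouville_eq : liouville e R = 1
  symplectic_eq : ∀ w ∈ tangentUnitCotangent F e, symplecticForm e R w = 0

/-! ### The linearized Poincaré map and nondegeneracy -/

/-- `φ` restricts, on `S*_F M` near `e₀` and for times in `[0, T]`, to the Reeb flow of
`λ|_{S*_F M}`. No condition is imposed off the unit cotangent bundle. -/
def IsReebFlowNear (F : TangentBundle (𝓡 2) M → ℝ) (e₀ : CotangentBundle M) (T : ℝ)
    (φ : ℝ → CotangentBundle M → CotangentBundle M) : Prop :=
  ∀ᶠ e in 𝓝[unitCotangent F] e₀, φ 0 e = e ∧ ∀ t ∈ Icc (0 : ℝ) T, φ t e ∈ unitCotangent F ∧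
    ∃ R : TangentSpace cotangentModel (φ t e), IsReebVector F (φ t e) R ∧
      HasMFDerivWithinAt 𝓘(ℝ, ℝ) cotangentModel (fun s => φ s e) (Icc 0 T) t
        ((1 : ℝ →L[ℝ] ℝ).smulRight R)

/-- `P` is the linearized Poincaré map `dφ^T|_ξ : ξ → ξ` at `e₀ = L_F(σ'(0))` of the Reeb orbit
that corresponds to the closed geodesic `σ` of length `T`. The map `φ^T` is the restriction
to `S*_F M` of a map on `T*M` differentiable at `e₀`; as `ξ` is tangent to `S*_F M`, the
differential on `ξ` does not depend on the extension. -/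
def IsLinearizedPoincareMap (F : TangentBundle (𝓡 2) M → ℝ) (σ : ℝ → M) (T : ℝ)
    (P : Module.End ℝ (contactPlane F (legendre F (velocity σ 0)))) : Prop :=
  ∃ φ : ℝ → CotangentBundle M → CotangentBundle M,
    IsReebFlowNear F (legendre F (velocity σ 0)) T φ ∧
    φ T (legendre F (velocity σ 0)) = legendre F (velocity σ 0) ∧
    MDifferentiableAt cotangentModel cotangentModel (φ T) (legendre F (velocity σ 0)) ∧
    ∀ w : contactPlane F (legendre F (velocity σ 0)),
      ((P w : TangentSpace cotangentModel (legendre F (velocity σ 0))) : Plane × DualPlane) =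
        mfderiv cotangentModel cotangentModel (φ T) (legendre F (velocity σ 0)) w

/-- A closed geodesic is nondegenerate if `1` is not in the spectrum of its linearized Poincaré
map. -/
def IsNondegenerate (F : TangentBundle (𝓡 2) M → ℝ) (σ : ℝ → M) (T : ℝ) : Prop :=
  ∃ P : Module.End ℝ (contactPlane F (legendre F (velocity σ 0))),
    IsLinearizedPoincareMap F σ T P ∧ (1 : ℝ) ∉ spectrum ℝ P

end

end FinslerSurface

/-! The perturbation is conformal: `F' = (1 + s f) F`, where `f ≥ 0` is smooth and vanishes on all
the given geodesics, and `s > 0` is small. Symmetric metrics stay symmetric, Riemannian ones stay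
Riemannian, and the `C^∞`-distance to `F` tends to `0` with `s` (`tendsto_cInftyDist_conformal`).
Since `f` and `df` vanish along each `σ i`, the Euler-Lagrange equation there is unchanged
(`IsClosedGeodesic.conformal`). What remains is nondegeneracy.

The dual metric becomes `F* / (1 + s f)`, and the Reeb flow is the Hamiltonian flow of the energy
`K_s = (F*)² / (2 (1 + s f)²)` on the level `F* = 1 + s f`. Along the given orbit `K_s` has the same
differential as `K_0`, and its Hessian is smaller by exactly `s Hess f`, a form in the base
directions. Let `Y_s` be the linearized flow along the orbit and `D_s` its value after one period.
Comparison of the two linear Hamiltonian systems gives the exact identity `ω(D_s y, D_0 w) = ω(y, w)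
+ s Q_s(y, w)`, where `Q_s(y, w)` is the integral of `Hess f` on the base components of `Y_s y` and
`Y_0 w`. If unit vectors `y_s` of the contact plane satisfied `D_s y_s = y_s` for a sequence `s →
0`, then a limit `y` would be fixed by `D_0`; the identity with `w = y` gives `Q_s(y_s, y) = 0`,
hence `Q_0(y, y) = 0`. So positivity of `Q_0` on the contact plane excludes fixed vectors for all
small `s > 0`, whatever `D_0` is (`eventually_no_fixed_vector`); finitely many geodesics share a
common `s`.

For positivity, note that `Hess f ≥ 0` along the orbit and that the velocity lies in its kernel.
Suppose `Q_0(y, y) = 0`. While `Hess f ≠ 0`, the base component of `Y_0 y` lies in that kernel,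
which is the line of the velocity, but it is also annihilated by the momentum, because the contact
planes are invariant. Hence it vanishes on a time interval, and nondegeneracy of the fibre Hessian
of the energy forces `y = 0` (`IsCriticalOrbit.variationForm_self_pos`). One instant with `Hess f ≠
0` is enough, since all other segments contribute nonnegative terms
(`exists_isTransport_isPositiveOn`). Flows and forms are constructed in charts on short segments and
composed (`IsTransport.comp`).

For the construction of `f`, the geodesics may cross, overlap or be iterates. Their union is covered
by finitely many closed embedded arcs. For a time off the nowhere dense set at which `σ i` meets the
frontier of the preimage of an arc, the union is near that point a single graph traced by `σ i`. A
bump function times the squared height over the graph vanishes on every geodesic and has nonzero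
Hessian there; the sum of these functions over `i` is `f` (`exists_factor`). -/

namespace FinslerSurface

noncomputable section

/-! ### Differentiable dependence of solutions of differential equations on the initial value -/

section ODE

open NNReal

variable {V : Type*} [NormedAddCommGroup V] [NormedSpace ℝ V]

/-- Linearity of the bound in the defect is what turns a defect of order `o(‖h‖)` into a deviation
of order `o(‖h‖)`. -/
theorem gronwallBound_zero_eq_mul (K e x : ℝ) :
    gronwallBound 0 K e x = e * gronwallBound 0 K 1 x := by
  unfold gronwallBound
  split_ifs <;> ring

theorem _root_.HasDerivWithinAt.Ici_of_Icc {W : Type*} [NormedAddCommGroup W] [NormedSpace ℝ W]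
    {f : ℝ → W} {f' : W} {a b t : ℝ}
    (h : HasDerivWithinAt f f' (Icc a b) t) (ht : t ∈ Ico a b) : HasDerivWithinAt f f' (Ici t) t :=
  h.mono_of_mem_nhdsWithin (Icc_mem_nhdsGE_of_mem ht)

/-- A solution of speed at most `C` stays within `C (b - a)` of its start. With this radius
Picard-Lindelöf covers all of `[a, b]` at once, without subdivision. -/
theorem exists_solution_of_lipschitz_of_bounded [CompleteSpace V] {X : V → V} {K : ℝ≥0}
    (hK : LipschitzWith K X) {C : ℝ} (hC : ∀ x, ‖X x‖ ≤ C) {a b : ℝ} (hab : a ≤ b) :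
    ∃ φ : ℝ → V → V, ∀ x, φ a x = x ∧
      ∀ t ∈ Icc a b, HasDerivWithinAt (fun s => φ s x) (X (φ t x)) (Icc a b) t := by
  have h0 : 0 ≤ C := (norm_nonneg _).trans (hC 0)
  have key (x : V) : ∃ α : ℝ → V, α a = x ∧
      ∀ t ∈ Icc a b, HasDerivWithinAt α (X (α t)) (Icc a b) t := by
    have hP : IsPicardLindelof (fun _ : ℝ => X) (⟨a, left_mem_Icc.2 hab⟩ : Icc a b) x
        (C.toNNReal * (b - a).toNNReal) 0 C.toNNReal K :=
      { lipschitzOnWith := fun t _ => hK.lipschitzOnWith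
        continuousOn := fun x _ => continuousOn_const
        norm_le := fun t _ x _ => by simpa [h0] using hC x
        mul_max_le := by simp [h0, hab] }
    exact hP.exists_eq_forall_mem_Icc_hasDerivWithinAt₀
  choose α h1 h2 using key
  exact ⟨fun t x => α x t, fun x => ⟨h1 x, h2 x⟩⟩

/-- The curve `φ t z + Y t h` solves the equation up to a defect `e ‖Y t h‖`, so Grönwall's
inequality bounds its distance to the true solution from `z + h`. -/
theorem hasFDerivAt_flow_of_lipschitz {X : V → V} (hX : ContDiff ℝ 1 X)
    {K : ℝ≥0} (hK : LipschitzWith K X) {a b : ℝ} (hab : a ≤ b) {φ : ℝ → V → V}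
    (hφ : ∀ x, φ a x = x ∧
      ∀ t ∈ Icc a b, HasDerivWithinAt (fun s => φ s x) (X (φ t x)) (Icc a b) t)
    (z : V) {Y : ℝ → V →L[ℝ] V} (hYa : Y a = 1)
    (hY : ∀ t ∈ Icc a b,
      HasDerivWithinAt Y ((fderiv ℝ X (φ t z)).comp (Y t)) (Icc a b) t) :
    HasFDerivAt (φ b) (Y b) z := by
  have hYc : ContinuousOn Y (Icc a b) := fun t ht => (hY t ht).continuousWithinAt
  have hφc (x : V) : ContinuousOn (fun s => φ s x) (Icc a b) :=
    fun t ht => ((hφ x).2 t ht).continuousWithinAt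
  obtain ⟨C, hC⟩ := isCompact_Icc.exists_bound_of_continuousOn hYc
  have hC0 : 0 ≤ C := (norm_nonneg _).trans (hC a (left_mem_Icc.2 hab))
  have hcomp : IsCompact ((fun s => φ s z) '' Icc a b) := isCompact_Icc.image_of_continuousOn (hφc z)
  set G := gronwallBound 0 K 1 (b - a) with hG
  rw [hasFDerivAt_iff_isLittleO_nhds_zero, Asymptotics.isLittleO_iff]
  intro c hc
  -- The final error is `e * C * G * ‖h‖`, with `C` a bound of `‖Y‖` and `G` the Grönwall factor.
  obtain ⟨e, he, hec⟩ : ∃ e : ℝ, 0 < e ∧ e * C * G ≤ c := by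
    refine ⟨c / (|C * G| + 1), by positivity, ?_⟩
    rw [mul_assoc, div_mul_eq_mul_div, div_le_iff₀ (by positivity)]
    nlinarith [le_abs_self (C * G), abs_nonneg (C * G)]
  -- Compactness of the orbit gives one `δ` for all times in the first order Taylor estimate of `X`.
  have huc := hcomp.uniformContinuousAt_of_continuousAt (fderiv ℝ X)
    (fun x _ => (hX.continuous_fderiv one_ne_zero).continuousAt) (Metric.dist_mem_uniformity he)
  obtain ⟨δ, hδ, hδe⟩ := Metric.mem_uniformity_dist.1 huc
  have hest : ∀ t ∈ Icc a b, ∀ h : V, ‖h‖ < δ →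
      ‖X (φ t z + h) - X (φ t z) - fderiv ℝ X (φ t z) h‖ ≤ e * ‖h‖ := by
    intro t ht h hh
    have := (convex_ball (φ t z) δ).norm_image_sub_le_of_norm_fderiv_le'
      (φ := fderiv ℝ X (φ t z)) (C := e) (f := X) (𝕜 := ℝ) (x := φ t z) (y := φ t z + h)
      (fun x _ => hX.differentiable one_ne_zero x) (fun x hx => ?_)
      (Metric.mem_ball_self hδ) (by simpa using hh)
    · simpa using this
    · have := hδe (a := φ t z) (b := x) (by simpa [dist_comm] using hx) ⟨t, ht, rfl⟩
      rw [← dist_eq_norm, dist_comm]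
      exact this.le
  have hball : ∀ᶠ h : V in 𝓝 0, C * ‖h‖ < δ := by
    have : Tendsto (fun h : V => C * ‖h‖) (𝓝 0) (𝓝 (C * ‖(0 : V)‖)) :=
      Continuous.tendsto (by fun_prop) _
    rw [norm_zero, mul_zero] at this
    exact this.eventually_lt_const hδ
  filter_upwards [hball] with h hh
  have hYh (t : ℝ) (ht : t ∈ Icc a b) : ‖Y t h‖ ≤ C * ‖h‖ := (Y t).le_of_opNorm_le (hC t ht) h
  have hder (t : ℝ) (ht : t ∈ Icc a b) : HasDerivWithinAt (fun s => φ s z + Y s h)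
      (X (φ t z) + fderiv ℝ X (φ t z) (Y t h)) (Icc a b) t := by
    have h1 := (hY t ht).clm_apply (hasDerivWithinAt_const t (Icc a b) h)
    simp only [map_zero, add_zero] at h1
    exact ((hφ z).2 t ht).add h1
  have hgr := dist_le_of_approx_trajectories_ODE (v := fun _ => X) (K := K) (a := a) (b := b)
    (f := fun s => φ s (z + h)) (g := fun s => φ s z + Y s h) (δ := 0) (εf := 0)
    (εg := e * (C * ‖h‖)) (fun _ => hK) (hφc _)
    (fun t ht => ((hφ (z + h)).2 t (Ico_subset_Icc_self ht)).Ici_of_Icc ht)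
    (fun t ht => by simp) ((hφc z).add (hYc.clm_apply continuousOn_const))
    (fun t ht => (hder t (Ico_subset_Icc_self ht)).Ici_of_Icc ht)
    (fun t ht => by
      have ht := Ico_subset_Icc_self ht
      have h1 := hest t ht (Y t h) ((hYh t ht).trans_lt hh)
      rw [dist_comm, dist_eq_norm]
      calc ‖X (φ t z + Y t h) - (X (φ t z) + fderiv ℝ X (φ t z) (Y t h))‖
          = ‖X (φ t z + Y t h) - X (φ t z) - fderiv ℝ X (φ t z) (Y t h)‖ := by congr 1; abel
        _ ≤ e * ‖Y t h‖ := h1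
        _ ≤ e * (C * ‖h‖) := by gcongr; exact hYh t ht)
    (by simp [(hφ _).1, hYa]) b (right_mem_Icc.2 hab)
  rw [zero_add, gronwallBound_zero_eq_mul, ← hG, dist_eq_norm] at hgr
  calc ‖φ b (z + h) - φ b z - Y b h‖ = ‖φ b (z + h) - (φ b z + Y b h)‖ := by congr 1; abel
    _ ≤ e * (C * ‖h‖) * G := hgr
    _ = e * C * G * ‖h‖ := by ring
    _ ≤ c * ‖h‖ := by gcongr

/-- Cutting off makes a `C¹` field globally Lipschitz and bounded, as the flow construction
requires, without changing it near the orbit. -/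
theorem exists_contDiff_hasCompactSupport_eqOn [FiniteDimensional ℝ V] {X : V → V} {U k : Set V}
    (hU : IsOpen U) (hX : ContDiffOn ℝ 1 X U) (hk : IsCompact k) (hkU : k ⊆ U) :
    ∃ X' : V → V, ContDiff ℝ 1 X' ∧ HasCompactSupport X' ∧
      ∃ W, IsOpen W ∧ k ⊆ W ∧ W ⊆ U ∧ EqOn X' X W := by
  obtain ⟨L, hL, hkL, hLU⟩ := exists_compact_between hk hU hkU
  obtain ⟨f, hf1, hf0, -⟩ := exists_contMDiffMap_one_nhds_of_subset_interior 𝓘(ℝ, V) (n := 1)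
    hk.isClosed hkL
  have hf : ContDiff ℝ 1 f := f.contMDiff.contDiff
  have hzero : ∀ x ∉ L, f x • X x = 0 := fun x hx => by simp [hf0 x hx]
  obtain ⟨W, hW, hkW, hW1⟩ := mem_nhdsSet_iff_exists.1 hf1
  refine ⟨fun x => f x • X x, ?_, HasCompactSupport.intro hL hzero, W ∩ U, hW.inter hU,
    subset_inter hkW hkU, inter_subset_right, fun x hx => ?_⟩
  · rw [contDiff_iff_contDiffAt]
    intro x
    by_cases hx : x ∈ U
    · exact hf.contDiffAt.smul ((hX x hx).contDiffAt (hU.mem_nhds hx))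
    · have : (fun x => f x • X x) =ᶠ[𝓝 x] fun _ => 0 := by
        filter_upwards [hL.isClosed.isOpen_compl.mem_nhds fun h => hx (hLU h)] with y hy
        exact hzero y hy
      exact contDiffAt_const.congr_of_eventuallyEq this
  · have : f x = 1 := hW1 hx.1
    simp [this]

/-- The flow of a `C¹` vector field near a given integral curve, and its derivative with respect
to the initial value, which solves the linearized equation. -/
theorem exists_flow_near_integralCurve [FiniteDimensional ℝ V] {X : V → V} {U : Set V}
    (hU : IsOpen U) (hX : ContDiffOn ℝ 1 X U) {a b : ℝ} (hab : a ≤ b) {z : ℝ → V}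
    (hz : ∀ t ∈ Icc a b, HasDerivWithinAt z (X (z t)) (Icc a b) t)
    (hzU : ∀ t ∈ Icc a b, z t ∈ U) {Y : ℝ → V →L[ℝ] V} (hYa : Y a = 1)
    (hY : ∀ t ∈ Icc a b, HasDerivWithinAt Y ((fderiv ℝ X (z t)).comp (Y t)) (Icc a b) t) :
    ∃ φ : ℝ → V → V, φ b (z a) = z b ∧ HasFDerivAt (φ b) (Y b) (z a) ∧
      ∀ᶠ x in 𝓝 (z a), φ a x = x ∧ ∀ t ∈ Icc a b, φ t x ∈ U ∧
        HasDerivWithinAt (fun s => φ s x) (X (φ t x)) (Icc a b) t := by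
  have : CompleteSpace V := FiniteDimensional.complete ℝ V
  have hzc : ContinuousOn z (Icc a b) := fun t ht => (hz t ht).continuousWithinAt
  have hk : IsCompact (z '' Icc a b) := isCompact_Icc.image_of_continuousOn hzc
  obtain ⟨X', hX', hX's, W, hW, hkW, hWU, hXW⟩ :=
    exists_contDiff_hasCompactSupport_eqOn hU hX hk (image_subset_iff.2 hzU)
  obtain ⟨K, hK⟩ := hX'.lipschitzWith_of_hasCompactSupport hX's one_ne_zero
  obtain ⟨C, hC⟩ := hX'.continuous.bounded_above_of_compact_support hX's
  obtain ⟨φ, hφ⟩ := exists_solution_of_lipschitz_of_bounded hK hC hab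
  have hzW (t : ℝ) (ht : t ∈ Icc a b) : z t ∈ W := hkW ⟨t, ht, rfl⟩
  have hφc (x : V) : ContinuousOn (fun s => φ s x) (Icc a b) :=
    fun t ht => ((hφ x).2 t ht).continuousWithinAt
  have hdist (x : V) (t : ℝ) (ht : t ∈ Icc a b) :
      dist (φ t x) (z t) ≤ dist x (z a) * Real.exp (K * (t - a)) :=
    dist_le_of_trajectories_ODE (v := fun _ => X') (fun _ => hK) (hφc x)
      (fun t ht => ((hφ x).2 t (Ico_subset_Icc_self ht)).Ici_of_Icc ht) hzc
      (fun t ht => by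
        rw [hXW (hzW t (Ico_subset_Icc_self ht))]
        exact (hz t (Ico_subset_Icc_self ht)).Ici_of_Icc ht) (by rw [(hφ x).1]) t ht
  have hφz (t : ℝ) (ht : t ∈ Icc a b) : φ t (z a) = z t := by
    simpa using hdist (z a) t ht
  refine ⟨φ, hφz b (right_mem_Icc.2 hab), ?_, ?_⟩
  · refine hasFDerivAt_flow_of_lipschitz hX' hK hab hφ (z a) hYa fun t ht => ?_
    rw [hφz t ht, ((eventuallyEq_of_mem (hW.mem_nhds (hzW t ht)) hXW).fderiv_eq)]
    exact hY t ht
  -- By Grönwall, solutions that start close to `z a` stay in `W` up to time `b`, and there the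
  -- cut-off field is the original one.
  · obtain ⟨δ, hδ, hδW⟩ := hk.exists_thickening_subset_open hW hkW
    have hball : ∀ᶠ x in 𝓝 (z a), dist x (z a) * Real.exp (K * (b - a)) < δ := by
      have : Tendsto (fun x => dist x (z a) * Real.exp (K * (b - a))) (𝓝 (z a))
          (𝓝 (dist (z a) (z a) * Real.exp (K * (b - a)))) :=
        Continuous.tendsto (by fun_prop) _
      rw [dist_self, zero_mul] at this
      exact this.eventually_lt_const hδ
    filter_upwards [hball] with x hx
    refine ⟨(hφ x).1, fun t ht => ?_⟩
    have hin : φ t x ∈ W := by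
      refine hδW (Metric.mem_thickening_iff.2 ⟨z t, ⟨t, ht, rfl⟩, (hdist x t ht).trans_lt ?_⟩)
      refine lt_of_le_of_lt ?_ hx
      gcongr
      exact ht.2
    refine ⟨hWU hin, ?_⟩
    have := (hφ x).2 t ht
    rwa [hXW hin] at this

/-- Picard-Lindelöf in the unit ball around the identity: there `‖Y‖ ≤ 2`, so the speed is at most
`2 * C`, and `hs` keeps the solution in the ball. -/
theorem exists_propagator [CompleteSpace V] {A : ℝ → V →L[ℝ] V} {a b : ℝ} (hab : a ≤ b)
    (hA : ContinuousOn A (Icc a b)) {C : ℝ} (hC : ∀ t ∈ Icc a b, ‖A t‖ ≤ C)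
    (hs : 2 * C * (b - a) ≤ 1) :
    ∃ Y : ℝ → V →L[ℝ] V, Y a = 1 ∧
      ∀ t ∈ Icc a b, HasDerivWithinAt Y ((A t).comp (Y t)) (Icc a b) t := by
  have h0 : 0 ≤ C := (norm_nonneg _).trans (hC a (left_mem_Icc.2 hab))
  have hP : IsPicardLindelof (fun t (Y : V →L[ℝ] V) => (A t).comp Y)
      (⟨a, left_mem_Icc.2 hab⟩ : Icc a b) 1 1 0 (2 * C).toNNReal C.toNNReal :=
    { lipschitzOnWith := fun t ht => by
        refine LipschitzOnWith.of_dist_le_mul fun Y _ Z _ => ?_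
        rw [dist_eq_norm, dist_eq_norm, ← ContinuousLinearMap.comp_sub, Real.coe_toNNReal _ h0]
        exact (ContinuousLinearMap.opNorm_comp_le _ _).trans (by gcongr; exact hC t ht)
      continuousOn := fun Y _ => hA.clm_comp continuousOn_const
      norm_le := fun t ht Y hY => by
        rw [Real.coe_toNNReal _ (by positivity)]
        have h1 : ‖Y‖ ≤ 2 := by
          have h2 : ‖Y - 1‖ ≤ 1 := by simpa [dist_eq_norm] using hY
          have h3 : ‖(1 : V →L[ℝ] V)‖ ≤ 1 := ContinuousLinearMap.norm_id_le
          calc ‖Y‖ = ‖(Y - 1) + 1‖ := by rw [sub_add_cancel]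
            _ ≤ ‖Y - 1‖ + ‖(1 : V →L[ℝ] V)‖ := norm_add_le _ _
            _ ≤ 2 := by linarith
        calc ‖(A t).comp Y‖ ≤ ‖A t‖ * ‖Y‖ := ContinuousLinearMap.opNorm_comp_le _ _
          _ ≤ C * 2 := by gcongr; exact hC t ht
          _ = 2 * C := mul_comm _ _
      mul_max_le := by
        simpa [h0, hab] using hs }
  exact hP.exists_eq_forall_mem_Icc_hasDerivWithinAt₀

/-- The generator `A + s B` has norm at most `2 * C`, whence the factor `4` in `hs`. The solution
for `s = 0` satisfies the equation for `s` up to the defect `s • B Y₀`, so by Grönwall the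
dependence on `s` is Lipschitz at `0`. -/
theorem exists_propagator_family [CompleteSpace V] {A B : ℝ → V →L[ℝ] V} {a b : ℝ} (hab : a ≤ b)
    (hA : ContinuousOn A (Icc a b)) (hB : ContinuousOn B (Icc a b)) {C : ℝ}
    (hCA : ∀ t ∈ Icc a b, ‖A t‖ ≤ C) (hCB : ∀ t ∈ Icc a b, ‖B t‖ ≤ C)
    (hs : 4 * C * (b - a) ≤ 1) :
    ∃ Y : ℝ → ℝ → V →L[ℝ] V, (∀ s ∈ Icc (0 : ℝ) 1, Y s a = 1 ∧
      ∀ t ∈ Icc a b, HasDerivWithinAt (Y s) ((A t + s • B t).comp (Y s t)) (Icc a b) t) ∧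
      ∃ D : ℝ, ∀ s ∈ Icc (0 : ℝ) 1, ∀ t ∈ Icc a b, ‖Y s t - Y 0 t‖ ≤ s * D := by
  have h0 : 0 ≤ C := (norm_nonneg _).trans (hCA a (left_mem_Icc.2 hab))
  have hbound (s : ℝ) (hs : s ∈ Icc (0 : ℝ) 1) (t : ℝ) (ht : t ∈ Icc a b) :
      ‖A t + s • B t‖ ≤ 2 * C := by
    calc ‖A t + s • B t‖ ≤ ‖A t‖ + ‖s • B t‖ := norm_add_le _ _
      _ = ‖A t‖ + s * ‖B t‖ := by rw [norm_smul, Real.norm_of_nonneg hs.1]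
      _ ≤ C + 1 * C := by gcongr; exacts [hCA t ht, hs.2, hCB t ht]
      _ = 2 * C := by ring
  have key (s : ℝ) : ∃ Y : ℝ → V →L[ℝ] V, s ∈ Icc (0 : ℝ) 1 → Y a = 1 ∧
      ∀ t ∈ Icc a b, HasDerivWithinAt Y ((A t + s • B t).comp (Y t)) (Icc a b) t := by
    by_cases h : s ∈ Icc (0 : ℝ) 1
    · obtain ⟨Y, hY⟩ := exists_propagator hab (A := fun t => A t + s • B t)
        (hA.add (hB.const_smul s)) (hbound s h) (by linarith)
      exact ⟨Y, fun _ => hY⟩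
    -- Outside `[0, 1]` the value is a dummy.
    · exact ⟨0, fun h' => absurd h' h⟩
  choose Y hY using key
  refine ⟨Y, hY, ?_⟩
  have h00 : (0 : ℝ) ∈ Icc (0 : ℝ) 1 := by simp
  have hYc (s : ℝ) (hs : s ∈ Icc (0 : ℝ) 1) : ContinuousOn (Y s) (Icc a b) :=
    fun t ht => ((hY s hs).2 t ht).continuousWithinAt
  obtain ⟨C₀, hC₀⟩ := isCompact_Icc.exists_bound_of_continuousOn (hYc 0 h00)
  have hC₀0 : 0 ≤ C₀ := (norm_nonneg _).trans (hC₀ a (left_mem_Icc.2 hab))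
  refine ⟨C * C₀ * gronwallBound 0 (2 * C) 1 (b - a), fun s hs t ht => ?_⟩
  have hgr := dist_le_of_approx_trajectories_ODE_of_mem (K := (2 * C).toNNReal) (a := a) (b := b)
    (v := fun t (Z : V →L[ℝ] V) => (A t + s • B t).comp Z) (s := fun _ => univ)
    (f := Y s) (g := Y 0) (δ := 0) (εf := 0) (εg := s * (C * C₀))
    (fun t ht => by
      refine LipschitzOnWith.of_dist_le_mul fun Y _ Z _ => ?_
      rw [dist_eq_norm, dist_eq_norm, ← ContinuousLinearMap.comp_sub,
        Real.coe_toNNReal _ (by positivity)]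
      exact (ContinuousLinearMap.opNorm_comp_le _ _).trans
        (by gcongr; exact hbound s hs t (Ico_subset_Icc_self ht)))
    (hYc s hs) (fun t ht => ((hY s hs).2 t (Ico_subset_Icc_self ht)).Ici_of_Icc ht)
    (fun t ht => by simp) (fun _ _ => trivial) (hYc 0 h00)
    (fun t ht => ((hY 0 h00).2 t (Ico_subset_Icc_self ht)).Ici_of_Icc ht)
    (fun t ht => by
      have ht := Ico_subset_Icc_self ht
      have : (A t + (0 : ℝ) • B t).comp (Y 0 t) - (A t + s • B t).comp (Y 0 t)
          = -(s • (B t).comp (Y 0 t)) := by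
        ext x; simp
      rw [dist_eq_norm, this, norm_neg, norm_smul, Real.norm_of_nonneg hs.1]
      have h1 : ‖(B t).comp (Y 0 t)‖ ≤ C * C₀ :=
        (ContinuousLinearMap.opNorm_comp_le _ _).trans (by gcongr; exacts [hCB t ht, hC₀ t ht])
      exact mul_le_mul_of_nonneg_left h1 hs.1)
    (fun _ _ => trivial) (by simp [(hY s hs).1, (hY 0 h00).1]) t ht
  rw [zero_add, dist_eq_norm, gronwallBound_zero_eq_mul, Real.coe_toNNReal _ (by positivity)] at hgr
  calc ‖Y s t - Y 0 t‖ ≤ s * (C * C₀) * gronwallBound 0 (2 * C) 1 (t - a) := hgr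
    _ ≤ s * (C * C₀) * gronwallBound 0 (2 * C) 1 (b - a) := by
      have := hs.1
      gcongr
      exact gronwallBound_mono le_rfl zero_le_one (by positivity) (by linarith [ht.2])
    _ = _ := by ring

end ODE

/-! ### Charts of the tangent and of the cotangent bundle -/

section Charts

variable {M : Type*} [TopologicalSpace M] [ChartedSpace Plane M] [IsManifold (𝓡 2) ∞ M]

/-- The model space of `T*M`. -/
abbrev Phase : Type := Plane × DualPlane

/-- The derivative at `x` of the chart at `c`, in terms of the preferred chart at `x`. -/
abbrev coordTo (c x : M) : Plane →L[ℝ] Plane := tangentCoordChange (𝓡 2) x c x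

/-- The inverse of `coordTo c x`. -/
abbrev coordFrom (c x : M) : Plane →L[ℝ] Plane := tangentCoordChange (𝓡 2) c x x

theorem coordFrom_coordTo {c x : M} (hx : x ∈ (extChartAt (𝓡 2) c).source) (v : Plane) :
    coordFrom c x (coordTo c x v) = v := by
  rw [tangentCoordChange_comp ⟨⟨mem_extChartAt_source x, hx⟩, mem_extChartAt_source x⟩,
    tangentCoordChange_self (mem_extChartAt_source x)]

theorem coordTo_coordFrom {c x : M} (hx : x ∈ (extChartAt (𝓡 2) c).source) (v : Plane) :
    coordTo c x (coordFrom c x v) = v := by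
  rw [tangentCoordChange_comp ⟨⟨hx, mem_extChartAt_source x⟩, hx⟩, tangentCoordChange_self hx]

/-- The chart of `TM` which is induced by the chart of `M` at `c`. -/
abbrev tanChart (c : M) : PartialEquiv (TangentBundle (𝓡 2) M) (Plane × Plane) :=
  extChartAt (𝓡 2).tangent (⟨c, 0⟩ : TangentBundle (𝓡 2) M)

/-- The chart of `T*M` which is induced by the chart of `M` at `c`. -/
abbrev cotChart (c : M) : PartialEquiv (CotangentBundle M) Phase :=
  extChartAt cotangentModel (⟨c, 0⟩ : CotangentBundle M)

theorem extChartAt_cotangent (e : CotangentBundle M) :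
    extChartAt cotangentModel e = cotChart e.1 := rfl

/-- The vector `v` at `x`. -/
def tanMk (x : M) (v : Plane) : TangentBundle (𝓡 2) M := ⟨x, v⟩

/-- The covector `p` at `x`. -/
def cotMk (x : M) (p : DualPlane) : CotangentBundle M := ⟨x, p⟩

/-- The covector underlying a point of the cotangent bundle. -/
def covec (e : CotangentBundle M) : DualPlane := e.2

/-- The vector underlying a point of the tangent bundle. -/
def vec (p : TangentBundle (𝓡 2) M) : Plane := p.2

omit [IsManifold (𝓡 2) ∞ M] in
theorem cotMk_eta (e : CotangentBundle M) : cotMk e.1 (covec e) = e := rfl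

omit [IsManifold (𝓡 2) ∞ M] in
theorem tanMk_eta (p : TangentBundle (𝓡 2) M) : tanMk p.1 (vec p) = p := rfl

theorem mem_tanChart_source {c : M} {p : TangentBundle (𝓡 2) M} :
    p ∈ (tanChart c).source ↔ p.1 ∈ (extChartAt (𝓡 2) c).source := by
  rw [tanChart, FiberBundle.extChartAt]
  simp

theorem mem_tanChart_target {c : M} {z : Plane × Plane} :
    z ∈ (tanChart c).target ↔ z.1 ∈ (extChartAt (𝓡 2) c).target := by
  rw [tanChart, FiberBundle.extChartAt_target]
  simpa using (chartAt (EuclideanSpace ℝ (Fin 2)) c).map_target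

theorem mem_cotChart_source {c : M} {e : CotangentBundle M} :
    e ∈ (cotChart c).source ↔ e.1 ∈ (extChartAt (𝓡 2) c).source := by
  rw [cotChart, extChartAt_source, FiberBundle.chartedSpace_chartAt]
  simp +contextual [iff_def]

theorem mem_cotChart_target {c : M} {z : Phase} :
    z ∈ (cotChart c).target ↔ z.1 ∈ (extChartAt (𝓡 2) c).target := by
  rw [cotChart, FiberBundle.extChartAt_target]
  simpa using (chartAt (EuclideanSpace ℝ (Fin 2)) c).map_target

theorem tanChart_apply (c x : M) (v : Plane) :
    tanChart c (tanMk x v) = (extChartAt (𝓡 2) c x, coordTo c x v) := rfl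

theorem cotChart_apply {c x : M} (hx : x ∈ (extChartAt (𝓡 2) c).source) (p : DualPlane) :
    cotChart c (cotMk x p) =
      (extChartAt (𝓡 2) c x, p.comp (coordFrom c x)) := by
  rw [extChartAt_source] at hx
  refine Prod.ext rfl ?_
  have h := hom_trivializationAt_apply (RingHom.id ℝ) (F₁ := Plane) (F₂ := ℝ)
    (E₁ := (TangentSpace (𝓡 2) : M → Type _)) (E₂ := fun _ : M => ℝ) c ⟨x, p⟩
  change (trivializationAt DualPlane
    (fun x : M => TangentSpace (𝓡 2) x →L[ℝ] ℝ) c ⟨x, p⟩).2 = _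
  rw [h]
  refine ContinuousLinearMap.ext fun v => ?_
  simp only [ContinuousLinearMap.inCoordinates, ContinuousLinearMap.comp_apply]
  rw [TangentBundle.symmL_trivializationAt_eq_core hx]
  exact congrArg (fun L : ℝ →L[ℝ] ℝ => L (p (coordFrom c x v)))
    (Bundle.Trivial.continuousLinearMapAt_trivialization ℝ M ℝ x)

theorem tanChart_symm_apply {c : M} {q : Plane} (hq : q ∈ (extChartAt (𝓡 2) c).target)
    (w : Plane) : (tanChart c).symm (q, w) =
      tanMk ((extChartAt (𝓡 2) c).symm q) (coordFrom c ((extChartAt (𝓡 2) c).symm q) w) := by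
  have hx := (extChartAt (𝓡 2) c).map_target hq
  refine (tanChart c).injOn ((tanChart c).map_target (mem_tanChart_target.2 hq))
    (mem_tanChart_source.2 hx) ?_
  rw [(tanChart c).right_inv (mem_tanChart_target.2 hq), tanChart_apply, coordTo_coordFrom hx,
    (extChartAt (𝓡 2) c).right_inv hq]

theorem cotChart_symm_apply {c : M} {q : Plane} (hq : q ∈ (extChartAt (𝓡 2) c).target)
    (p : DualPlane) : (cotChart c).symm (q, p) =
      cotMk ((extChartAt (𝓡 2) c).symm q) (p.comp (coordTo c ((extChartAt (𝓡 2) c).symm q))) := by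
  have hx := (extChartAt (𝓡 2) c).map_target hq
  refine (cotChart c).injOn ((cotChart c).map_target (mem_cotChart_target.2 hq))
    (mem_cotChart_source.2 hx) ?_
  rw [(cotChart c).right_inv (mem_cotChart_target.2 hq), cotChart_apply hx,
    (extChartAt (𝓡 2) c).right_inv hq]
  refine Prod.ext rfl ?_
  ext v
  exact congrArg p (coordTo_coordFrom hx v).symm

omit [IsManifold (𝓡 2) ∞ M] in
theorem isOpen_chartTarget (c : M) : IsOpen (extChartAt (𝓡 2) c).target := isOpen_extChartAt_target c

theorem isOpen_cotChart_target (c : M) : IsOpen (cotChart c).target := isOpen_extChartAt_target _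

theorem hasFDerivAt_chart_comp_symm {c x y : M} (hx : y ∈ (extChartAt (𝓡 2) x).source)
    (hc : y ∈ (extChartAt (𝓡 2) c).source) :
    HasFDerivAt (extChartAt (𝓡 2) c ∘ (extChartAt (𝓡 2) x).symm)
      (tangentCoordChange (𝓡 2) x c y) (extChartAt (𝓡 2) x y) := by
  have := hasFDerivWithinAt_tangentCoordChange (I := (𝓡 2)) (x := x) (y := c) (z := y) ⟨hx, hc⟩
  simpa using this

theorem contDiffAt_chart_comp_symm {c x y : M} (hx : y ∈ (extChartAt (𝓡 2) x).source)
    (hc : y ∈ (extChartAt (𝓡 2) c).source) :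
    ContDiffAt ℝ ∞ (extChartAt (𝓡 2) c ∘ (extChartAt (𝓡 2) x).symm) (extChartAt (𝓡 2) x y) := by
  have h' : extChartAt (𝓡 2) x y ∈ ((extChartAt (𝓡 2) x).symm ≫ extChartAt (𝓡 2) c).source := by
    rw [PartialEquiv.trans_source'', PartialEquiv.symm_symm, PartialEquiv.symm_target]
    exact mem_image_of_mem _ ⟨hx, hc⟩
  have := contDiffWithinAt_ext_coord_change (I := 𝓡 2) (n := ∞) c x h'
  simpa [contDiffWithinAt_univ] using this

/-- The derivative of a chart of `T*M`. -/
def cotDeriv (c : M) (e : CotangentBundle M) : Phase →L[ℝ] Phase :=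
  mfderiv cotangentModel 𝓘(ℝ, Phase) (cotChart c) e

theorem hasMFDerivAt_cotChart {c : M} {e : CotangentBundle M} (he : e ∈ (cotChart c).source) :
    HasMFDerivAt cotangentModel 𝓘(ℝ, Phase) (cotChart c) e (cotDeriv c e) := by
  have := mdifferentiableAt_extChartAt (I := cotangentModel) (x := (⟨c, 0⟩ : CotangentBundle M))
    (y := e) (by rwa [extChartAt_source] at he)
  exact this.hasMFDerivAt

/-- Tangent vectors at `e` are stored in the chart at `e.1`, so the derivative of a chart is the
derivative of a coordinate change, and computations on `T*M` become computations in `Phase`. -/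
theorem hasFDerivAt_cotChart_comp_symm {c : M} {e : CotangentBundle M}
    (he : e ∈ (cotChart c).source) :
    HasFDerivAt (cotChart c ∘ (cotChart e.1).symm) (cotDeriv c e) (cotChart e.1 e) := by
  have h : HasFDerivWithinAt (cotChart c ∘ (cotChart e.1).symm) (cotDeriv c e)
      (range cotangentModel) (cotChart e.1 e) := (hasMFDerivAt_cotChart he).2
  rwa [ModelWithCorners.range_eq_univ, hasFDerivWithinAt_univ] at h

theorem isInvertible_cotDeriv {c : M} {e : CotangentBundle M} (he : e ∈ (cotChart c).source) :
    (cotDeriv c e).IsInvertible :=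
  isInvertible_mfderiv_extChartAt (I := cotangentModel) he

/-- In the chart attached to `e` the projection to `M` is the first coordinate. -/
theorem liouville_apply (e : CotangentBundle M) (a : Phase) : liouville e a = covec e a.1 := by
  have h : HasMFDerivAt cotangentModel (𝓡 2) (fun e' : CotangentBundle M => e'.1) e
      (ContinuousLinearMap.fst ℝ Plane DualPlane) := by
    refine ⟨(FiberBundle.continuous_proj DualPlane
      (fun x : M => TangentSpace (𝓡 2) x →L[ℝ] ℝ)).continuousAt, ?_⟩
    have hmem : (cotChart e.1).target ∈ 𝓝 (cotChart e.1 e) :=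
      (isOpen_cotChart_target e.1).mem_nhds
        ((cotChart e.1).map_source (mem_cotChart_source.2 (mem_extChartAt_source e.1)))
    have : writtenInExtChartAt cotangentModel (𝓡 2) e (fun e' : CotangentBundle M => e'.1)
        =ᶠ[𝓝 (cotChart e.1 e)] Prod.fst := by
      filter_upwards [hmem] with z hz
      obtain ⟨q, p⟩ := z
      have hq := mem_cotChart_target.1 hz
      simp only [writtenInExtChartAt, extChartAt_cotangent, Function.comp_apply]
      rw [cotChart_symm_apply hq]
      exact (extChartAt (𝓡 2) e.1).right_inv hq
    have h2 : HasFDerivAt (Prod.fst : Phase → Plane) (ContinuousLinearMap.fst ℝ Plane DualPlane)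
      (cotChart e.1 e) := hasFDerivAt_fst
    exact (h2.congr_of_eventuallyEq this).hasFDerivWithinAt
  rw [liouville, h.mfderiv]
  rfl

end Charts

/-! ### The symplectic form in charts -/

theorem two_le_infty : (2 : WithTop ℕ∞) ≤ ((⊤ : ℕ∞) : WithTop ℕ∞) :=
  (WithTop.coe_le_coe.2 le_top : ((2 : ℕ∞) : WithTop ℕ∞) ≤ ((⊤ : ℕ∞) : WithTop ℕ∞))

/-- The standard symplectic form of the phase space. -/
def omega (a b : Phase) : ℝ := a.2 b.1 - b.2 a.1

theorem omega_symm (a b : Phase) : omega a b = -omega b a := by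
  simp only [omega]; ring

/-- Lifts of point transformations preserve the symplectic form. -/
theorem omega_fderiv_of_liouville {τ : Phase → Phase} {ψ : Plane → Plane} {z : Phase}
    {D : Phase →L[ℝ] Phase} (hτ : HasFDerivAt τ D z) (hψ : ContDiffAt ℝ 2 ψ z.1)
    (h1 : ∀ᶠ y in 𝓝 z, (τ y).1 = ψ y.1)
    (h2 : ∀ᶠ y in 𝓝 z, ∀ v, (τ y).2 (fderiv ℝ ψ y.1 v) = y.2 v) (a b : Phase) :
    (D a).1 = fderiv ℝ ψ z.1 a.1 ∧ omega (D a) (D b) = omega a b := by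
  have hψ1 : HasFDerivAt ψ (fderiv ℝ ψ z.1) z.1 :=
    (hψ.differentiableAt two_ne_zero).hasFDerivAt
  have hψ2 : HasFDerivAt (fderiv ℝ ψ) (fderiv ℝ (fderiv ℝ ψ) z.1) z.1 :=
    ((hψ.fderiv_right (m := 1) (by norm_num)).differentiableAt one_ne_zero).hasFDerivAt
  have hfst (a : Phase) : (D a).1 = fderiv ℝ ψ z.1 a.1 := by
    have e1 : HasFDerivAt (fun y => (τ y).1) ((ContinuousLinearMap.fst ℝ Plane DualPlane).comp D) z :=
      hτ.fst
    have e2 : HasFDerivAt (fun y : Phase => ψ y.1)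
        ((fderiv ℝ ψ z.1).comp (ContinuousLinearMap.fst ℝ Plane DualPlane)) z :=
      HasFDerivAt.comp z hψ1 hasFDerivAt_fst
    exact congrArg (fun L => L a) (e1.unique (e2.congr_of_eventuallyEq h1))
  -- This is the derivative in direction `b` of the identity `h2`, which says that the new covector
  -- pulled back by `ψ` is the old one.
  have key (v : Plane) (b : Phase) :
      (D b).2 (fderiv ℝ ψ z.1 v) + (τ z).2 (fderiv ℝ (fderiv ℝ ψ) z.1 b.1 v) = b.2 v := by
    have e2 : HasFDerivAt (fun y : Phase => fderiv ℝ ψ y.1)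
        ((fderiv ℝ (fderiv ℝ ψ) z.1).comp (ContinuousLinearMap.fst ℝ Plane DualPlane)) z :=
      HasFDerivAt.comp z hψ2 hasFDerivAt_fst
    have e3 := hτ.snd.clm_apply (e2.clm_apply (hasFDerivAt_const v z))
    have e4 : HasFDerivAt (fun y : Phase => y.2 v) _ z :=
      hasFDerivAt_snd.clm_apply (hasFDerivAt_const v z)
    have := congrArg (fun L => L b) (e3.unique
      (e4.congr_of_eventuallyEq (by filter_upwards [h2] with y hy using hy v)))
    simpa [add_comm] using this
  -- The terms with the second derivative of `ψ` cancel in the antisymmetric form, since that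
  -- derivative is symmetric.
  have hsymm : fderiv ℝ (fderiv ℝ ψ) z.1 a.1 b.1 = fderiv ℝ (fderiv ℝ ψ) z.1 b.1 a.1 :=
    (hψ.isSymmSndFDerivAt (by simp)) a.1 b.1
  refine ⟨hfst a, ?_⟩
  have ka := key b.1 a
  have kb := key a.1 b
  simp only [omega, hfst]
  rw [hsymm] at ka
  linarith

section

variable {M : Type*} [TopologicalSpace M] [ChartedSpace Plane M] [IsManifold (𝓡 2) ∞ M]

theorem cotDeriv_spec {c : M} {e : CotangentBundle M} (he : e ∈ (cotChart c).source)
    (a b : Phase) :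
    (cotDeriv c e a).1 = coordTo c e.1 a.1 ∧ omega (cotDeriv c e a) (cotDeriv c e b) = omega a b := by
  have hx := mem_cotChart_source.1 he
  have hxx := mem_extChartAt_source (I := 𝓡 2) e.1
  set ψ : Plane → Plane := extChartAt (𝓡 2) c ∘ (extChartAt (𝓡 2) e.1).symm with hψ
  have hz1 : (cotChart e.1 e).1 = extChartAt (𝓡 2) e.1 e.1 := rfl
  have hnear : ∀ᶠ y in 𝓝 (cotChart e.1 e), y.1 ∈ (extChartAt (𝓡 2) e.1).target ∧
      (extChartAt (𝓡 2) e.1).symm y.1 ∈ (extChartAt (𝓡 2) c).source := by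
    have hc : ContinuousAt (fun y : Phase => y.1) (cotChart e.1 e) := continuousAt_fst
    have h1 := hc.eventually_mem ((isOpen_chartTarget e.1).mem_nhds
      ((extChartAt (𝓡 2) e.1).map_source hxx))
    have h2 : ∀ᶠ q in 𝓝 (extChartAt (𝓡 2) e.1 e.1),
        (extChartAt (𝓡 2) e.1).symm q ∈ (extChartAt (𝓡 2) c).source := by
      refine (continuousAt_extChartAt_symm e.1).eventually_mem ?_
      rw [(extChartAt (𝓡 2) e.1).left_inv hxx]
      exact (isOpen_extChartAt_source c).mem_nhds hx
    exact h1.and (hc.eventually h2)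
  have hτ (y : Phase) (h1 : y.1 ∈ (extChartAt (𝓡 2) e.1).target)
      (h2 : (extChartAt (𝓡 2) e.1).symm y.1 ∈ (extChartAt (𝓡 2) c).source) :
      (cotChart c ∘ (cotChart e.1).symm) y = (ψ y.1,
        (y.2.comp (coordTo e.1 ((extChartAt (𝓡 2) e.1).symm y.1))).comp
          (coordFrom c ((extChartAt (𝓡 2) e.1).symm y.1))) := by
    obtain ⟨q, p⟩ := y
    rw [Function.comp_apply, cotChart_symm_apply h1, cotChart_apply h2]
    rfl
  have main := omega_fderiv_of_liouville (hasFDerivAt_cotChart_comp_symm he) (ψ := ψ)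
    ((contDiffAt_chart_comp_symm hxx hx).of_le two_le_infty)
    (by filter_upwards [hnear] with y hy; rw [hτ y hy.1 hy.2])
    (by
      filter_upwards [hnear] with y hy v
      rw [hτ y hy.1 hy.2]
      set x := (extChartAt (𝓡 2) e.1).symm y.1 with hxdef
      have hxs := (extChartAt (𝓡 2) e.1).map_target hy.1
      have hyx : y.1 = extChartAt (𝓡 2) e.1 x := ((extChartAt (𝓡 2) e.1).right_inv hy.1).symm
      have hd : fderiv ℝ ψ y.1 = tangentCoordChange (𝓡 2) e.1 c x := by
        rw [hyx]
        exact (hasFDerivAt_chart_comp_symm hxs hy.2).fderiv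
      rw [hd]
      simp only [ContinuousLinearMap.comp_apply]
      rw [tangentCoordChange_comp ⟨⟨hxs, hy.2⟩, mem_extChartAt_source x⟩, coordTo_coordFrom hxs])
    a b
  have hd : fderiv ℝ ψ (cotChart e.1 e).1 = coordTo c e.1 :=
    (hasFDerivAt_chart_comp_symm hxx hx).fderiv
  rw [hd] at main
  exact main

theorem omega_cotDeriv {c : M} {e : CotangentBundle M} (he : e ∈ (cotChart c).source)
    (a b : Phase) : omega (cotDeriv c e a) (cotDeriv c e b) = omega a b := (cotDeriv_spec he a b).2

/-- The Liouville form in a chart. -/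
theorem liouville_eq_chart {c : M} {e : CotangentBundle M} (he : e ∈ (cotChart c).source)
    (a : Phase) : liouville e a = (cotChart c e).2 (cotDeriv c e a).1 := by
  have hx := mem_cotChart_source.1 he
  rw [liouville_apply, (cotDeriv_spec he a a).1, ← cotMk_eta e, cotChart_apply hx]
  exact congrArg (covec e) (coordFrom_coordTo hx a.1).symm

/-- The derivative of a chart of `T*M` as a linear equivalence. -/
def cotDerivEquiv (c : M) (e : CotangentBundle M) (he : e ∈ (cotChart c).source) :
    Phase ≃L[ℝ] Phase := (isInvertible_cotDeriv he).choose

theorem coe_cotDerivEquiv (c : M) (e : CotangentBundle M) (he : e ∈ (cotChart c).source) :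
    (cotDerivEquiv c e he : Phase →L[ℝ] Phase) = cotDeriv c e :=
  (isInvertible_cotDeriv he).choose_spec

theorem cotDerivEquiv_apply (c : M) (e : CotangentBundle M) (he : e ∈ (cotChart c).source)
    (a : Phase) : cotDerivEquiv c e he a = cotDeriv c e a := by
  rw [← coe_cotDerivEquiv c e he]; rfl

/-- The derivative of the inverse of a chart of `T*M`. -/
theorem hasMFDerivAt_cotChart_symm {c : M} {e : CotangentBundle M}
    (he : e ∈ (cotChart c).source) :
    HasMFDerivAt 𝓘(ℝ, Phase) cotangentModel (cotChart c).symm (cotChart c e)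
      ((cotDerivEquiv c e he).symm : Phase →L[ℝ] Phase) := by
  have hz : cotChart c e ∈ (cotChart c).target := (cotChart c).map_source he
  have hinv : (cotChart c).symm (cotChart c e) = e := (cotChart c).left_inv he
  have hmd := mdifferentiableWithinAt_extChartAt_symm (I := cotangentModel)
    (x := (⟨c, 0⟩ : CotangentBundle M)) hz
  rw [ModelWithCorners.range_eq_univ, mdifferentiableWithinAt_univ] at hmd
  have hd := hmd.hasMFDerivAt
  set D : Phase →L[ℝ] Phase := mfderiv 𝓘(ℝ, Phase) cotangentModel (cotChart c).symm (cotChart c e)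
    with hD
  have hd' : HasMFDerivAt 𝓘(ℝ, Phase) cotangentModel (cotChart c).symm (cotChart c e) D := hd
  have hc := hasMFDerivAt_cotChart he
  have hcomp : HasMFDerivAt cotangentModel cotangentModel ((cotChart c).symm ∘ cotChart c) e
      (D.comp (cotDeriv c e)) := HasMFDerivAt.comp e hd' hc
  have hid : HasMFDerivAt cotangentModel cotangentModel ((cotChart c).symm ∘ cotChart c) e
      (ContinuousLinearMap.id ℝ Phase) := by
    refine (hasMFDerivAt_id (I := cotangentModel) e).congr_of_eventuallyEq ?_
    filter_upwards [extChartAt_source_mem_nhds' (I := cotangentModel) he] with y hy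
    exact (cotChart c).left_inv hy
  have huniq : D.comp (cotDeriv c e) = ContinuousLinearMap.id ℝ Phase :=
    hasMFDerivAt_unique hcomp hid
  have : D = ((cotDerivEquiv c e he).symm : Phase →L[ℝ] Phase) := by
    refine ContinuousLinearMap.ext fun w => ?_
    obtain ⟨a, rfl⟩ := (cotDerivEquiv c e he).surjective w
    have := congrArg (fun L => L a) huniq
    simp only [ContinuousLinearMap.comp_apply, ContinuousLinearMap.id_apply] at this
    rw [cotDerivEquiv_apply, this]
    simp [← cotDerivEquiv_apply c e he]
  rw [← this]
  exact hd'

end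

set_option synthInstance.maxHeartbeats 200000

/-! ### Finsler functions on an open subset of the plane and their Legendre transformation -/

theorem hasDerivAt_clm_eval {E G : Type*} [NormedAddCommGroup E] [NormedSpace ℝ E]
    [NormedAddCommGroup G] [NormedSpace ℝ G] {f : E → G →L[ℝ] ℝ} {f' : E →L[ℝ] G →L[ℝ] ℝ}
    {c : ℝ → E} {c' : E} {t : ℝ} {z : E} (hf : HasFDerivAt f f' z) (hc : HasDerivAt c c' t)
    (hz : c t = z) (w : G) : HasDerivAt (fun s => f (c s) w) (f' c' w) t := by
  subst hz
  simpa using (hf.comp_hasDerivAt t hc).clm_apply (hasDerivAt_const t w)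

theorem hasFDerivAt_clm_eval {E G : Type*} [NormedAddCommGroup E] [NormedSpace ℝ E]
    [NormedAddCommGroup G] [NormedSpace ℝ G] {f : E → G →L[ℝ] ℝ} {f' : E →L[ℝ] G →L[ℝ] ℝ}
    {z : E} (hf : HasFDerivAt f f' z) (w : G) : HasFDerivAt (fun y => f y w) (f'.flip w) z := by
  simpa using hf.clm_apply (hasFDerivAt_const w z)

theorem _root_.ContDiffAt.hasFDerivAt_fderiv {E : Type*} [NormedAddCommGroup E] [NormedSpace ℝ E]
    {f : E → ℝ} {z : E} (hf : ContDiffAt ℝ 2 f z) :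
    HasFDerivAt (fderiv ℝ f) (fderiv ℝ (fderiv ℝ f) z) z :=
  ((hf.fderiv_right (m := 1) (by norm_num)).differentiableAt one_ne_zero).hasFDerivAt

/-- The coordinate expression of a Finsler metric over an open subset `U` of the plane. -/
structure IsLocalFinsler (U : Set Plane) (L : Plane × Plane → ℝ) : Prop where
  isOpen : IsOpen U
  pos : ∀ q ∈ U, ∀ w, w ≠ 0 → 0 < L (q, w)
  smooth : ContDiffOn ℝ ∞ L (U ×ˢ {0}ᶜ)
  homogeneous : ∀ q ∈ U, ∀ w, ∀ a : ℝ, 0 < a → L (q, a • w) = a * L (q, w)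
  strongly_convex : ∀ q ∈ U, ∀ v w, v ≠ 0 → w ≠ 0 →
    0 < deriv (fun s : ℝ => deriv (fun t : ℝ => L (q, v + s • w + t • w) ^ 2) 0) 0

/-- The fibre derivative `L ∂L/∂v`. -/
def fibreLegendre (L : Plane × Plane → ℝ) (z : Plane × Plane) : DualPlane :=
  L z • (fderiv ℝ L z).comp (ContinuousLinearMap.inr ℝ Plane Plane)

/-- The Legendre transformation in coordinates. -/
def localLegendre (L : Plane × Plane → ℝ) (z : Plane × Plane) : Phase := (z.1, fibreLegendre L z)

namespace IsLocalFinsler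

variable {U : Set Plane} {L : Plane × Plane → ℝ} (h : IsLocalFinsler U L)

include h

theorem isOpen_dom : IsOpen (U ×ˢ ({0}ᶜ : Set Plane)) := h.isOpen.prod isOpen_compl_singleton

theorem contDiffAt {z : Plane × Plane} (h1 : z.1 ∈ U) (h2 : z.2 ≠ 0) : ContDiffAt ℝ ∞ L z :=
  (h.smooth z ⟨h1, h2⟩).contDiffAt (h.isOpen_dom.mem_nhds ⟨h1, h2⟩)

theorem hasFDerivAt {z : Plane × Plane} (h1 : z.1 ∈ U) (h2 : z.2 ≠ 0) :
    HasFDerivAt L (fderiv ℝ L z) z :=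
  ((h.contDiffAt h1 h2).differentiableAt (by simp)).hasFDerivAt

theorem contDiffAt_fibreLegendre {z : Plane × Plane} (h1 : z.1 ∈ U) (h2 : z.2 ≠ 0) :
    ContDiffAt ℝ ∞ (fibreLegendre L) z :=
  (h.contDiffAt h1 h2).smul
    (((h.contDiffAt h1 h2).fderiv_right (m := ∞) (by simp)).clm_comp contDiffAt_const)

/-- Both sides are the derivative at `t = 1` of `t ↦ L (q, t • w)`. -/
theorem euler {q w : Plane} (hq : q ∈ U) (hw : w ≠ 0) : fderiv ℝ L (q, w) (0, w) = L (q, w) := by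
  have h1 : HasDerivAt (fun t : ℝ => L (q, t • w)) (fderiv ℝ L (q, w) (0, w)) 1 := by
    have hz : HasFDerivAt L (fderiv ℝ L (q, w)) (q, (1 : ℝ) • w) := by
      rw [one_smul]; exact h.hasFDerivAt (z := (q, w)) hq hw
    have hc : HasDerivAt (fun t : ℝ => (q, t • w)) ((0 : Plane), w) 1 := by
      have := (hasDerivAt_id (1 : ℝ)).smul_const w
      rw [one_smul] at this
      exact (hasDerivAt_const (1 : ℝ) q).prodMk this
    exact hz.comp_hasDerivAt 1 hc
  have h2 : HasDerivAt (fun t : ℝ => L (q, t • w)) (L (q, w)) 1 := by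
    have h3 : HasDerivAt (fun t : ℝ => t * L (q, w)) (1 * L (q, w)) 1 :=
      (hasDerivAt_id (1 : ℝ)).mul_const _
    rw [one_mul] at h3
    refine h3.congr_of_eventuallyEq ?_
    filter_upwards [lt_mem_nhds (zero_lt_one (α := ℝ))] with t ht
    exact h.homogeneous q hq w t ht
  exact h1.unique h2

theorem fibreLegendre_self {q w : Plane} (hq : q ∈ U) (hw : w ≠ 0) :
    fibreLegendre L (q, w) w = L (q, w) ^ 2 := by
  simp [fibreLegendre, h.euler hq hw, sq]

/-- `L ∂L/∂v` is half the fibre derivative of `L²`, so its own fibre derivative is half the form in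
`strongly_convex`. -/
theorem fibreLegendre_fderiv_pos {q v w : Plane} (hq : q ∈ U) (hv : v ≠ 0) (hw : w ≠ 0) :
    0 < fderiv ℝ (fibreLegendre L) (q, v) (0, w) w := by
  have hline (s : ℝ) : HasDerivAt (fun t : ℝ => (q, v + s • w + t • w)) ((0 : Plane), w) 0 := by
    have := ((hasDerivAt_id (0 : ℝ)).smul_const w).const_add (v + s • w)
    rw [one_smul] at this
    exact (hasDerivAt_const (0 : ℝ) q).prodMk this
  have hline' : HasDerivAt (fun s : ℝ => (q, v + s • w)) ((0 : Plane), w) 0 := by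
    have := ((hasDerivAt_id (0 : ℝ)).smul_const w).const_add v
    rw [one_smul] at this
    exact (hasDerivAt_const (0 : ℝ) q).prodMk this
  -- `L` is smooth only off the zero section.
  have hne : ∀ᶠ s : ℝ in 𝓝 0, v + s • w ≠ 0 := by
    have : Tendsto (fun s : ℝ => v + s • w) (𝓝 0) (𝓝 (v + (0 : ℝ) • w)) :=
      Continuous.tendsto (by fun_prop) _
    rw [zero_smul, add_zero] at this
    exact this.eventually_ne hv
  have hinner : (fun s : ℝ => deriv (fun t : ℝ => L (q, v + s • w + t • w) ^ 2) 0)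
      =ᶠ[𝓝 0] fun s => 2 * fibreLegendre L (q, v + s • w) w := by
    filter_upwards [hne] with s hs
    have hz : HasFDerivAt L (fderiv ℝ L (q, v + s • w)) (q, v + s • w + (0 : ℝ) • w) := by
      rw [zero_smul, add_zero]; exact h.hasFDerivAt (z := (q, v + s • w)) hq hs
    have := ((hz.comp_hasDerivAt (0 : ℝ) (hline s)).pow 2).deriv
    simp only [Function.comp_def] at this
    refine Eq.trans this ?_
    simp [fibreLegendre, mul_assoc]
  have houter : HasDerivAt (fun s : ℝ => 2 * fibreLegendre L (q, v + s • w) w)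
      (2 * fderiv ℝ (fibreLegendre L) (q, v) (0, w) w) 0 := by
    have hz := ((h.contDiffAt_fibreLegendre (z := (q, v)) hq hv).differentiableAt
        (by simp)).hasFDerivAt
    exact (hasDerivAt_clm_eval hz hline' (by simp) w).const_mul 2
  have hpos := h.strongly_convex q hq v w hv hw
  rw [hinner.deriv_eq, houter.deriv] at hpos
  linarith

/-- The Legendre transformation is injective on the fibres off zero. -/
theorem fibreLegendre_injective {q v w : Plane} (hq : q ∈ U) (hv : v ≠ 0) (hw : w ≠ 0)
    (heq : fibreLegendre L (q, v) = fibreLegendre L (q, w)) : v = w := by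
  by_contra hvw
  have hd : w - v ≠ 0 := sub_ne_zero.2 (Ne.symm hvw)
  -- If the segment from `v` to `w` passes through `0`, smoothness fails there. Then a convex
  -- combination of `v` and `w` is `0`, and the common covector would give it the positive value `(1
  -- - t) L(v)² + t L(w)²`. Otherwise the covector evaluated on `w - v` increases strictly along the
  -- segment.
  by_cases h0 : ∃ t ∈ Icc (0 : ℝ) 1, v + t • (w - v) = 0
  · obtain ⟨t, ht, h0⟩ := h0
    have h1 : (1 - t) • v + t • w = 0 := by rw [← h0]; module
    have ht0 : t ≠ 0 := by rintro rfl; simp [hv] at h1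
    have ht1 : t ≠ 1 := by rintro rfl; simp [hw] at h1
    have h2 := congrArg (fibreLegendre L (q, v)) h1
    rw [map_add, map_smul, map_smul, map_zero] at h2
    nth_rw 2 [heq] at h2
    rw [h.fibreLegendre_self hq hv, h.fibreLegendre_self hq hw, smul_eq_mul, smul_eq_mul] at h2
    have p1 := h.pos q hq v hv
    have p2 := h.pos q hq w hw
    have q1 : 0 < t := lt_of_le_of_ne ht.1 ht0.symm
    have q2 : 0 < 1 - t := sub_pos.2 (lt_of_le_of_ne ht.2 ht1)
    have : 0 < (1 - t) * L (q, v) ^ 2 + t * L (q, w) ^ 2 := by positivity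
    exact this.ne' h2
  · push Not at h0
    have hder (t : ℝ) (ht : t ∈ Icc (0 : ℝ) 1) :
        HasDerivAt (fun t : ℝ => fibreLegendre L (q, v + t • (w - v)) (w - v))
          (fderiv ℝ (fibreLegendre L) (q, v + t • (w - v)) (0, w - v) (w - v)) t := by
      have hline : HasDerivAt (fun s : ℝ => (q, v + s • (w - v))) ((0 : Plane), w - v) t := by
        have := ((hasDerivAt_id t).smul_const (w - v)).const_add v
        rw [one_smul] at this
        exact (hasDerivAt_const t q).prodMk this
      have hz := ((h.contDiffAt_fibreLegendre (z := (q, v + t • (w - v))) hq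
        (h0 t ht)).differentiableAt (by simp)).hasFDerivAt
      exact hasDerivAt_clm_eval hz hline rfl (w - v)
    have hmono : StrictMonoOn (fun t : ℝ => fibreLegendre L (q, v + t • (w - v)) (w - v))
        (Icc 0 1) := by
      refine strictMonoOn_of_deriv_pos (convex_Icc 0 1)
        (fun t ht => (hder t ht).continuousAt.continuousWithinAt) fun t ht => ?_
      have ht := interior_subset ht
      rw [(hder t ht).deriv]
      exact h.fibreLegendre_fderiv_pos hq (h0 t ht) hd
    have := hmono (left_mem_Icc.2 zero_le_one) (right_mem_Icc.2 zero_le_one) zero_lt_one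
    simp [heq] at this

theorem hasFDerivAt_localLegendre {z : Plane × Plane} (h1 : z.1 ∈ U) (h2 : z.2 ≠ 0) :
    HasFDerivAt (localLegendre L)
      ((ContinuousLinearMap.fst ℝ Plane Plane).prod (fderiv ℝ (fibreLegendre L) z)) z :=
  hasFDerivAt_fst.prodMk
    ((h.contDiffAt_fibreLegendre h1 h2).differentiableAt (by simp)).hasFDerivAt

theorem contDiffAt_localLegendre {z : Plane × Plane} (h1 : z.1 ∈ U) (h2 : z.2 ≠ 0) :
    ContDiffAt ℝ ∞ (localLegendre L) z :=
  contDiffAt_fst.prodMk (h.contDiffAt_fibreLegendre h1 h2)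

theorem localLegendre_injOn : InjOn (localLegendre L) (U ×ˢ {0}ᶜ) := by
  rintro ⟨q, v⟩ ⟨hq, hv⟩ ⟨q', w⟩ ⟨-, hw⟩ heq
  obtain ⟨rfl, h2⟩ := Prod.ext_iff.1 heq
  exact Prod.ext rfl (h.fibreLegendre_injective hq hv hw h2)

/-- The derivative is block triangular, with the identity on the base and a positive definite block
on the fibre. It is therefore injective, and the dimensions agree. -/
theorem exists_equiv_fderiv_localLegendre {z : Plane × Plane} (h1 : z.1 ∈ U) (h2 : z.2 ≠ 0) :
    ∃ D : (Plane × Plane) ≃L[ℝ] Phase, HasFDerivAt (localLegendre L)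
      (D : (Plane × Plane) →L[ℝ] Phase) z := by
  set D := (ContinuousLinearMap.fst ℝ Plane Plane).prod (fderiv ℝ (fibreLegendre L) z) with hD
  have hinj : Function.Injective D := by
    rw [injective_iff_map_eq_zero]
    rintro ⟨a, u⟩ hau
    obtain ⟨rfl, hu⟩ : a = 0 ∧ fderiv ℝ (fibreLegendre L) z (a, u) = 0 := by
      simpa [hD, Prod.ext_iff] using hau
    by_contra hne
    have hu0 : u ≠ 0 := fun h => hne (by simp [h])
    have := h.fibreLegendre_fderiv_pos (q := z.1) (v := z.2) h1 h2 hu0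
    rw [Prod.mk.eta, hu] at this
    simp at this
  have hdim : Module.finrank ℝ (Plane × Plane) = Module.finrank ℝ Phase := by
    have : Module.finrank ℝ DualPlane = Module.finrank ℝ Plane := by
      rw [← LinearEquiv.finrank_eq (LinearMap.toContinuousLinearMap (𝕜 := ℝ) (E := Plane)
        (F' := ℝ))]
      exact Subspace.dual_finrank_eq
    rw [Module.finrank_prod, Module.finrank_prod, this]
  refine ⟨(LinearEquiv.ofInjectiveOfFinrankEq D.toLinearMap hinj hdim).toContinuousLinearEquiv, ?_⟩
  have : (((LinearEquiv.ofInjectiveOfFinrankEq D.toLinearMap hinj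
      hdim).toContinuousLinearEquiv : (Plane × Plane) ≃L[ℝ] Phase) :
      (Plane × Plane) →L[ℝ] Phase) = D := by
    refine ContinuousLinearMap.ext fun x => rfl
  rw [this]
  exact h.hasFDerivAt_localLegendre h1 h2

/-- A smooth local inverse of the Legendre transformation. -/
theorem exists_localLegendre_inverse {z₀ : Plane × Plane} (h1 : z₀.1 ∈ U) (h2 : z₀.2 ≠ 0) :
    ∃ (O : Set Phase) (g : Phase → Plane × Plane), IsOpen O ∧ localLegendre L z₀ ∈ O ∧
      ContDiffOn ℝ ∞ g O ∧ (∀ z ∈ O, g z ∈ U ×ˢ ({0}ᶜ : Set Plane) ∧ localLegendre L (g z) = z) := by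
  obtain ⟨D, hD⟩ := h.exists_equiv_fderiv_localLegendre h1 h2
  set e := ((h.contDiffAt_localLegendre h1 h2).toOpenPartialHomeomorph (localLegendre L) hD
    (by simp)).restrOpen _ h.isOpen_dom with he
  have hecoe (x) : e x = localLegendre L x := rfl
  have hsrc : e.source ⊆ U ×ˢ ({0}ᶜ : Set Plane) := inter_subset_right
  have hz0 : z₀ ∈ e.source :=
    ⟨ContDiffAt.mem_toOpenPartialHomeomorph_source (h.contDiffAt_localLegendre h1 h2) hD (by simp),
      h1, h2⟩
  refine ⟨e.target, e.symm, e.open_target, e.map_source hz0, fun z hz => ?_,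
    fun z hz => ⟨hsrc (e.map_target hz), e.right_inv hz⟩⟩
  have hm := hsrc (e.map_target hz)
  obtain ⟨D', hD'⟩ := h.exists_equiv_fderiv_localLegendre hm.1 hm.2
  exact (e.contDiffAt_symm hz hD' (h.contDiffAt_localLegendre hm.1 hm.2)).contDiffWithinAt

end IsLocalFinsler

/-- The kinetic energy which belongs to a (dual) norm function. -/
def energy (H : Phase → ℝ) (z : Phase) : ℝ := H z ^ 2 / 2

/-- `H` restricts on `O` to the dual norm of a Finsler function. -/
structure IsDualNormOn (H : Phase → ℝ) (O : Set Phase) : Prop where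
  isOpen : IsOpen O
  smooth : ContDiffOn ℝ ∞ H O
  pos : ∀ z ∈ O, 0 < H z
  euler : ∀ z ∈ O, fderiv ℝ (energy H) z (0, z.2) = 2 * energy H z
  nondegenerate : ∀ z ∈ O, ∀ α : DualPlane,
    (∀ β : DualPlane, fderiv ℝ (fderiv ℝ (energy H)) z (0, α) (0, β) = 0) → α = 0

theorem contDiffOn_energy {H : Phase → ℝ} {O : Set Phase} (hH : ContDiffOn ℝ ∞ H O) :
    ContDiffOn ℝ ∞ (energy H) O :=
  (hH.pow 2).div_const 2

/-- With `g` a local inverse of the Legendre transformation and `w = (g z).2`, the energy equals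
`p(w) - L² / 2`. Since `p = L ∂L/∂w`, the variation of `w` drops out of its differential, which
leaves `dp(w) - L ∂L/∂q dq`, that is, Hamilton's equations. The Euler relation is `p(w) = L²`, and
the fibre Hessian is nondegenerate because it is the fibre derivative of the invertible map `g`. -/
theorem IsLocalFinsler.exists_isDualNormOn {U : Set Plane} {L : Plane × Plane → ℝ}
    (h : IsLocalFinsler U L) {H : Phase → ℝ}
    (hH : ∀ z ∈ U ×ˢ ({0}ᶜ : Set Plane), H (localLegendre L z) = L z)
    {z₀ : Plane × Plane} (h1 : z₀.1 ∈ U) (h2 : z₀.2 ≠ 0) :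
    ∃ O : Set Phase, localLegendre L z₀ ∈ O ∧ IsDualNormOn H O ∧
      O ⊆ localLegendre L '' (U ×ˢ ({0}ᶜ : Set Plane)) ∧
      ∀ z ∈ U ×ˢ ({0}ᶜ : Set Plane), localLegendre L z ∈ O → ∀ b : Phase,
        fderiv ℝ (energy H) (localLegendre L z) b = b.2 z.2 - L z * fderiv ℝ L z (b.1, 0) := by
  obtain ⟨O, g, hO, hz0, hg, hgO⟩ := h.exists_localLegendre_inverse h1 h2
  have hHg (z) (hz : z ∈ O) : H z = L (g z) := by
    conv_lhs => rw [← (hgO z hz).2]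
    exact hH _ (hgO z hz).1
  have hHsmooth : ContDiffOn ℝ ∞ H O := fun z hz => by
    have hLg : ContDiffWithinAt ℝ ∞ (L ∘ g) O z :=
      (h.contDiffAt (hgO z hz).1.1 (hgO z hz).1.2).comp_contDiffWithinAt z (hg z hz)
    exact hLg.congr hHg (hHg z hz)
  have hgd (z) (hz : z ∈ O) : HasFDerivAt g (fderiv ℝ g z) z :=
    (((hg z hz).contDiffAt (hO.mem_nhds hz)).differentiableAt (by simp)).hasFDerivAt
  have hg1 (z) (hz : z ∈ O) : (g z).1 = z.1 := congrArg Prod.fst (hgO z hz).2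
  have hdg1 (z) (hz : z ∈ O) (b : Phase) : (fderiv ℝ g z b).1 = b.1 := by
    have e1 := (hgd z hz).fst
    have e2 : HasFDerivAt (fun y : Phase => y.1) (ContinuousLinearMap.fst ℝ Plane DualPlane) z :=
      hasFDerivAt_fst
    exact congrArg (fun A => A b) (e1.unique (e2.congr_of_eventuallyEq
      (by filter_upwards [hO.mem_nhds hz] with y hy using hg1 y hy)))
  have hder (z) (hz : z ∈ O) : HasFDerivAt (energy H)
      ((ContinuousLinearMap.apply ℝ ℝ (g z).2).comp (ContinuousLinearMap.snd ℝ Plane DualPlane) -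
        L (g z) • ((fderiv ℝ L (g z)).comp (ContinuousLinearMap.inl ℝ Plane Plane)).comp
          (ContinuousLinearMap.fst ℝ Plane DualPlane)) z := by
    have hm := (hgO z hz).1
    have hLd := h.hasFDerivAt hm.1 hm.2
    -- Differentiating `p(w) - L² / 2` instead of `L² / 2` is what makes the derivative of `w`
    -- cancel.
    have e1 : HasFDerivAt (fun y : Phase => y.2 (g y).2 - L (g y) ^ 2 / 2) _ z :=
      (hasFDerivAt_snd.clm_apply (hgd z hz).snd).sub
        (((hLd.comp z (hgd z hz)).pow 2).mul_const (2⁻¹ : ℝ))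
    have hval : energy H =ᶠ[𝓝 z] fun y : Phase => y.2 (g y).2 - L (g y) ^ 2 / 2 := by
      filter_upwards [hO.mem_nhds hz] with y hy
      have hm' := (hgO y hy).1
      have e : y.2 (g y).2 = L (g y) ^ 2 := by
        have := h.fibreLegendre_self (q := (g y).1) (w := (g y).2) hm'.1 hm'.2
        rw [Prod.mk.eta] at this
        rw [← this]
        exact congrArg (fun w : Phase => w.2 (g y).2) (hgO y hy).2.symm
      rw [e, energy, hHg y hy]
      ring
    refine (e1.congr_of_eventuallyEq hval).congr_fderiv ?_
    refine ContinuousLinearMap.ext fun b => ?_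
    have hz2 : z.2 = fibreLegendre L (g z) := congrArg Prod.snd (hgO z hz).2.symm
    have hsplit : fderiv ℝ L (g z) (fderiv ℝ g z b) =
        fderiv ℝ L (g z) (b.1, 0) + fderiv ℝ L (g z) (0, (fderiv ℝ g z b).2) := by
      rw [← map_add, ← hdg1 z hz b]
      simp
    simp only [_root_.sub_apply, _root_.add_apply,
      ContinuousLinearMap.comp_apply, _root_.smul_apply,
      ContinuousLinearMap.apply_apply, ContinuousLinearMap.flip_apply, smul_eq_mul,
      ContinuousLinearMap.inl_apply, ContinuousLinearMap.coe_fst', ContinuousLinearMap.coe_snd',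
      Function.comp_apply, hsplit, hz2, fibreLegendre, ContinuousLinearMap.inr_apply]
    simp
    ring
  have hderiv (z) (hz : z ∈ O) (b : Phase) :
      fderiv ℝ (energy H) z b = b.2 (g z).2 - L (g z) * fderiv ℝ L (g z) (b.1, 0) := by
    rw [(hder z hz).fderiv]
    simp
  refine ⟨O, hz0, ⟨hO, hHsmooth, fun z hz => ?_, fun z hz => ?_, fun z hz α hα => ?_⟩,
    fun z hz => ⟨g z, hgO z hz⟩, fun z hz hzO b => ?_⟩
  · rw [hHg z hz]
    exact h.pos _ (hgO z hz).1.1 _ (hgO z hz).1.2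
  · rw [hderiv z hz, energy, hHg z hz]
    have hm' := (hgO z hz).1
    have e : z.2 (g z).2 = L (g z) ^ 2 := by
      have := h.fibreLegendre_self (q := (g z).1) (w := (g z).2) hm'.1 hm'.2
      rw [Prod.mk.eta] at this
      rw [← this]
      exact congrArg (fun w : Phase => w.2 (g z).2) (hgO z hz).2.symm
    have h0 : ((0 : Plane), (0 : Plane)) = 0 := rfl
    simp only [e, h0, map_zero]
    ring
  · have hK : ContDiffAt ℝ ∞ (energy H) z :=
      (contDiffOn_energy hHsmooth z hz).contDiffAt (hO.mem_nhds hz)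
    have hK2 : HasFDerivAt (fderiv ℝ (energy H)) (fderiv ℝ (fderiv ℝ (energy H)) z) z :=
      (hK.of_le two_le_infty).hasFDerivAt_fderiv
    -- The fibre gradient of the energy is the vector `(g y).2`, so a kernel vector of the fibre
    -- Hessian does not move it.
    have hv (β : DualPlane) : β (fderiv ℝ g z (0, α)).2 = 0 := by
      have e1 := hasFDerivAt_clm_eval hK2 ((0 : Plane), β)
      have e2 : HasFDerivAt (fun y => β (g y).2) _ z := β.hasFDerivAt.comp z (hgd z hz).snd
      have hEq : (fun y => fderiv ℝ (energy H) y (0, β)) =ᶠ[𝓝 z] fun y => β (g y).2 := by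
        filter_upwards [hO.mem_nhds hz] with y hy
        have h0 : ((0 : Plane), (0 : Plane)) = 0 := rfl
        rw [hderiv y hy]
        simp only [h0, map_zero]
        ring
      have := congrArg (fun A => A ((0 : Plane), α)) (e1.unique (e2.congr_of_eventuallyEq hEq))
      exact this.symm.trans (hα β)
    have h2z : (fderiv ℝ g z (0, α)).2 = 0 := by
      by_contra hne
      obtain ⟨β, -, hβ⟩ := exists_dual_vector ℝ _ (norm_ne_zero_iff.2 hne)
      rw [hv β] at hβ
      exact hne (norm_eq_zero.1 (by simpa using hβ.symm))
    have hzero : fderiv ℝ g z (0, α) = 0 := Prod.ext (hdg1 z hz _) h2z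
    obtain ⟨D, hD⟩ := h.exists_equiv_fderiv_localLegendre (hgO z hz).1.1 (hgO z hz).1.2
    have e1 : HasFDerivAt (localLegendre L ∘ g) _ z := hD.comp z (hgd z hz)
    have e2 := (hasFDerivAt_id (𝕜 := ℝ) z).congr_of_eventuallyEq
      (f₁ := localLegendre L ∘ g) (by
        filter_upwards [hO.mem_nhds hz] with y hy using (hgO y hy).2)
    have := congrArg (fun A => A ((0 : Plane), α)) (e1.unique e2)
    simp only [ContinuousLinearMap.comp_apply, hzero, map_zero, ContinuousLinearMap.id_apply]
      at this
    exact (congrArg Prod.snd this).symm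
  · have hgz : g (localLegendre L z) = z :=
      h.localLegendre_injOn (hgO _ hzO).1 hz (hgO _ hzO).2
    rw [hderiv _ hzO, hgz]

/-! ### Finsler metrics in charts -/

section

variable {M : Type*} [TopologicalSpace M] [ChartedSpace Plane M] [IsManifold (𝓡 2) ∞ M]
  {F : TangentBundle (𝓡 2) M → ℝ}

theorem chartExpr_apply (F : TangentBundle (𝓡 2) M → ℝ) {c : M} {q : Plane}
    (hq : q ∈ (extChartAt (𝓡 2) c).target) (w : Plane) :
    chartExpr F c (q, w) =
      F (tanMk ((extChartAt (𝓡 2) c).symm q) (coordFrom c ((extChartAt (𝓡 2) c).symm q) w)) := by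
  rw [← tanChart_symm_apply hq]; rfl

theorem chartExpr_tanChart (F : TangentBundle (𝓡 2) M → ℝ) {c : M} {p : TangentBundle (𝓡 2) M}
    (hp : p.1 ∈ (extChartAt (𝓡 2) c).source) : chartExpr F c (tanChart c p) = F p :=
  congrArg F ((tanChart c).left_inv (mem_tanChart_source.2 hp))

theorem coordFrom_ne_zero {c x : M} (hx : x ∈ (extChartAt (𝓡 2) c).source) {w : Plane}
    (hw : w ≠ 0) : coordFrom c x w ≠ 0 := fun h => hw <| by
  rw [← coordTo_coordFrom hx w, h, map_zero]

theorem coordTo_ne_zero {c x : M} (hx : x ∈ (extChartAt (𝓡 2) c).source) {w : Plane}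
    (hw : w ≠ 0) : coordTo c x w ≠ 0 := fun h => hw <| by
  rw [← coordFrom_coordTo hx w, h, map_zero]

theorem IsFinslerMetric.isLocalFinsler (hF : IsFinslerMetric F) (c : M) :
    IsLocalFinsler (extChartAt (𝓡 2) c).target (chartExpr F c) where
  isOpen := isOpen_chartTarget c
  pos q hq w hw := by
    rw [chartExpr_apply F hq]
    exact hF.pos _ _ (coordFrom_ne_zero ((extChartAt (𝓡 2) c).map_target hq) hw)
  smooth := by
    have h1 : ContMDiffOn 𝓘(ℝ, Plane × Plane) (𝓡 2).tangent ∞ (tanChart c).symm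
        (tanChart c).target := contMDiffOn_extChartAt_symm _
    have hsub : (extChartAt (𝓡 2) c).target ×ˢ ({0}ᶜ : Set Plane) ⊆ (tanChart c).target :=
      fun z hz => mem_tanChart_target.2 hz.1
    have h1' := h1.mono hsub
    have h2 := hF.smooth.comp h1' (fun z hz => by
        obtain ⟨q, w⟩ := z
        rw [mem_preimage, tanChart_symm_apply hz.1]
        exact coordFrom_ne_zero ((extChartAt (𝓡 2) c).map_target hz.1) hz.2)
    exact h2.contDiffOn
  homogeneous q hq w a ha := by
    rw [chartExpr_apply F hq, chartExpr_apply F hq, map_smul]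
    exact hF.homogeneous _ _ a ha
  strongly_convex q hq v w hv hw := by
    have hx := (extChartAt (𝓡 2) c).map_target hq
    have := hF.strongly_convex ((extChartAt (𝓡 2) c).symm q) _ _ (coordFrom_ne_zero hx hv)
      (coordFrom_ne_zero hx hw)
    have e (s t : ℝ) : chartExpr F c (q, v + s • w + t • w) = 
        F (tanMk ((extChartAt (𝓡 2) c).symm q) (coordFrom c ((extChartAt (𝓡 2) c).symm q) v
          + s • coordFrom c ((extChartAt (𝓡 2) c).symm q) w
          + t • coordFrom c ((extChartAt (𝓡 2) c).symm q) w)) := by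
      rw [chartExpr_apply F hq, map_add, map_add, map_smul, map_smul]
    simp only [e]
    exact this

/-- The fibre derivative as a covector of the plane. -/
def legendreCovec (F : TangentBundle (𝓡 2) M → ℝ) (x : M) (v : Plane) : DualPlane :=
  F (tanMk x v) • fderiv ℝ (fun w : Plane => F (tanMk x w)) v

omit [IsManifold (𝓡 2) ∞ M] in
theorem legendre_tanMk (F : TangentBundle (𝓡 2) M → ℝ) (x : M) (v : Plane) :
    legendre F (tanMk x v) = cotMk x (legendreCovec F x v) := rfl

theorem IsFinslerMetric.legendreCovec_eq (hF : IsFinslerMetric F) {c x : M}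
    (hx : x ∈ (extChartAt (𝓡 2) c).source) {v : Plane} (hv : v ≠ 0) :
    legendreCovec F x v =
      (fibreLegendre (chartExpr F c) (tanChart c (tanMk x v))).comp (coordTo c x) := by
  have hL := (hF.isLocalFinsler c).hasFDerivAt (z := tanChart c (tanMk x v))
    ((extChartAt (𝓡 2) c).map_source hx) (coordTo_ne_zero hx hv)
  have hc : HasFDerivAt (fun w : Plane => tanChart c (tanMk x w))
      ((ContinuousLinearMap.inr ℝ Plane Plane).comp (coordTo c x)) v := by
    have h := (hasFDerivAt_const (extChartAt (𝓡 2) c x) v).prodMk (coordTo c x).hasFDerivAt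
    refine h.congr_fderiv (ContinuousLinearMap.ext fun w => rfl)
  have hd : HasFDerivAt (fun w : Plane => F (tanMk x w))
      ((fderiv ℝ (chartExpr F c) (tanChart c (tanMk x v))).comp
        ((ContinuousLinearMap.inr ℝ Plane Plane).comp (coordTo c x))) v := by
    refine (hL.comp v hc).congr_of_eventuallyEq (Eventually.of_forall fun w => ?_)
    exact (chartExpr_tanChart F (p := tanMk x w) hx).symm
  rw [legendreCovec, fibreLegendre, hd.fderiv, chartExpr_tanChart F (p := tanMk x v) hx]
  rfl

theorem IsFinslerMetric.cotChart_legendre (hF : IsFinslerMetric F) {c x : M}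
    (hx : x ∈ (extChartAt (𝓡 2) c).source) {v : Plane} (hv : v ≠ 0) :
    cotChart c (legendre F (tanMk x v)) =
      localLegendre (chartExpr F c) (tanChart c (tanMk x v)) := by
  rw [legendre_tanMk, cotChart_apply hx, hF.legendreCovec_eq hx hv]
  refine Prod.ext rfl (ContinuousLinearMap.ext fun w => ?_)
  exact congrArg (fibreLegendre (chartExpr F c) (tanChart c (tanMk x v)))
    (coordTo_coordFrom hx w)

/-- The zero vector needs its own argument, as `F` is not smooth there: its image is `0` because `F`
vanishes, whereas the image of `v ≠ 0` takes the value `F(v)² > 0` on `v`. -/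
theorem IsFinslerMetric.legendreCovec_injective (hF : IsFinslerMetric F) (x : M) :
    Function.Injective (legendreCovec F x) := by
  have hx := mem_extChartAt_source (I := 𝓡 2) x
  have h0 : legendreCovec F x 0 = 0 := by
    rw [legendreCovec, show F (tanMk x 0) = 0 from hF.map_zero x, zero_smul]
  have hid (w : Plane) : coordTo x x w = w := tangentCoordChange_self hx
  have hdef (v : Plane) (hv : v ≠ 0) : legendreCovec F x v =
      fibreLegendre (chartExpr F x) (extChartAt (𝓡 2) x x, v) := by
    rw [hF.legendreCovec_eq hx hv, tanChart_apply, hid]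
    exact ContinuousLinearMap.ext fun w => congrArg
      (fibreLegendre (chartExpr F x) (extChartAt (𝓡 2) x x, v)) (hid w)
  have hq := (extChartAt (𝓡 2) x).map_source hx
  have hne (v : Plane) (hv : v ≠ 0) : legendreCovec F x v ≠ 0 := by
    intro h
    rw [hdef v hv] at h
    have := (hF.isLocalFinsler x).fibreLegendre_self hq hv
    rw [h] at this
    have hp := (hF.isLocalFinsler x).pos _ hq v hv
    exact absurd this (by simpa using (pow_pos hp 2).ne)
  intro v w hvw
  by_cases hv : v = 0
  · by_contra h
    rw [hv, h0] at hvw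
    exact hne w (fun h' => h (hv.trans h'.symm)) hvw.symm
  by_cases hw : w = 0
  · rw [hw, h0] at hvw
    exact absurd hvw (hne v hv)
  rw [hdef v hv, hdef w hw] at hvw
  exact (hF.isLocalFinsler x).fibreLegendre_injective hq hv hw hvw

/-- Injectivity alone makes `Function.invFun` a left inverse, so surjectivity of the Legendre
transformation never enters. -/
theorem IsFinslerMetric.dualMetric_legendre (hF : IsFinslerMetric F) (p : TangentBundle (𝓡 2) M) :
    dualMetric F (legendre F p) = F p :=
  congrArg (fun v : Plane => F (tanMk p.1 v))
    (Function.leftInverse_invFun (hF.legendreCovec_injective p.1) (vec p))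

/-- The coordinate expression of the dual metric. -/
def dualExpr (F : TangentBundle (𝓡 2) M → ℝ) (c : M) (z : Phase) : ℝ :=
  dualMetric F ((cotChart c).symm z)

theorem dualExpr_cotChart (F : TangentBundle (𝓡 2) M → ℝ) {c : M} {e : CotangentBundle M}
    (he : e ∈ (cotChart c).source) : dualExpr F c (cotChart c e) = dualMetric F e :=
  congrArg (dualMetric F) ((cotChart c).left_inv he)

/-- In the domain of a chart, every point of the coordinate tangent bundle comes from a vector. -/
theorem exists_tanChart_eq {c : M} {z : Plane × Plane}
    (hz : z ∈ (extChartAt (𝓡 2) c).target ×ˢ ({0}ᶜ : Set Plane)) :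
    ∃ (x : M) (v : Plane), x ∈ (extChartAt (𝓡 2) c).source ∧ v ≠ 0 ∧ tanChart c (tanMk x v) = z := by
  obtain ⟨q, w⟩ := z
  have hx := (extChartAt (𝓡 2) c).map_target hz.1
  refine ⟨_, coordFrom c ((extChartAt (𝓡 2) c).symm q) w, hx, coordFrom_ne_zero hx hz.2, ?_⟩
  rw [tanChart_apply, coordTo_coordFrom hx, (extChartAt (𝓡 2) c).right_inv hz.1]

theorem IsFinslerMetric.dualExpr_localLegendre (hF : IsFinslerMetric F) {c : M} {z : Plane × Plane}
    (hz : z ∈ (extChartAt (𝓡 2) c).target ×ˢ ({0}ᶜ : Set Plane)) :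
    dualExpr F c (localLegendre (chartExpr F c) z) = chartExpr F c z := by
  obtain ⟨x, v, hx, hv, rfl⟩ := exists_tanChart_eq hz
  rw [← hF.cotChart_legendre hx hv, dualExpr_cotChart F (mem_cotChart_source.2 hx),
    hF.dualMetric_legendre, chartExpr_tanChart F hx]

/-- Near the Legendre transform of a nonzero vector, the dual metric is smooth, and the
differential of the kinetic energy is given by Hamilton's equations. -/
theorem IsFinslerMetric.exists_isDualNormOn (hF : IsFinslerMetric F) {c x : M}
    (hx : x ∈ (extChartAt (𝓡 2) c).source) {v : Plane} (hv : v ≠ 0) :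
    ∃ O : Set Phase, cotChart c (legendre F (tanMk x v)) ∈ O ∧ IsDualNormOn (dualExpr F c) O ∧
      (∀ z ∈ O, ∃ (y : M) (w : Plane), y ∈ (extChartAt (𝓡 2) c).source ∧ w ≠ 0 ∧
        cotChart c (legendre F (tanMk y w)) = z) ∧
      ∀ b : Phase, fderiv ℝ (energy (dualExpr F c)) (cotChart c (legendre F (tanMk x v))) b =
        b.2 (coordTo c x v) - F (tanMk x v) *
          fderiv ℝ (chartExpr F c) (tanChart c (tanMk x v)) (b.1, 0) := by
  have hq := (extChartAt (𝓡 2) c).map_source hx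
  have hw := coordTo_ne_zero hx hv
  obtain ⟨O, hO, h1, h2, h3⟩ := (hF.isLocalFinsler c).exists_isDualNormOn
    (fun z hz => hF.dualExpr_localLegendre hz) (z₀ := tanChart c (tanMk x v)) hq hw
  rw [hF.cotChart_legendre hx hv]
  refine ⟨O, hO, h1, fun z hz => ?_, fun b => ?_⟩
  · obtain ⟨y, hy, rfl⟩ := h2 hz
    obtain ⟨x', v', hx', hv', rfl⟩ := exists_tanChart_eq hy
    exact ⟨x', v', hx', hv', hF.cotChart_legendre hx' hv'⟩
  · rw [h3 (tanChart c (tanMk x v)) ⟨hq, hw⟩ hO, chartExpr_tanChart F (p := tanMk x v) hx]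
    rfl

/-! ### Conformal changes of a Finsler metric -/

/-- The metric `u F`. -/
def conformal (u : M → ℝ) (F : TangentBundle (𝓡 2) M → ℝ) (p : TangentBundle (𝓡 2) M) : ℝ :=
  u p.1 * F p

/-- The Legendre transformation of `u F` is `u²` times that of `F`, and it is positively homogeneous
of degree one because `∂F/∂v` has degree zero. -/
theorem IsFinslerMetric.legendreCovec_conformal_smul (hF : IsFinslerMetric F) {u : M → ℝ} {x : M}
    (hu : 0 < u x) (v : Plane) :
    legendreCovec (conformal u F) x (((u x) ^ 2)⁻¹ • v) = legendreCovec F x v := by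
  set a := ((u x) ^ 2)⁻¹ with ha
  have ha0 : 0 < a := by positivity
  have h1 : fderiv ℝ (fun w : Plane => F (tanMk x w)) (a • v) =
      fderiv ℝ (fun w : Plane => F (tanMk x w)) v := by
    have h2 : (fun w : Plane => F (tanMk x (a • w))) = fun w => a • F (tanMk x w) :=
      funext fun w => hF.homogeneous x w a ha0
    have h3 := fderiv_comp_smul (𝕜 := ℝ) (f := fun w : Plane => F (tanMk x w)) (x := v) a
    have h4 := fderiv_const_smul_field (𝕜 := ℝ) (f := fun w : Plane => F (tanMk x w)) a
    have h5 : a • fderiv ℝ (fun w : Plane => F (tanMk x w)) (a • v) =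
        a • fderiv ℝ (fun w : Plane => F (tanMk x w)) v := by
      rw [← h3, h2]; exact congrFun h4 v
    exact smul_right_injective _ ha0.ne' h5
  have h6 : fderiv ℝ (fun w : Plane => conformal u F (tanMk x w)) (a • v) =
      u x • fderiv ℝ (fun w : Plane => F (tanMk x w)) (a • v) :=
    congrFun (fderiv_const_smul_field (𝕜 := ℝ) (f := fun w : Plane => F (tanMk x w)) (u x)) (a • v)
  have h7 : F (tanMk x (a • v)) = a * F (tanMk x v) := hF.homogeneous x v a ha0
  rw [legendreCovec, legendreCovec, h6, h1, smul_smul]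
  congr 1
  change u x * F (tanMk x (a • v)) * u x = _
  rw [h7, ha]
  field_simp

/-- The preimage of the covector under the new Legendre transformation is `u⁻² v`, and `u F(u⁻² v) =
F(v) / u`: a conformal factor divides the dual norm. -/
theorem IsFinslerMetric.dualMetric_conformal_legendre (hF : IsFinslerMetric F) {u : M → ℝ}
    (hu : ∀ x, 0 < u x) (hFu : IsFinslerMetric (conformal u F)) (x : M) (v : Plane) :
    dualMetric (conformal u F) (legendre F (tanMk x v)) = F (tanMk x v) / u x := by
  have h : legendre F (tanMk x v) = legendre (conformal u F) (tanMk x (((u x) ^ 2)⁻¹ • v)) := by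
    rw [legendre_tanMk, legendre_tanMk, hF.legendreCovec_conformal_smul (hu x)]
  have h7 : F (tanMk x (((u x) ^ 2)⁻¹ • v)) = ((u x) ^ 2)⁻¹ * F (tanMk x v) :=
    hF.homogeneous x v _ (by have := hu x; positivity)
  rw [h, hFu.dualMetric_legendre]
  change u x * F (tanMk x (((u x) ^ 2)⁻¹ • v)) = _
  rw [h7]
  have := (hu x).ne'
  field_simp

end

section

variable {M : Type*} [TopologicalSpace M] [ChartedSpace Plane M] [IsManifold (𝓡 2) ∞ M]
  {F : TangentBundle (𝓡 2) M → ℝ}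

/-- The coordinate expression of a function on the surface. -/
def baseExpr (f : M → ℝ) (c : M) (q : Plane) : ℝ := f ((extChartAt (𝓡 2) c).symm q)

theorem contDiffOn_baseExpr {f : M → ℝ} (hf : ContMDiff (𝓡 2) 𝓘(ℝ, ℝ) ∞ f) (c : M) :
    ContDiffOn ℝ ∞ (baseExpr f c) (extChartAt (𝓡 2) c).target :=
  (hf.comp_contMDiffOn (contMDiffOn_extChartAt_symm (I := 𝓡 2) (n := ∞) c)).contDiffOn

theorem contDiffAt_baseExpr {f : M → ℝ} (hf : ContMDiff (𝓡 2) 𝓘(ℝ, ℝ) ∞ f) {c : M} {q : Plane}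
    (hq : q ∈ (extChartAt (𝓡 2) c).target) : ContDiffAt ℝ ∞ (baseExpr f c) q :=
  (contDiffOn_baseExpr hf c q hq).contDiffAt ((isOpen_chartTarget c).mem_nhds hq)

theorem chartExpr_conformal (u : M → ℝ) (F : TangentBundle (𝓡 2) M → ℝ) {c : M}
    {z : Plane × Plane} (hz : z.1 ∈ (extChartAt (𝓡 2) c).target) :
    chartExpr (conformal u F) c z = baseExpr u c z.1 * chartExpr F c z := by
  obtain ⟨q, w⟩ := z
  rw [chartExpr_apply _ hz, chartExpr_apply _ hz]
  rfl

theorem IsFinslerMetric.conformal (hF : IsFinslerMetric F) {u : M → ℝ} (hu : ∀ x, 0 < u x)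
    (hus : ContMDiff (𝓡 2) 𝓘(ℝ, ℝ) ∞ u) : IsFinslerMetric (conformal u F) where
  map_zero x := by simp [FinslerSurface.conformal, hF.map_zero x]
  pos x v hv := mul_pos (hu x) (hF.pos x v hv)
  smooth := by
    have h1 : ContMDiff (𝓡 2).tangent 𝓘(ℝ, ℝ) ∞ (fun p : TangentBundle (𝓡 2) M => u p.1) :=
      hus.comp (contMDiff_proj (TangentSpace (𝓡 2)))
    exact h1.contMDiffOn.mul hF.smooth
  homogeneous x v a ha := by
    have := hF.homogeneous x v a ha
    simp only [FinslerSurface.conformal, this]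
    ring
  strongly_convex x v w hv hw := by
    have h := hF.strongly_convex x v w hv hw
    simp only [FinslerSurface.conformal, mul_pow, deriv_const_mul_field]
    exact mul_pos (pow_pos (hu x) 2) h

omit [IsManifold (𝓡 2) ∞ M] in
theorem IsSymmetric.conformal (h : IsSymmetric F) (u : M → ℝ) : IsSymmetric (conformal u F) := by
  intro x v a ha
  have := h x v a ha
  simp only [FinslerSurface.conformal, this]
  ring

/-- A conformal multiple of a Riemannian metric. -/
def conformalRiemannian (g : ContMDiffRiemannianMetric (𝓡 2) ∞ Plane
    (fun x : M => TangentSpace (𝓡 2) x)) {u : M → ℝ} (hu : ∀ x, 0 < u x)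
    (hus : ContMDiff (𝓡 2) 𝓘(ℝ, ℝ) ∞ u) :
    ContMDiffRiemannianMetric (𝓡 2) ∞ Plane (fun x : M => TangentSpace (𝓡 2) x) where
  inner x := u x ^ 2 • g.inner x
  symm x v w := congrArg (u x ^ 2 * ·) (g.symm x v w)
  pos x v hv := mul_pos (pow_pos (hu x) 2) (g.pos x v hv)
  isVonNBounded x := by
    -- The unit ball of `u² g` is `u⁻¹` times the unit ball of `g`.
    have h := (g.isVonNBounded x).image ((u x)⁻¹ • ContinuousLinearMap.id ℝ (TangentSpace (𝓡 2) x))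
    refine h.subset (fun v hv => (mem_image _ _ _).2 ⟨u x • v, ?_, ?_⟩)
    · have hv' : u x ^ 2 * g.inner x v v < 1 := hv
      change g.inner x (u x • v) (u x • v) < 1
      rw [map_smul, map_smul, smul_apply, smul_eq_mul, smul_eq_mul, ← mul_assoc, ← sq]
      exact hv'
    · exact inv_smul_smul₀ (hu x).ne' v
  contMDiff := (hus.pow 2).smul_section g.contMDiff

theorem IsRiemannian.conformal (h : IsRiemannian F) {u : M → ℝ} (hu : ∀ x, 0 < u x)
    (hus : ContMDiff (𝓡 2) 𝓘(ℝ, ℝ) ∞ u) : IsRiemannian (conformal u F) := by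
  obtain ⟨g, hg⟩ := h
  refine ⟨conformalRiemannian g hu hus, fun x v => ?_⟩
  change u x * F ⟨x, v⟩ = √(u x ^ 2 * g.inner x v v)
  rw [hg x v, Real.sqrt_mul (sq_nonneg _), Real.sqrt_sq (hu x).le]

theorem IsClosedGeodesic.vec_velocity_ne_zero (hF : IsFinslerMetric F) {σ : ℝ → M} {T : ℝ}
    (hσ : IsClosedGeodesic F σ T) (t : ℝ) : vec (velocity σ t) ≠ 0 := by
  intro h
  have h1 := hσ.unit_speed t
  have h2 : velocity σ t = tanMk (σ t) 0 := by
    rw [← tanMk_eta (velocity σ t), h]; rfl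
  rw [h2] at h1
  exact zero_ne_one ((hF.map_zero (σ t)).symm.trans h1)

omit [IsManifold (𝓡 2) ∞ M] in
theorem fderiv_baseExpr_eq_zero_of_min {u : M → ℝ} {c x : M} (hx : x ∈ (extChartAt (𝓡 2) c).source)
    (hmin : ∀ y, u x ≤ u y) : fderiv ℝ (baseExpr u c) (extChartAt (𝓡 2) c x) = 0 := by
  refine IsLocalMin.fderiv_eq_zero (Eventually.of_forall fun q => ?_)
  rw [baseExpr, (extChartAt (𝓡 2) c).left_inv hx]
  exact hmin _

/-- A conformal factor which attains its minimum `1` along a closed geodesic preserves it. -/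
theorem IsClosedGeodesic.conformal (hF : IsFinslerMetric F) {σ : ℝ → M} {T : ℝ}
    (hσ : IsClosedGeodesic F σ T) {u : M → ℝ} (hus : ContMDiff (𝓡 2) 𝓘(ℝ, ℝ) ∞ u)
    (hmin : ∀ x, 1 ≤ u x) (h1 : ∀ t, u (σ t) = 1) : IsClosedGeodesic (conformal u F) σ T where
  length_pos := hσ.length_pos
  smooth := hσ.smooth
  periodic := hσ.periodic
  unit_speed t := by
    change u (σ t) * F (velocity σ t) = 1
    rw [h1, hσ.unit_speed, one_mul]
  geodesic t₀ := by
    have hgeo := hσ.geodesic t₀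
    unfold EulerLagrangeAt at hgeo ⊢
    set c := σ t₀
    -- Over the curve `u = 1` and `du = 0`, so the full differentials of `u F` and `F` agree and
    -- both sides of the Euler-Lagrange equation are unchanged.
    have key (t : ℝ) (ht : σ t ∈ (extChartAt (𝓡 2) c).source) :
        fderiv ℝ (chartExpr (FinslerSurface.conformal u F) c) (tanChart c (velocity σ t)) =
          fderiv ℝ (chartExpr F c) (tanChart c (velocity σ t)) := by
      have hq : (tanChart c (velocity σ t)).1 ∈ (extChartAt (𝓡 2) c).target :=
        (extChartAt (𝓡 2) c).map_source ht
      have hL := (hF.isLocalFinsler c).hasFDerivAt (z := tanChart c (velocity σ t)) hq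
        (coordTo_ne_zero ht (hσ.vec_velocity_ne_zero hF t))
      have hu := ((contDiffAt_baseExpr hus hq).differentiableAt (by simp)).hasFDerivAt
      have hu0 : fderiv ℝ (baseExpr u c) (tanChart c (velocity σ t)).1 = 0 :=
        fderiv_baseExpr_eq_zero_of_min ht fun y => (h1 t).trans_le (hmin y)
      rw [hu0] at hu
      have hprod := (hu.comp (tanChart c (velocity σ t)) hasFDerivAt_fst).mul hL
      have hev : chartExpr (FinslerSurface.conformal u F) c =ᶠ[𝓝 (tanChart c (velocity σ t))]
          fun z => baseExpr u c z.1 * chartExpr F c z := by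
        have : (Prod.fst ⁻¹' (extChartAt (𝓡 2) c).target : Set (Plane × Plane)) ∈
            𝓝 (tanChart c (velocity σ t)) :=
          ((isOpen_chartTarget c).preimage continuous_fst).mem_nhds hq
        filter_upwards [this] with z hz using chartExpr_conformal u F hz
      have h2 : baseExpr u c (tanChart c (velocity σ t)).1 = 1 :=
        (congrArg u ((extChartAt (𝓡 2) c).left_inv ht)).trans (h1 t)
      rw [hev.fderiv_eq]
      refine hprod.fderiv.trans ?_
      simp only [Function.comp_apply, h2, ContinuousLinearMap.zero_comp, smul_zero, add_zero,
        one_smul]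
    have hnear : ∀ᶠ t in 𝓝 t₀, σ t ∈ (extChartAt (𝓡 2) c).source :=
      hσ.smooth.continuous.continuousAt.eventually_mem
        ((isOpen_extChartAt_source c).mem_nhds (mem_extChartAt_source c))
    have e0 := key t₀ (mem_extChartAt_source c)
    have ev : (fun t => (fderiv ℝ (chartExpr (FinslerSurface.conformal u F) c)
        (tanChart c (velocity σ t))).comp (ContinuousLinearMap.inr ℝ Plane Plane)) =ᶠ[𝓝 t₀]
        fun t => (fderiv ℝ (chartExpr F c)
        (tanChart c (velocity σ t))).comp (ContinuousLinearMap.inr ℝ Plane Plane) := by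
      filter_upwards [hnear] with t ht
      rw [key t ht]
    have := hgeo.congr_of_eventuallyEq ev
    simp only [] at this ⊢
    rw [e0]
    exact this

/-! ### The size of a conformal change -/

/-- The derivatives are evaluated on finitely many compact sets of nonzero vectors, where the chart
expressions are smooth and hence bounded. -/
theorem exists_derivNorm_smul_le {h : TangentBundle (𝓡 2) M → ℝ}
    (hh : ContMDiffOn (𝓡 2).tangent 𝓘(ℝ, ℝ) ∞ h {p | p.2 ≠ 0}) (A : ChartCover M) (k : ℕ) :
    ∃ C : NNReal, ∀ s : ℝ, derivNorm A k (fun p => s * h p) ≤ ‖s‖ₑ * C := by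
  have hsm (c : M) : ContDiffOn ℝ ∞ (chartExpr h c)
      ((extChartAt (𝓡 2) c).target ×ˢ ({0}ᶜ : Set Plane)) := by
    have h1 : ContMDiffOn 𝓘(ℝ, Plane × Plane) (𝓡 2).tangent ∞ (tanChart c).symm
        (tanChart c).target := contMDiffOn_extChartAt_symm _
    have hsub : (extChartAt (𝓡 2) c).target ×ˢ ({0}ᶜ : Set Plane) ⊆ (tanChart c).target :=
      fun z hz => mem_tanChart_target.2 hz.1
    have h2 := hh.comp (h1.mono hsub) (fun z hz => by
        obtain ⟨q, w⟩ := z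
        rw [mem_preimage, tanChart_symm_apply hz.1]
        exact coordFrom_ne_zero ((extChartAt (𝓡 2) c).map_target hz.1) hz.2)
    exact h2.contDiffOn
  have hopen (c : M) : IsOpen ((extChartAt (𝓡 2) c).target ×ˢ ({0}ᶜ : Set Plane)) :=
    (isOpen_chartTarget c).prod isOpen_compl_singleton
  have hmem (i : Fin A.card) (x : M) (hx : x ∈ A.piece i) (v : Plane)
      (hv : v ∈ Metric.sphere (0 : Plane) 1) : (extChartAt (𝓡 2) (A.center i) x, v) ∈
        (extChartAt (𝓡 2) (A.center i)).target ×ˢ ({0}ᶜ : Set Plane) :=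
    ⟨(extChartAt (𝓡 2) (A.center i)).map_source (by
      rw [extChartAt_source]; exact A.piece_subset i hx), ne_zero_of_mem_unit_sphere ⟨v, hv⟩⟩
  have hbound (i : Fin A.card) : ∃ C : NNReal, ∀ x ∈ A.piece i,
      ∀ v ∈ Metric.sphere (0 : Plane) 1, ‖iteratedFDeriv ℝ k (chartExpr h (A.center i))
        (extChartAt (𝓡 2) (A.center i) x, v)‖ₑ ≤ C := by
    have hcompact : IsCompact ((extChartAt (𝓡 2) (A.center i) '' A.piece i) ×ˢ
        Metric.sphere (0 : Plane) 1) := by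
      refine IsCompact.prod ((A.isCompact_piece i).image_of_continuousOn ?_) (isCompact_sphere _ _)
      refine (continuousOn_extChartAt _).mono ?_
      rw [extChartAt_source]; exact A.piece_subset i
    have hcont : ContinuousOn (iteratedFDeriv ℝ k (chartExpr h (A.center i)))
        ((extChartAt (𝓡 2) (A.center i) '' A.piece i) ×ˢ Metric.sphere (0 : Plane) 1) := by
      rintro ⟨_, v⟩ ⟨⟨x, hx, rfl⟩, hv⟩
      have hm := hmem i x hx v hv
      exact (((hsm _ _ hm).contDiffAt ((hopen _).mem_nhds hm)).continuousAt_iteratedFDeriv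
        (k := k) (by exact_mod_cast le_top)).continuousWithinAt
    obtain ⟨C, hC⟩ := hcompact.exists_bound_of_continuousOn hcont
    refine ⟨C.toNNReal, fun x hx v hv => ?_⟩
    rw [← ofReal_norm]
    exact ENNReal.ofReal_le_ofReal (hC _ ⟨⟨x, hx, rfl⟩, hv⟩)
  choose C hC using hbound
  -- The sum over the charts dominates each single bound.
  refine ⟨∑ i, C i, fun s => ?_⟩
  refine iSup_le fun i => iSup₂_le fun x hx => iSup₂_le fun v hv => ?_
  have hm := hmem i x hx v hv
  have hsmul : chartExpr (fun p => s * h p) (A.center i) = s • chartExpr h (A.center i) := rfl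
  rw [hsmul, iteratedFDeriv_const_smul_apply, enorm_smul]
  · gcongr
    refine (hC i x hx v hv).trans ?_
    exact_mod_cast Finset.single_le_sum (f := C) (fun _ _ => zero_le) (Finset.mem_univ i)
  · exact (((hsm _ _ hm).contDiffAt ((hopen _).mem_nhds hm))).of_le (by exact_mod_cast le_top)

/-- Each term tends to `0` and is at most `2⁻ᵏ`, which is summable; dominated convergence for the
counting measure applies. -/
theorem tendsto_cInftyNorm_smul {h : TangentBundle (𝓡 2) M → ℝ}
    (hh : ContMDiffOn (𝓡 2).tangent 𝓘(ℝ, ℝ) ∞ h {p | p.2 ≠ 0}) (A : ChartCover M) :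
    Tendsto (fun s : ℝ => cInftyNorm A (fun p => s * h p)) (𝓝 0) (𝓝 0) := by
  choose C hC using exists_derivNorm_smul_le hh A
  have h0 : Tendsto (fun s : ℝ => ∫⁻ k : ℕ, (2⁻¹ : ℝ≥0∞) ^ k *
      (1 - (1 + derivNorm A k (fun p => s * h p))⁻¹) ∂MeasureTheory.Measure.count) (𝓝 0)
      (𝓝 (∫⁻ _ : ℕ, 0 ∂MeasureTheory.Measure.count)) := by
    refine MeasureTheory.tendsto_lintegral_filter_of_dominated_convergence
      (fun k => (2⁻¹ : ℝ≥0∞) ^ k) (Eventually.of_forall fun s => measurable_from_nat)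
      (Eventually.of_forall fun s => Eventually.of_forall fun k => ?_) ?_
      (Eventually.of_forall fun k => ?_)
    · exact mul_le_of_le_one_right zero_le tsub_le_self
    · rw [MeasureTheory.lintegral_count, ENNReal.tsum_geometric]
      simp
    · have hd : Tendsto (fun s : ℝ => derivNorm A k (fun p => s * h p)) (𝓝 0) (𝓝 0) := by
        have hb : Tendsto (fun s : ℝ => ‖s‖ₑ * (C k : ℝ≥0∞)) (𝓝 0) (𝓝 (‖(0 : ℝ)‖ₑ * C k)) :=
          ENNReal.Tendsto.mul_const (continuous_enorm.tendsto 0) (Or.inr ENNReal.coe_ne_top)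
        rw [enorm_zero, zero_mul] at hb
        exact tendsto_of_tendsto_of_tendsto_of_le_of_le tendsto_const_nhds hb
          (fun _ => zero_le) (fun s => hC k s)
      have h2 : Tendsto (fun s : ℝ => (1 + derivNorm A k (fun p => s * h p))⁻¹) (𝓝 0)
          (𝓝 (1 + 0)⁻¹) := tendsto_inv_iff.2 (tendsto_const_nhds.add hd)
      have h3 := ENNReal.Tendsto.sub (tendsto_const_nhds (x := (1 : ℝ≥0∞)) (f := 𝓝 (0 : ℝ))) h2
        (Or.inl ENNReal.one_ne_top)
      have h4 := ENNReal.Tendsto.const_mul (a := (2⁻¹ : ℝ≥0∞) ^ k) h3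
        (Or.inr (by simp))
      simpa using h4
  simpa [MeasureTheory.lintegral_count, cInftyNorm] using h0

/-- The difference of the two quotients is `s` times the fixed smooth function `-f F / F₀`. -/
theorem tendsto_cInftyDist_conformal (hF : IsFinslerMetric F)
    {F₀ : TangentBundle (𝓡 2) M → ℝ} (hF₀ : IsFinslerMetric F₀) (A : ChartCover M) {f : M → ℝ}
    (hf : ContMDiff (𝓡 2) 𝓘(ℝ, ℝ) ∞ f) :
    Tendsto (fun s : ℝ => cInftyDist A F₀ F (conformal (fun x => 1 + s * f x) F)) (𝓝 0) (𝓝 0) := by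
  have hh : ContMDiffOn (𝓡 2).tangent 𝓘(ℝ, ℝ) ∞
      (fun p : TangentBundle (𝓡 2) M => -(f p.1 * (F p / F₀ p))) {p | p.2 ≠ 0} := by
    have h1 : ContMDiff (𝓡 2).tangent 𝓘(ℝ, ℝ) ∞ (fun p : TangentBundle (𝓡 2) M => f p.1) :=
      hf.comp (contMDiff_proj (TangentSpace (𝓡 2)))
    exact (h1.contMDiffOn.mul (hF.smooth.div₀ hF₀.smooth
      fun p hp => (hF₀.pos p.1 p.2 hp).ne')).neg
  refine (tendsto_cInftyNorm_smul hh A).congr fun s => ?_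
  unfold cInftyDist
  congr 1
  funext p
  simp only [conformal]
  ring

end

instance instNormedAddCommGroupPhaseDual : NormedAddCommGroup (Phase →L[ℝ] ℝ) := inferInstance

instance instNormedSpacePhaseDual : NormedSpace ℝ (Phase →L[ℝ] ℝ) := inferInstance

instance instNormedAddCommGroupPhaseForm : NormedAddCommGroup (Phase →L[ℝ] Phase →L[ℝ] ℝ) :=
  inferInstance

/-! ### Hamiltonian vector fields on the phase space -/

/-- The coordinate functions as elements of the dual plane. -/
def coordForm (i : Fin 2) : DualPlane := EuclideanSpace.proj i

theorem sum_coordForm (β : DualPlane) :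
    ∑ i, β (EuclideanSpace.single i 1) • coordForm i = β := by
  refine ContinuousLinearMap.ext fun v => ?_
  have hv : v = ∑ i, v i • EuclideanSpace.single i (1 : ℝ) := by
    ext j
    fin_cases j <;> simp
  conv_rhs => rw [hv]
  simp [coordForm, mul_comm]

/-- The Hamiltonian vector of a covector: `sgrad ℓ` is characterized by `ω(sgrad ℓ, ·) = -ℓ`. -/
def sgrad : (Phase →L[ℝ] ℝ) →L[ℝ] Phase :=
  (∑ i, (ContinuousLinearMap.apply ℝ ℝ (((0 : Plane), coordForm i) : Phase)).smulRight
    (EuclideanSpace.single i (1 : ℝ) : Plane)).prod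
  (-((ContinuousLinearMap.compL ℝ Plane Phase ℝ).flip (ContinuousLinearMap.inl ℝ Plane DualPlane)))

theorem apply_sgrad_fst (β : DualPlane) (ℓ : Phase →L[ℝ] ℝ) : β (sgrad ℓ).1 = ℓ (0, β) := by
  have h : (sgrad ℓ).1 = ∑ i, ℓ ((0 : Plane), coordForm i) • EuclideanSpace.single i (1 : ℝ) := by
    simp [sgrad]
  have h2 : (ContinuousLinearMap.inr ℝ Plane DualPlane) β =
      ∑ i, β (EuclideanSpace.single i 1) • ContinuousLinearMap.inr ℝ Plane DualPlane
        (coordForm i) := by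
    conv_lhs => rw [← sum_coordForm β]
    simp
  have h3 : ((0 : Plane), β) = ∑ i, β (EuclideanSpace.single i 1) •
      ((0 : Plane), coordForm i) := h2
  rw [h, h3, map_sum, map_sum]
  simp [mul_comm, -Prod.smul_mk]

theorem sgrad_snd_apply (ℓ : Phase →L[ℝ] ℝ) (v : Plane) : (sgrad ℓ).2 v = -ℓ (v, 0) := rfl

theorem omega_sgrad (ℓ : Phase →L[ℝ] ℝ) (w : Phase) : omega (sgrad ℓ) w = -ℓ w := by
  have h : ℓ w = ℓ (w.1, 0) + ℓ (0, w.2) := by rw [← map_add]; simp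
  rw [omega, apply_sgrad_fst, sgrad_snd_apply, h]
  ring

/-- Nondegeneracy of the symplectic form. Equations between vectors are verified below by pairing
with all `w`. -/
theorem eq_of_omega_eq {a b : Phase} (h : ∀ w, omega a w = omega b w) : a = b := by
  refine Prod.ext ?_ ?_
  · ext i
    have := h (0, coordForm i)
    simpa [omega, coordForm] using this
  · refine ContinuousLinearMap.ext fun v => ?_
    have := h (v, 0)
    simpa [omega] using this

/-- Naturality of Hamiltonian vectors under symplectic maps; it carries Hamilton's equations from
one chart to another. -/
theorem sgrad_eq_of_comp {C : Phase →L[ℝ] Phase} (hC : Function.Surjective C)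
    (hω : ∀ a b, omega (C a) (C b) = omega a b) (ℓ : Phase →L[ℝ] ℝ) :
    C (sgrad (ℓ.comp C)) = sgrad ℓ := by
  refine eq_of_omega_eq fun w => ?_
  obtain ⟨v, rfl⟩ := hC w
  rw [hω, omega_sgrad, omega_sgrad]
  rfl

theorem omega_self (a : Phase) : omega a a = 0 := by simp [omega]

theorem _root_.HasDerivWithinAt.omega {y w : ℝ → Phase} {y' w' : Phase} {A : Set ℝ} {t : ℝ}
    (hy : HasDerivWithinAt y y' A t) (hw : HasDerivWithinAt w w' A t) :
    HasDerivWithinAt (fun t => omega (y t) (w t)) (omega y' (w t) + omega (y t) w') A t := by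
  have h1 (x : ℝ → Phase) (x' : Phase) (hx : HasDerivWithinAt x x' A t) :
      HasDerivWithinAt (fun t => (x t).1) x'.1 A t :=
    (ContinuousLinearMap.fst ℝ Plane DualPlane).hasFDerivAt.comp_hasDerivWithinAt t hx
  have h2 (x : ℝ → Phase) (x' : Phase) (hx : HasDerivWithinAt x x' A t) :
      HasDerivWithinAt (fun t => (x t).2) x'.2 A t :=
    (ContinuousLinearMap.snd ℝ Plane DualPlane).hasFDerivAt.comp_hasDerivWithinAt t hx
  refine (((h2 y y' hy).clm_apply (h1 w w' hw)).sub
    ((h2 w w' hw).clm_apply (h1 y y' hy))).congr_deriv ?_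
  simp only [FinslerSurface.omega]
  ring

/-- The pullback to the phase space of a bilinear form of the plane. -/
def pullForm (β : Plane →L[ℝ] Plane →L[ℝ] ℝ) : Phase →L[ℝ] Phase →L[ℝ] ℝ :=
  β.bilinearComp (ContinuousLinearMap.fst ℝ Plane DualPlane)
    (ContinuousLinearMap.fst ℝ Plane DualPlane)

/-! ### Second derivatives of products -/

section Abstract

variable {V : Type*} [NormedAddCommGroup V] [NormedSpace ℝ V]

/-- The mixed terms of the product rule contain `dg = 0`. This is applied to the energy `f` and the
conformal factor `g`. -/
theorem _root_.ContDiffAt.hasFDerivAt_fderiv_mul_of_critical {f g : V → ℝ} {z : V}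
    (hf : ContDiffAt ℝ 2 f z) (hg : ContDiffAt ℝ 2 g z) (h1 : g z = 1) (h0 : fderiv ℝ g z = 0) :
    fderiv ℝ (fun y => f y * g y) z = fderiv ℝ f z ∧
      HasFDerivAt (fderiv ℝ (fun y => f y * g y))
        (fderiv ℝ (fderiv ℝ f) z + f z • fderiv ℝ (fderiv ℝ g) z) z := by
  have hd (h : V → ℝ) (hh : ContDiffAt ℝ 2 h z) : ∀ᶠ y in 𝓝 z, HasFDerivAt h (fderiv ℝ h y) y := by
    filter_upwards [hh.eventually (by simp)] with y hy
    exact (hy.differentiableAt two_ne_zero).hasFDerivAt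
  have hev : fderiv ℝ (fun y => f y * g y) =ᶠ[𝓝 z]
      fun y => f y • fderiv ℝ g y + g y • fderiv ℝ f y := by
    filter_upwards [hd f hf, hd g hg] with y h2 h3
    exact (h2.mul h3).fderiv
  refine ⟨hev.self_of_nhds.trans (by simp [h1, h0]), ?_⟩
  have h2 := ((hd f hf).self_of_nhds.smul hg.hasFDerivAt_fderiv).add
    ((hd g hg).self_of_nhds.smul hf.hasFDerivAt_fderiv)
  refine (h2.congr_fderiv ?_).congr_of_eventuallyEq hev
  refine ContinuousLinearMap.ext fun v => ContinuousLinearMap.ext fun w => ?_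
  simp [h0, h1]
  ring

/-- Only the first derivative `-2 s` of `r ↦ (1 + s r)⁻²` at `0` survives, since the term quadratic
in `dh` vanishes. -/
theorem _root_.ContDiffAt.fderiv_inv_sq_of_critical {h : V → ℝ} {z : V} (hh : ContDiffAt ℝ 2 h z)
    (h0 : h z = 0) (h1 : fderiv ℝ h z = 0) (s : ℝ) :
    fderiv ℝ (fun y => ((1 + s * h y) ^ 2)⁻¹) z = 0 ∧
      fderiv ℝ (fderiv ℝ (fun y => ((1 + s * h y) ^ 2)⁻¹)) z =
        (-2 * s) • fderiv ℝ (fderiv ℝ h) z := by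
  have hd : ∀ᶠ y in 𝓝 z, HasFDerivAt h (fderiv ℝ h y) y := by
    filter_upwards [hh.eventually (by simp)] with y hy
    exact (hy.differentiableAt two_ne_zero).hasFDerivAt
  have hne : ∀ᶠ y in 𝓝 z, 1 + s * h y ≠ 0 := by
    have : ContinuousAt (fun y => 1 + s * h y) z := by
      have := hh.continuousAt
      fun_prop
    exact this.eventually_ne (by simp [h0])
  have hev : fderiv ℝ (fun y => ((1 + s * h y) ^ 2)⁻¹) =ᶠ[𝓝 z]
      fun y => (-2 * s * ((1 + s * h y) ^ 3)⁻¹) • fderiv ℝ h y := by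
    filter_upwards [hd, hne] with y h2 h3
    have hp : HasDerivAt (fun r : ℝ => ((1 + s * r) ^ 2)⁻¹) (-2 * s * ((1 + s * h y) ^ 3)⁻¹)
        (h y) := by
      have e1 : HasDerivAt (fun r : ℝ => 1 + s * r) s (h y) := by
        simpa using ((hasDerivAt_id (h y)).const_mul s).const_add 1
      refine ((e1.pow 2).inv (pow_ne_zero 2 h3)).congr_deriv ?_
      field_simp
      simp
      ring
    exact (hp.comp_hasFDerivAt y h2).fderiv
  refine ⟨hev.self_of_nhds.trans (by simp [h1]), ?_⟩
  have e1 : DifferentiableAt ℝ (fun y => -2 * s * ((1 + s * h y) ^ 3)⁻¹) z := by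
    have h2 := hd.self_of_nhds.differentiableAt
    have h3 : (1 + s * h z) ^ 3 ≠ 0 := pow_ne_zero 3 hne.self_of_nhds
    fun_prop (disch := exact h3)
  have h2 := e1.hasFDerivAt.smul hh.hasFDerivAt_fderiv
  rw [hev.fderiv_eq]
  refine h2.fderiv.trans ?_
  refine ContinuousLinearMap.ext fun v => ContinuousLinearMap.ext fun w => ?_
  simp [h0, h1]

end Abstract

theorem fderiv_fderiv_comp_fst {h : Plane → ℝ} {z : Phase} (hh : ContDiffAt ℝ 2 h z.1) :
    fderiv ℝ (fun y : Phase => h y.1) z = (fderiv ℝ h z.1).comp (ContinuousLinearMap.fst ℝ _ _) ∧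
    ∀ v w : Phase, fderiv ℝ (fderiv ℝ (fun y : Phase => h y.1)) z v w =
      fderiv ℝ (fderiv ℝ h) z.1 v.1 w.1 := by
  have hd : ∀ᶠ q in 𝓝 z.1, HasFDerivAt h (fderiv ℝ h q) q := by
    filter_upwards [hh.eventually (by simp)] with y hy
    exact (hy.differentiableAt two_ne_zero).hasFDerivAt
  have hev : fderiv ℝ (fun y : Phase => h y.1) =ᶠ[𝓝 z]
      fun y => (fderiv ℝ h y.1).comp (ContinuousLinearMap.fst ℝ Plane DualPlane) := by
    filter_upwards [continuousAt_fst.eventually hd] with y hy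
    exact (hy.comp y hasFDerivAt_fst).fderiv
  refine ⟨hev.self_of_nhds, fun v w => ?_⟩
  have h2 : HasFDerivAt (fun y : Phase => fderiv ℝ h y.1) ((fderiv ℝ (fderiv ℝ h) z.1).comp
      (ContinuousLinearMap.fst ℝ Plane DualPlane)) z :=
    HasFDerivAt.comp z hh.hasFDerivAt_fderiv hasFDerivAt_fst
  have h3 := hasFDerivAt_clm_eval h2 w.1
  have h4 : ContDiffAt ℝ 2 (fun y : Phase => h y.1) z := hh.comp z contDiffAt_fst
  have h5 := hasFDerivAt_clm_eval h4.hasFDerivAt_fderiv w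
  have h6 : (fun y => fderiv ℝ (fun y : Phase => h y.1) y w) =ᶠ[𝓝 z]
      fun y : Phase => fderiv ℝ h y.1 w.1 := by
    filter_upwards [hev] with y hy
    rw [hy]; rfl
  exact congrArg (fun L : Phase →L[ℝ] ℝ => L v) (h5.unique (h3.congr_of_eventuallyEq h6))

/-! ### Conformal changes of the energy -/

/-- The energy of a Hamiltonian after a conformal change. -/
theorem energy_div (H : Phase → ℝ) (h : Plane → ℝ) (s : ℝ) :
    energy (fun z => H z / (1 + s * h z.1)) =
      fun z => energy H z * ((1 + s * h z.1) ^ 2)⁻¹ := by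
  funext z
  simp only [energy, div_pow]
  ring

/-- The second derivative of the energy at a point where the conformal factor is critical. -/
theorem hasFDerivAt_fderiv_energy_div {H : Phase → ℝ} {h : Plane → ℝ} {z : Phase}
    (hK : ContDiffAt ℝ 2 (energy H) z) (hh : ContDiffAt ℝ 2 h z.1) (h1 : H z = 1) (h0 : h z.1 = 0)
    (hd : fderiv ℝ h z.1 = 0) (s : ℝ) :
    fderiv ℝ (energy (fun z => H z / (1 + s * h z.1))) z = fderiv ℝ (energy H) z ∧
    HasFDerivAt (fderiv ℝ (energy (fun z => H z / (1 + s * h z.1))))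
      (fderiv ℝ (fderiv ℝ (energy H)) z - s • pullForm (fderiv ℝ (fderiv ℝ h) z.1)) z := by
  have hc : ContDiffAt ℝ 2 (fun y : Phase => h y.1) z := hh.comp z contDiffAt_fst
  obtain ⟨e1, e2⟩ := fderiv_fderiv_comp_fst hh
  have hd' : fderiv ℝ (fun y : Phase => h y.1) z = 0 := by
    rw [e1, hd, ContinuousLinearMap.zero_comp]
  obtain ⟨g1, g2⟩ := hc.fderiv_inv_sq_of_critical h0 hd' s
  have hg : ContDiffAt ℝ 2 (fun y : Phase => ((1 + s * h y.1) ^ 2)⁻¹) z :=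
    ((contDiffAt_const.add (contDiffAt_const.mul hc)).pow 2).inv (by simp [h0])
  obtain ⟨k1, k2⟩ := hK.hasFDerivAt_fderiv_mul_of_critical hg (by simp [h0]) g1
  rw [energy_div]
  refine ⟨k1, k2.congr_fderiv ?_⟩
  refine ContinuousLinearMap.ext fun v => ContinuousLinearMap.ext fun w => ?_
  rw [g2]
  have h3 := e2 v w
  -- On the unit level the energy `1 / 2` and the factor `-2 s` combine to the coefficient `-s`.
  have h4 : energy H z = 1 / 2 := by rw [energy, h1]; norm_num
  rw [h4]
  change fderiv ℝ (fderiv ℝ (energy H)) z v w + 1 / 2 * ((-2 * s) *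
      fderiv ℝ (fderiv ℝ (fun y : Phase => h y.1)) z v w) =
    fderiv ℝ (fderiv ℝ (energy H)) z v w - s * fderiv ℝ (fderiv ℝ h) z.1 v.1 w.1
  rw [h3]
  ring

section

variable {M : Type*} [TopologicalSpace M] [ChartedSpace Plane M] [IsManifold (𝓡 2) ∞ M]
  {F : TangentBundle (𝓡 2) M → ℝ}

/-! ### The contact plane and the Reeb field in charts -/

theorem hasFDerivAt_energy {H : Phase → ℝ} {z : Phase} (hH : DifferentiableAt ℝ H z) :
    HasFDerivAt (energy H) (H z • fderiv ℝ H z) z := by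
  have h : HasDerivAt (fun r : ℝ => r ^ 2 / 2) (H z) (H z) := by
    refine ((hasDerivAt_pow 2 (H z)).div_const 2).congr_deriv ?_
    simp
  exact h.comp_hasFDerivAt z hH.hasFDerivAt

theorem hasMFDerivAt_dualMetric {c : M} {e : CotangentBundle M} (he : e ∈ (cotChart c).source)
    (hd : DifferentiableAt ℝ (dualExpr F c) (cotChart c e)) :
    HasMFDerivAt cotangentModel 𝓘(ℝ, ℝ) (dualMetric F) e
      ((fderiv ℝ (dualExpr F c) (cotChart c e)).comp (cotDeriv c e)) := by
  have h : HasMFDerivAt cotangentModel 𝓘(ℝ, ℝ) (dualExpr F c ∘ cotChart c) e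
      ((fderiv ℝ (dualExpr F c) (cotChart c e)).comp (cotDeriv c e)) :=
    HasMFDerivAt.comp e hd.hasFDerivAt.hasMFDerivAt (hasMFDerivAt_cotChart he)
  refine h.congr_of_eventuallyEq ?_
  filter_upwards [extChartAt_source_mem_nhds' (I := cotangentModel) he] with y hy
  exact (dualExpr_cotChart F hy).symm

/-- The differential of the energy is `H dH`, with the same kernel as `dH` where `H ≠ 0`. The energy
is used because Hamilton's equations are stated for it. -/
theorem mem_tangentUnitCotangent {c : M} {e : CotangentBundle M} (he : e ∈ (cotChart c).source)
    (hd : DifferentiableAt ℝ (dualExpr F c) (cotChart c e))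
    (h0 : dualExpr F c (cotChart c e) ≠ 0) (w : Phase) :
    w ∈ tangentUnitCotangent F e ↔
      fderiv ℝ (energy (dualExpr F c)) (cotChart c e) (cotDeriv c e w) = 0 := by
  have h1 : w ∈ tangentUnitCotangent F e ↔
      fderiv ℝ (dualExpr F c) (cotChart c e) (cotDeriv c e w) = 0 := by
    change (mfderiv cotangentModel 𝓘(ℝ, ℝ) (dualMetric F) e) w = 0 ↔ _
    rw [(hasMFDerivAt_dualMetric he hd).mfderiv]
    rfl
  rw [h1, (hasFDerivAt_energy hd).fderiv]
  exact (mul_eq_zero.trans (or_iff_right h0)).symm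

/-- The contact plane as a subspace of the model space. -/
def contactSpace (F : TangentBundle (𝓡 2) M → ℝ) (e : CotangentBundle M) : Submodule ℝ Phase :=
  contactPlane F e

theorem mem_contactSpace {c : M} {e : CotangentBundle M} (he : e ∈ (cotChart c).source)
    (hd : DifferentiableAt ℝ (dualExpr F c) (cotChart c e))
    (h0 : dualExpr F c (cotChart c e) ≠ 0) (w : Phase) :
    w ∈ contactSpace F e ↔
      fderiv ℝ (energy (dualExpr F c)) (cotChart c e) (cotDeriv c e w) = 0 ∧
        (cotChart c e).2 (cotDeriv c e w).1 = 0 := by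
  rw [← mem_tangentUnitCotangent he hd h0, ← liouville_eq_chart he]
  exact Iff.rfl

/-- The Reeb vector in a chart. -/
theorem isReebVector_sgrad {c : M} {e : CotangentBundle M} (he : e ∈ (cotChart c).source)
    (hd : DifferentiableAt ℝ (dualExpr F c) (cotChart c e))
    (h1 : dualMetric F e = 1)
    (heuler : fderiv ℝ (energy (dualExpr F c)) (cotChart c e) (0, (cotChart c e).2) =
      2 * energy (dualExpr F c) (cotChart c e)) :
    IsReebVector F e ((cotDerivEquiv c e he).symm
      (sgrad (fderiv ℝ (energy (dualExpr F c)) (cotChart c e)))) := by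
  set ℓ := fderiv ℝ (energy (dualExpr F c)) (cotChart c e) with hℓ
  set R : Phase := (cotDerivEquiv c e he).symm (sgrad ℓ) with hR
  have hCR : cotDeriv c e R = sgrad ℓ := by
    rw [← cotDerivEquiv_apply c e he, hR, ContinuousLinearEquiv.apply_symm_apply]
  have hH : dualExpr F c (cotChart c e) = 1 := (dualExpr_cotChart F he).trans h1
  have hmem := mem_tangentUnitCotangent he hd (by rw [hH]; exact one_ne_zero)
  refine ⟨?_, ?_, fun w hw => ?_⟩
  · refine (hmem R).2 ?_
    rw [hCR, ← neg_eq_zero, ← omega_sgrad, omega_self]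
  · refine (liouville_eq_chart he R).trans ?_
    rw [hCR, apply_sgrad_fst, heuler, energy, hH]
    norm_num
  · have h2 := (hmem w).1 hw
    have h3 (w : Phase) (hw : ℓ (cotDeriv c e w) = 0) : omega R w = 0 := by
      rw [← omega_cotDeriv he, hCR, omega_sgrad, hw, neg_zero]
    exact h3 w h2

theorem omega_smul_sub_left (a b c : Phase) (r : ℝ) :
    omega (r • a - b) c = r * omega a c - omega b c := by
  simp only [omega, Prod.fst_sub, Prod.snd_sub, Prod.smul_fst, Prod.smul_snd, map_sub, map_smul,
    sub_apply, smul_apply, smul_eq_mul]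
  ring

theorem omega_smul_sub_right (a b c : Phase) (r : ℝ) :
    omega c (r • a - b) = r * omega c a - omega c b := by
  rw [omega_symm, omega_smul_sub_left, omega_symm a, omega_symm b]
  ring

theorem exists_omega_eq_mul {ℓ : Phase →L[ℝ] ℝ} {a : Phase}
    (ha : ∀ w : Phase, ℓ w = 0 → omega a w = 0) : ∃ k : ℝ, ∀ w, omega a w = k * ℓ w := by
  by_cases h : ∀ w, ℓ w = 0
  · exact ⟨0, fun w => by rw [ha w (h w), zero_mul]⟩
  push Not at h
  obtain ⟨w₀, h0⟩ := h
  refine ⟨omega a w₀ / ℓ w₀, fun w => ?_⟩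
  have h2 := ha ((ℓ w / ℓ w₀) • w₀ - w) (by
    rw [map_sub, map_smul, smul_eq_mul, div_mul_cancel₀ _ h0, sub_self])
  rw [omega_smul_sub_right] at h2
  rw [← sub_eq_zero.1 h2]
  ring

/-- Both pairings are multiples of `ℓ`, so nondegeneracy makes the vectors proportional, and the
normalization by `p` makes them equal. -/
theorem eq_of_omega_ker {ℓ : Phase →L[ℝ] ℝ} {p : DualPlane} {R R' : Phase}
    (h : ∀ w : Phase, ℓ w = 0 → omega R w = 0) (h' : ∀ w : Phase, ℓ w = 0 → omega R' w = 0)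
    (hl : p R.1 = 1) (hl' : p R'.1 = 1) : R = R' := by
  obtain ⟨k, hk⟩ := exists_omega_eq_mul h
  obtain ⟨k', hk'⟩ := exists_omega_eq_mul h'
  have hz (r : Phase) (hr : ∀ w, omega r w = 0) : r = 0 :=
    eq_of_omega_eq fun w => by rw [hr]; simp [omega]
  by_cases hk0 : k = 0
  · have := hz R fun w => by rw [hk, hk0, zero_mul]
    rw [this] at hl
    simp at hl
  · have h3 : (k' / k) • R - R' = 0 := hz _ fun w => by
      rw [omega_smul_sub_left, hk, hk']
      field_simp
      ring
    have h4 : (k' / k) • R = R' := sub_eq_zero.1 h3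
    have h5 : k' / k = 1 := by
      have := congrArg (fun v : Phase => p v.1) h4
      simpa [hl, hl'] using this
    rwa [h5, one_smul] at h4

/-- The Reeb vector is unique. -/
theorem IsReebVector.unique {e : CotangentBundle M} {R R' : TangentSpace cotangentModel e}
    (h : IsReebVector F e R) (h' : IsReebVector F e R') : R = R' :=
  eq_of_omega_ker (ℓ := mfderiv cotangentModel 𝓘(ℝ, ℝ) (dualMetric F) e) (p := covec e)
    (fun w hw => h.symplectic_eq w hw) (fun w hw => h'.symplectic_eq w hw)
    ((liouville_apply e R).symm.trans h.liouville_eq)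
    ((liouville_apply e R').symm.trans h'.liouville_eq)

/-! ### Conformal changes in charts -/

theorem IsFinslerMetric.dualExpr_conformal (hF : IsFinslerMetric F) {u : M → ℝ}
    (hu : ∀ x, 0 < u x) (hFu : IsFinslerMetric (FinslerSurface.conformal u F)) {c y : M}
    (hy : y ∈ (extChartAt (𝓡 2) c).source) (w : Plane) :
    dualExpr (FinslerSurface.conformal u F) c (cotChart c (legendre F (tanMk y w))) =
      dualExpr F c (cotChart c (legendre F (tanMk y w))) /
        baseExpr u c (cotChart c (legendre F (tanMk y w))).1 := by
  have hs : legendre F (tanMk y w) ∈ (cotChart c).source := mem_cotChart_source.2 hy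
  have h1 : (cotChart c (legendre F (tanMk y w))).1 = extChartAt (𝓡 2) c y := rfl
  rw [dualExpr_cotChart _ hs, dualExpr_cotChart _ hs, hF.dualMetric_conformal_legendre hu hFu,
    hF.dualMetric_legendre, h1, baseExpr, (extChartAt (𝓡 2) c).left_inv hy]

/-! ### The Hamiltonian equations of a geodesic -/

omit [IsManifold (𝓡 2) ∞ M] in
theorem velocity_eq (σ : ℝ → M) (t : ℝ) : tanMk (σ t) (vec (velocity σ t)) = velocity σ t := rfl

omit [IsManifold (𝓡 2) ∞ M] in
theorem hasDerivAt_extChartAt_comp {σ : ℝ → M} (hσ : ContMDiff 𝓘(ℝ, ℝ) (𝓡 2) ∞ σ) (t : ℝ) :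
    HasDerivAt (fun r => extChartAt (𝓡 2) (σ t) (σ r)) (vec (velocity σ t)) t := by
  have h1 (L : ℝ →L[ℝ] Plane) (hL : HasMFDerivAt 𝓘(ℝ, ℝ) (𝓡 2) σ t L) :
      HasDerivAt (fun r => extChartAt (𝓡 2) (σ t) (σ r)) (L 1) t := by
    have h2 : HasFDerivWithinAt (extChartAt (𝓡 2) (σ t) ∘ σ) L (range 𝓘(ℝ, ℝ)) t := hL.2
    rw [ModelWithCorners.range_eq_univ, hasFDerivWithinAt_univ] at h2
    exact h2.hasDerivAt
  exact h1 _ ((hσ t).mdifferentiableAt (by simp)).hasMFDerivAt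

/-- The Legendre transform of the velocity of a geodesic is an integral curve of the Hamiltonian
vector field of the energy. -/
theorem IsClosedGeodesic.hasDerivAt_cotChart (hF : IsFinslerMetric F) {σ : ℝ → M} {T : ℝ}
    (hσ : IsClosedGeodesic F σ T) {c : M} {t₀ : ℝ} (hc : σ t₀ ∈ (extChartAt (𝓡 2) c).source) :
    HasDerivAt (fun t => cotChart c (legendre F (velocity σ t)))
        (sgrad (fderiv ℝ (energy (dualExpr F c)) (cotChart c (legendre F (velocity σ t₀))))) t₀ ∧
      (sgrad (fderiv ℝ (energy (dualExpr F c)) (cotChart c (legendre F (velocity σ t₀))))).1 =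
        coordTo c (σ t₀) (vec (velocity σ t₀)) := by
  have hv (t) := hσ.vec_velocity_ne_zero hF t
  set x := σ t₀ with hx
  set e := legendre F (velocity σ t₀) with he
  have hxs := mem_extChartAt_source (I := 𝓡 2) x
  -- the equations in the chart at the point itself
  have hown : HasDerivAt (fun t => cotChart x (legendre F (velocity σ t)))
      (sgrad (fderiv ℝ (energy (dualExpr F x)) (cotChart x e))) t₀ := by
    have hnear : ∀ᶠ t in 𝓝 t₀, σ t ∈ (extChartAt (𝓡 2) x).source :=
      hσ.smooth.continuous.continuousAt.eventually_mem
        ((isOpen_extChartAt_source x).mem_nhds hxs)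
    -- At unit speed `L = 1`, so the momentum is `∂L/∂v`, the quantity differentiated in the
    -- Euler-Lagrange equation.
    have hz : (fun t => cotChart x (legendre F (velocity σ t))) =ᶠ[𝓝 t₀]
        fun t => (extChartAt (𝓡 2) x (σ t),
          (fderiv ℝ (chartExpr F x) (tanChart x (velocity σ t))).comp
            (ContinuousLinearMap.inr ℝ Plane Plane)) := by
      filter_upwards [hnear] with t ht
      have h1 := hF.cotChart_legendre ht (hv t)
      rw [velocity_eq] at h1
      have h2 : chartExpr F x (tanChart x (velocity σ t)) = 1 :=
        (chartExpr_tanChart F ht).trans (hσ.unit_speed t)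
      rw [h1, localLegendre, fibreLegendre, h2, one_smul]
      rfl
    have hq : HasDerivAt (fun t => extChartAt (𝓡 2) x (σ t)) (vec (velocity σ t₀)) t₀ :=
      hasDerivAt_extChartAt_comp hσ.smooth t₀
    have hgeo : HasDerivAt (fun t => (fderiv ℝ (chartExpr F x) (tanChart x (velocity σ t))).comp
        (ContinuousLinearMap.inr ℝ Plane Plane)) ((fderiv ℝ (chartExpr F x)
          (tanChart x (velocity σ t₀))).comp (ContinuousLinearMap.inl ℝ Plane Plane)) t₀ :=
      hσ.geodesic t₀
    refine ((hq.prodMk hgeo).congr_of_eventuallyEq hz).congr_deriv ?_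
    obtain ⟨O, -, -, -, hDK⟩ := hF.exists_isDualNormOn hxs (hv t₀)
    refine eq_of_omega_eq fun w => ?_
    rw [omega_sgrad]
    have h3 : fderiv ℝ (energy (dualExpr F x)) (cotChart x e) w = w.2 (vec (velocity σ t₀)) -
        F (velocity σ t₀) * fderiv ℝ (chartExpr F x) (tanChart x (velocity σ t₀)) (w.1, 0) := by
      refine (hDK w).trans ?_
      rw [show coordTo x x (vec (velocity σ t₀)) = vec (velocity σ t₀) from
        tangentCoordChange_self hxs]
      rfl
    rw [h3, hσ.unit_speed]
    simp only [omega, ContinuousLinearMap.comp_apply, ContinuousLinearMap.inl_apply]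
    ring
  obtain ⟨O, hO, hdual, -, hDK⟩ := hF.exists_isDualNormOn hc (hv t₀)
  have hcs : e ∈ (cotChart c).source := mem_cotChart_source.2 hc
  have hes : e ∈ (cotChart x).source := mem_cotChart_source.2 hxs
  have htrans := hasFDerivAt_cotChart_comp_symm hcs
  have hK : HasFDerivAt (energy (dualExpr F c))
      (fderiv ℝ (energy (dualExpr F c)) (cotChart c e)) (cotChart c e) :=
    ((((contDiffOn_energy hdual.smooth).contDiffAt (hdual.isOpen.mem_nhds hO)).differentiableAt
      (by simp))).hasFDerivAt
  have hinv : (cotChart c ∘ (cotChart x).symm) (cotChart x e) = cotChart c e :=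
    congrArg (cotChart c) ((cotChart x).left_inv hes)
  have hsrc : ∀ᶠ y in 𝓝 (cotChart x e), (cotChart x).symm y ∈ (cotChart c).source := by
    refine ((continuousAt_extChartAt_symm (I := cotangentModel) e)).eventually_mem ?_
    rw [extChartAt_cotangent e, show cotChart e.1 = cotChart x from rfl, (cotChart x).left_inv hes]
    exact (isOpen_extChartAt_source _).mem_nhds hcs
  -- The energies in the two charts are related by the coordinate change, which is symplectic;
  -- naturality then transports the Hamiltonian vector.
  have hD : fderiv ℝ (energy (dualExpr F x)) (cotChart x e) =
      (fderiv ℝ (energy (dualExpr F c)) (cotChart c e)).comp (cotDeriv c e) := by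
    have h1 : HasFDerivAt (energy (dualExpr F c) ∘ (cotChart c ∘ (cotChart x).symm))
        ((fderiv ℝ (energy (dualExpr F c)) (cotChart c e)).comp (cotDeriv c e)) (cotChart x e) :=
      HasFDerivAt.comp _ (by rw [hinv]; exact hK) htrans
    refine (h1.congr_of_eventuallyEq ?_).fderiv
    filter_upwards [hsrc] with y hy
    simp only [Function.comp_apply, energy]
    rw [dualExpr_cotChart F hy]
    rfl
  have hmain : cotDeriv c e (sgrad (fderiv ℝ (energy (dualExpr F x)) (cotChart x e))) =
      sgrad (fderiv ℝ (energy (dualExpr F c)) (cotChart c e)) := by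
    rw [hD]
    refine sgrad_eq_of_comp (fun w => ?_) (omega_cotDeriv hcs) _
    exact ⟨(cotDerivEquiv c e hcs).symm w, by
      rw [← cotDerivEquiv_apply c e hcs, ContinuousLinearEquiv.apply_symm_apply]⟩
  refine ⟨?_, ?_⟩
  · rw [← hmain]
    have h1 : HasDerivAt ((cotChart c ∘ (cotChart x).symm) ∘
        fun t => cotChart x (legendre F (velocity σ t))) _ t₀ :=
      HasFDerivAt.comp_hasDerivAt t₀ htrans hown
    refine h1.congr_of_eventuallyEq ?_
    have hnear : ∀ᶠ t in 𝓝 t₀, σ t ∈ (extChartAt (𝓡 2) x).source :=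
      hσ.smooth.continuous.continuousAt.eventually_mem
        ((isOpen_extChartAt_source x).mem_nhds hxs)
    filter_upwards [hnear] with t ht
    exact (congrArg (cotChart c) ((cotChart x).left_inv (mem_cotChart_source.2 ht))).symm
  · have h1 (β : DualPlane) :
        β (sgrad (fderiv ℝ (energy (dualExpr F c)) (cotChart c e))).1 =
          β (coordTo c x (vec (velocity σ t₀))) := by
      rw [apply_sgrad_fst]
      refine (hDK (0, β)).trans ?_
      have : fderiv ℝ (chartExpr F c) (tanChart c (tanMk x (vec (velocity σ t₀))))
        ((0 : Plane), (0 : Plane)) = 0 := map_zero _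
      rw [this, mul_zero, sub_zero]
    ext i
    exact h1 (coordForm i)

end

/-! ### Linearized Hamiltonian dynamics -/

theorem eq_of_hasDerivWithinAt_zero {a b : ℝ} {f : ℝ → ℝ}
    (hf : ∀ t ∈ Icc a b, HasDerivWithinAt f 0 (Icc a b) t) {t : ℝ} (ht : t ∈ Icc a b) :
    f t = f a :=
  constant_of_has_deriv_right_zero (fun t ht => (hf t ht).continuousWithinAt)
    (fun t ht => (hf t ⟨ht.1, ht.2.le⟩).Ici_of_Icc ht) t ht

theorem hasDerivWithinAt_fst_apply {y : ℝ → Phase} {y' : Phase} {A : Set ℝ} {t : ℝ}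
    (hy : HasDerivWithinAt y y' A t) : HasDerivWithinAt (fun t => (y t).1) y'.1 A t :=
  (ContinuousLinearMap.fst ℝ Plane DualPlane).hasFDerivAt.comp_hasDerivWithinAt t hy

theorem hasDerivWithinAt_snd_apply {y : ℝ → Phase} {y' : Phase} {A : Set ℝ} {t : ℝ}
    (hy : HasDerivWithinAt y y' A t) : HasDerivWithinAt (fun t => (y t).2) y'.2 A t :=
  (ContinuousLinearMap.snd ℝ Plane DualPlane).hasFDerivAt.comp_hasDerivWithinAt t hy

section Linearized

variable {G : Phase → ℝ} {S : Phase →L[ℝ] Phase →L[ℝ] ℝ} {z y : ℝ → Phase} {A : Set ℝ} {t : ℝ}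

/-- The energy is a first integral of the linearized equation. -/
theorem hasDerivWithinAt_fderiv_linearized (hG : HasFDerivAt (fderiv ℝ G) S (z t))
    (hS : ∀ v w, S v w = S w v) (hz : HasDerivWithinAt z (sgrad (fderiv ℝ G (z t))) A t)
    (hy : HasDerivWithinAt y (sgrad (S (y t))) A t) :
    HasDerivWithinAt (fun t => fderiv ℝ G (z t) (y t)) 0 A t := by
  have h1 : HasDerivWithinAt (fun t => fderiv ℝ G (z t)) (S (sgrad (fderiv ℝ G (z t)))) A t :=
    hG.comp_hasDerivWithinAt t hz
  refine (h1.clm_apply hy).congr_deriv ?_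
  have h2 : fderiv ℝ G (z t) (sgrad (S (y t))) = -omega (sgrad (fderiv ℝ G (z t)))
      (sgrad (S (y t))) := by rw [omega_sgrad, neg_neg]
  rw [h2, omega_symm, omega_sgrad, neg_neg, hS]
  ring

/-- The Liouville form is a first integral of the linearized equation on the energy level. -/
theorem hasDerivWithinAt_liouville_linearized
    (heuler : ∀ v, S v (0, (z t).2) + fderiv ℝ G (z t) (0, v.2) = 2 * fderiv ℝ G (z t) v)
    (hz : HasDerivWithinAt z (sgrad (fderiv ℝ G (z t))) A t)
    (hy : HasDerivWithinAt y (sgrad (S (y t))) A t) (h0 : fderiv ℝ G (z t) (y t) = 0) :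
    HasDerivWithinAt (fun t => (z t).2 (y t).1) 0 A t := by
  refine ((hasDerivWithinAt_snd_apply hz).clm_apply
    (hasDerivWithinAt_fst_apply hy)).congr_deriv ?_
  rw [apply_sgrad_fst, sgrad_snd_apply]
  have h1 := heuler (y t)
  have h2 : fderiv ℝ G (z t) (y t) =
      fderiv ℝ G (z t) ((y t).1, 0) + fderiv ℝ G (z t) (0, (y t).2) := by
    rw [← map_add]; simp
  linarith

/-- The variation of the symplectic pairing of solutions of two linear Hamiltonian systems. -/
theorem hasDerivWithinAt_omega_linearized {P : Phase →L[ℝ] Phase →L[ℝ] ℝ} {s : ℝ}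
    {w : ℝ → Phase} (hS : ∀ v w, S v w = S w v)
    (hy : HasDerivWithinAt y (sgrad ((S - s • P) (y t))) A t)
    (hw : HasDerivWithinAt w (sgrad (S (w t))) A t) :
    HasDerivWithinAt (fun t => omega (y t) (w t)) (s * P (y t) (w t)) A t := by
  refine (hy.omega hw).congr_deriv ?_
  rw [omega_symm (y t), omega_sgrad, omega_sgrad, hS (w t)]
  have : (S - s • P) (y t) (w t) = S (y t) (w t) - s * P (y t) (w t) := rfl
  rw [this]
  ring

end Linearized

/-! ### Conformal changes of a Hamiltonian along a critical orbit -/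

/-- The Hamiltonian `H / (1 + s h)`. -/
def confHam (H : Phase → ℝ) (h : Plane → ℝ) (s : ℝ) (z : Phase) : ℝ := H z / (1 + s * h z.1)

/-- An orbit of the Hamiltonian flow on the level `1`, along which the nonnegative
function `h` vanishes. -/
structure IsCriticalOrbit (H : Phase → ℝ) (O : Set Phase) (h : Plane → ℝ) (z : ℝ → Phase)
    (a b : ℝ) : Prop where
  dual : IsDualNormOn H O
  smooth : ∀ y ∈ O, ContDiffAt ℝ ∞ h y.1
  nonneg : ∀ y ∈ O, 0 ≤ h y.1
  mem : ∀ t ∈ Icc a b, z t ∈ O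
  hasDeriv : ∀ t ∈ Icc a b,
    HasDerivWithinAt z (sgrad (fderiv ℝ (energy H) (z t))) (Icc a b) t
  unit : ∀ t ∈ Icc a b, H (z t) = 1
  zero : ∀ t ∈ Icc a b, h (z t).1 = 0

/-! ### Second derivatives along lines and at local minima -/

theorem deriv_deriv_line {V : Type*} [NormedAddCommGroup V] [NormedSpace ℝ V]
    {h : V → ℝ} {q : V} (hh : ContDiffAt ℝ 2 h q) (v : V) :
    deriv (fun r : ℝ => h (q + r • v)) 0 = fderiv ℝ h q v ∧
      deriv (deriv fun r : ℝ => h (q + r • v)) 0 = fderiv ℝ (fderiv ℝ h) q v v := by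
  have hline (r : ℝ) : HasDerivAt (fun r : ℝ => q + r • v) v r := by
    simpa using ((hasDerivAt_id r).smul_const v).const_add q
  have hcont : Tendsto (fun r : ℝ => q + r • v) (𝓝 0) (𝓝 q) := by
    have : Continuous fun r : ℝ => q + r • v := by fun_prop
    simpa using this.tendsto 0
  have hderiv : deriv (fun r : ℝ => h (q + r • v)) =ᶠ[𝓝 0] fun r => fderiv ℝ h (q + r • v) v := by
    filter_upwards [hcont.eventually (hh.eventually (by simp))] with r hr
    exact ((hr.differentiableAt two_ne_zero).hasFDerivAt.comp_hasDerivAt r (hline r)).deriv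
  refine ⟨hderiv.self_of_nhds.trans (by simp), ?_⟩
  rw [hderiv.deriv_eq]
  exact (hasDerivAt_clm_eval hh.hasFDerivAt_fderiv (hline 0) (by simp) v).deriv

/-- A negative second derivative along a line would make `q` a local maximum on it as well as a
minimum. The function would then be constant near `q` on the line, with second derivative `0`. -/
theorem second_deriv_nonneg_of_isLocalMin {V : Type*} [NormedAddCommGroup V] [NormedSpace ℝ V]
    {h : V → ℝ} {q : V} (hh : ContDiffAt ℝ 2 h q) (hmin : IsLocalMin h q) (v : V) :
    0 ≤ fderiv ℝ (fderiv ℝ h) q v v := by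
  by_contra hneg
  push Not at hneg
  obtain ⟨h1, h2⟩ := deriv_deriv_line hh v
  rw [hmin.fderiv_eq_zero] at h1
  rw [← h2] at hneg
  have hcont : ContinuousAt (fun r : ℝ => q + r • v) 0 := by fun_prop
  have hq : q + (0 : ℝ) • v = q := by simp
  have hmax := isLocalMax_of_deriv_deriv_neg hneg h1
    (ContinuousAt.comp (by rw [hq]; exact hh.continuousAt) hcont)
  have hmin' : ∀ᶠ r in 𝓝 (0 : ℝ), h q ≤ h (q + r • v) := by
    refine hcont.tendsto.eventually (p := fun x => h q ≤ h x) ?_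
    rw [hq]
    exact hmin
  have hconst : (fun r : ℝ => h (q + r • v)) =ᶠ[𝓝 0] fun _ => h q := by
    filter_upwards [hmax, hmin'] with r h3 h4
    rw [hq] at h3
    exact le_antisymm h3 h4
  have h5 : deriv (fun r : ℝ => h (q + r • v)) =ᶠ[𝓝 0] fun _ => 0 :=
    hconst.deriv.trans (by simp)
  rw [h5.deriv_eq, deriv_const] at hneg
  exact lt_irrefl _ hneg

namespace IsCriticalOrbit

variable {H : Phase → ℝ} {O : Set Phase} {h : Plane → ℝ} {z : ℝ → Phase} {a b : ℝ}
  (hO : IsCriticalOrbit H O h z a b)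

include hO

theorem mono {a' b' : ℝ} (hab : Icc a' b' ⊆ Icc a b) : IsCriticalOrbit H O h z a' b' where
  dual := hO.dual
  smooth := hO.smooth
  nonneg := hO.nonneg
  mem t ht := hO.mem t (hab ht)
  hasDeriv t ht := (hO.hasDeriv t (hab ht)).mono hab
  unit t ht := hO.unit t (hab ht)
  zero t ht := hO.zero t (hab ht)

/-- The horizontal slice of the open set `O` through `z t` projects to a neighbourhood in the base
on which `h ≥ 0`. -/
theorem isLocalMin {t : ℝ} (ht : t ∈ Icc a b) : IsLocalMin h (z t).1 := by
  have hc : Continuous fun q : Plane => ((q, (z t).2) : Phase) := by fun_prop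
  filter_upwards [hc.continuousAt.eventually_mem (hO.dual.isOpen.mem_nhds (hO.mem t ht))] with q hq
  rw [hO.zero t ht]
  exact hO.nonneg _ hq

theorem contDiffAt_energy {y : Phase} (hy : y ∈ O) : ContDiffAt ℝ 2 (energy H) y :=
  ((contDiffOn_energy hO.dual.smooth).contDiffAt (hO.dual.isOpen.mem_nhds hy)).of_le two_le_infty

theorem one_le {s : ℝ} (hs : 0 ≤ s) {y : Phase} (hy : y ∈ O) : 1 ≤ 1 + s * h y.1 :=
  le_add_of_nonneg_right (mul_nonneg hs (hO.nonneg y hy))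

theorem contDiffOn_confHam {s : ℝ} (hs : 0 ≤ s) : ContDiffOn ℝ ∞ (confHam H h s) O := by
  intro y hy
  have h1 : ContDiffAt ℝ ∞ (fun y : Phase => 1 + s * h y.1) y :=
    contDiffAt_const.add (contDiffAt_const.mul ((hO.smooth y hy).comp y contDiffAt_fst))
  exact (hO.dual.smooth y hy).div h1.contDiffWithinAt
    (zero_lt_one.trans_le (hO.one_le hs hy)).ne'

theorem contDiffAt_energy_confHam {s : ℝ} (hs : 0 ≤ s) {y : Phase} (hy : y ∈ O) :
    ContDiffAt ℝ 2 (energy (confHam H h s)) y :=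
  ((contDiffOn_energy (hO.contDiffOn_confHam hs)).contDiffAt
    (hO.dual.isOpen.mem_nhds hy)).of_le two_le_infty

theorem confHam_pos {s : ℝ} (hs : 0 ≤ s) {y : Phase} (hy : y ∈ O) : 0 < confHam H h s y :=
  div_pos (hO.dual.pos y hy) (zero_lt_one.trans_le (hO.one_le hs hy))

/-- The conformal factor depends on the base point only, so the derivative in the fibre direction
does not see it. -/
theorem euler_confHam {s : ℝ} (hs : 0 ≤ s) {y : Phase} (hy : y ∈ O) :
    fderiv ℝ (energy (confHam H h s)) y (0, y.2) = 2 * energy (confHam H h s) y := by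
  have h1 : HasFDerivAt (energy H) (fderiv ℝ (energy H) y) y :=
    ((hO.contDiffAt_energy hy).differentiableAt two_ne_zero).hasFDerivAt
  have h2 : DifferentiableAt ℝ (fun q : Plane => ((1 + s * h q) ^ 2)⁻¹) y.1 := by
    have h3 : DifferentiableAt ℝ h y.1 := (hO.smooth y hy).differentiableAt (by simp)
    have h4 : (1 + s * h y.1) ^ 2 ≠ 0 := pow_ne_zero 2 (zero_lt_one.trans_le (hO.one_le hs hy)).ne'
    fun_prop (disch := exact h4)
  have h3 : HasFDerivAt (fun y : Phase => ((1 + s * h y.1) ^ 2)⁻¹)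
      ((fderiv ℝ (fun q : Plane => ((1 + s * h q) ^ 2)⁻¹) y.1).comp
        (ContinuousLinearMap.fst ℝ Plane DualPlane)) y :=
    HasFDerivAt.comp y h2.hasFDerivAt hasFDerivAt_fst
  have h4 : energy (confHam H h s) = fun z => energy H z * ((1 + s * h z.1) ^ 2)⁻¹ :=
    energy_div H h s
  have h5 : HasFDerivAt (fun z => energy H z * ((1 + s * h z.1) ^ 2)⁻¹) _ y := h1.mul h3
  rw [h4, h5.fderiv]
  change energy H y * fderiv ℝ (fun q : Plane => ((1 + s * h q) ^ 2)⁻¹) y.1 0 +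
    ((1 + s * h y.1) ^ 2)⁻¹ * fderiv ℝ (energy H) y (0, y.2) = _
  rw [hO.dual.euler y hy, map_zero]
  ring

/-- Along the orbit `h` and `dh` vanish and `H = 1`. So the same curve is an orbit for every `s`,
and the linearized equation changes only by the term linear in `s`. -/
theorem fderiv_energy_confHam {t : ℝ} (ht : t ∈ Icc a b) (s : ℝ) :
    fderiv ℝ (energy (confHam H h s)) (z t) = fderiv ℝ (energy H) (z t) ∧
    HasFDerivAt (fderiv ℝ (energy (confHam H h s))) (fderiv ℝ (fderiv ℝ (energy H)) (z t) -
      s • pullForm (fderiv ℝ (fderiv ℝ h) (z t).1)) (z t) :=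
  hasFDerivAt_fderiv_energy_div (hO.contDiffAt_energy (hO.mem t ht))
    ((hO.smooth _ (hO.mem t ht)).of_le two_le_infty) (hO.unit t ht) (hO.zero t ht)
    (hO.isLocalMin ht).fderiv_eq_zero s

/-- This is the derivative of the Euler relation `euler_confHam` at `z t`. -/
theorem euler_second {s : ℝ} (hs : 0 ≤ s) {t : ℝ} (ht : t ∈ Icc a b) (v : Phase) :
    (fderiv ℝ (fderiv ℝ (energy H)) (z t) - s • pullForm (fderiv ℝ (fderiv ℝ h) (z t).1)) v
      (0, (z t).2) + fderiv ℝ (energy (confHam H h s)) (z t) (0, v.2) =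
        2 * fderiv ℝ (energy (confHam H h s)) (z t) v := by
  have h1 := (hO.fderiv_energy_confHam ht s).2
  have h2 : HasFDerivAt (fun y : Phase => ((0, y.2) : Phase))
      ((ContinuousLinearMap.inr ℝ Plane DualPlane).comp (ContinuousLinearMap.snd ℝ Plane DualPlane))
      (z t) := ((ContinuousLinearMap.inr ℝ Plane DualPlane).comp
        (ContinuousLinearMap.snd ℝ Plane DualPlane)).hasFDerivAt
  have h3 := h1.clm_apply h2
  have h4 : HasFDerivAt (fun y => 2 * energy (confHam H h s) y)
      ((2 : ℝ) • fderiv ℝ (energy (confHam H h s)) (z t)) (z t) :=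
    (((hO.contDiffAt_energy_confHam hs (hO.mem t ht)).differentiableAt
      two_ne_zero).hasFDerivAt).const_mul 2
  have h5 := h3.unique (h4.congr_of_eventuallyEq (by
    filter_upwards [hO.dual.isOpen.mem_nhds (hO.mem t ht)] with y hy using hO.euler_confHam hs hy))
  have h6 := congrArg (fun L : Phase →L[ℝ] ℝ => L v) h5
  rw [add_comm]
  exact h6

theorem symm_second {s : ℝ} (hs : 0 ≤ s) {t : ℝ} (ht : t ∈ Icc a b) (v w : Phase) :
    (fderiv ℝ (fderiv ℝ (energy H)) (z t) - s • pullForm (fderiv ℝ (fderiv ℝ h) (z t).1)) v w =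
    (fderiv ℝ (fderiv ℝ (energy H)) (z t) - s • pullForm (fderiv ℝ (fderiv ℝ h) (z t).1)) w v := by
  rw [← (hO.fderiv_energy_confHam ht s).2.fderiv]
  exact ((hO.contDiffAt_energy_confHam hs (hO.mem t ht)).isSymmSndFDerivAt (by simp)) v w

theorem symm_second_zero {t : ℝ} (ht : t ∈ Icc a b) (v w : Phase) :
    fderiv ℝ (fderiv ℝ (energy H)) (z t) v w = fderiv ℝ (fderiv ℝ (energy H)) (z t) w v :=
  ((hO.contDiffAt_energy (hO.mem t ht)).isSymmSndFDerivAt (by simp)) v w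

end IsCriticalOrbit

/-! ### Linearized flows along a critical orbit -/

theorem _root_.ContDiffAt.continuousAt_fderiv_fderiv {V : Type*} [NormedAddCommGroup V]
    [NormedSpace ℝ V] {f : V → ℝ} {z : V} (hf : ContDiffAt ℝ 2 f z) :
    ContinuousAt (fderiv ℝ (fderiv ℝ f)) z :=
  ((hf.fderiv_right (m := 1) (by norm_num)).fderiv_right (m := 0) (by norm_num)).continuousAt

theorem continuous_bilinearComp {E G : Type*} [NormedAddCommGroup E] [NormedSpace ℝ E]
    [NormedAddCommGroup G] [NormedSpace ℝ G] (A B : G →L[ℝ] E) :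
    Continuous fun β : E →L[ℝ] E →L[ℝ] ℝ => β.bilinearComp A B := by
  have h1 : Continuous fun β : E →L[ℝ] E →L[ℝ] ℝ => (β.comp A).flip :=
    (ContinuousLinearMap.flipₗᵢ ℝ G E ℝ).continuous.comp (continuous_id.clm_comp continuous_const)
  exact (ContinuousLinearMap.flipₗᵢ ℝ G G ℝ).continuous.comp (h1.clm_comp continuous_const)

theorem continuous_pullForm : Continuous pullForm := continuous_bilinearComp _ _

theorem exists_forall_norm_le_of_continuousOn {E G : Type*} [NormedAddCommGroup E] [NormedSpace ℝ E]
    [NormedAddCommGroup G] [NormedSpace ℝ G] {a b : ℝ} {f : ℝ → E →L[ℝ] G}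
    (hf : ContinuousOn f (Icc a b)) : ∃ C, ∀ t ∈ Icc a b, ‖f t‖ ≤ C :=
  isCompact_Icc.exists_bound_of_continuousOn hf

/-- The generator of the linearized flow. -/
def generator (H : Phase → ℝ) (h : Plane → ℝ) (s : ℝ) (z : Phase) : Phase →L[ℝ] Phase :=
  sgrad.comp (fderiv ℝ (fderiv ℝ (energy H)) z - s • pullForm (fderiv ℝ (fderiv ℝ h) z.1))

/-- The linearized flows of the Hamiltonians `H / (1 + s h)` along an orbit. -/
structure IsLinearizedFlow (H : Phase → ℝ) (h : Plane → ℝ) (z : ℝ → Phase) (a b : ℝ)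
    (Y : ℝ → ℝ → Phase →L[ℝ] Phase) : Prop where
  init : ∀ s ∈ Icc (0 : ℝ) 1, Y s a = 1
  hasDeriv : ∀ s ∈ Icc (0 : ℝ) 1, ∀ t ∈ Icc a b,
    HasDerivWithinAt (Y s) ((generator H h s (z t)).comp (Y s t)) (Icc a b) t
  bound : ∃ D : ℝ, ∀ s ∈ Icc (0 : ℝ) 1, ∀ t ∈ Icc a b, ‖Y s t - Y 0 t‖ ≤ s * D

/-- The variation of the symplectic form under the linearized flows. -/
def variationForm (h : Plane → ℝ) (z : ℝ → Phase) (a b : ℝ) (Y : ℝ → ℝ → Phase →L[ℝ] Phase) (s : ℝ)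
    (y w : Phase) : ℝ :=
  ∫ t in a..b, fderiv ℝ (fderiv ℝ h) (z t).1 (Y s t y).1 (Y 0 t w).1

namespace IsCriticalOrbit

variable {H : Phase → ℝ} {O : Set Phase} {h : Plane → ℝ} {z : ℝ → Phase} {a b : ℝ}
  (hO : IsCriticalOrbit H O h z a b)

include hO

theorem continuousOn : ContinuousOn z (Icc a b) := fun t ht => (hO.hasDeriv t ht).continuousWithinAt

theorem continuousOn_hessian_energy :
    ContinuousOn (fun t => fderiv ℝ (fderiv ℝ (energy H)) (z t)) (Icc a b) := fun t ht =>
  (hO.contDiffAt_energy (hO.mem t ht)).continuousAt_fderiv_fderiv.comp_continuousWithinAt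
    (hO.continuousOn t ht)

theorem continuousOn_hessian :
    ContinuousOn (fun t => fderiv ℝ (fderiv ℝ h) (z t).1) (Icc a b) := fun t ht =>
  ContinuousAt.comp_continuousWithinAt (f := fun t => (z t).1)
    ((hO.smooth _ (hO.mem t ht)).of_le two_le_infty).continuousAt_fderiv_fderiv
    (hO.continuousOn t ht).fst

theorem exists_isLinearizedFlow : ∃ r : ℝ, 0 < r ∧ ∀ a' b' : ℝ, a' ≤ b' → b' - a' ≤ r →
    Icc a' b' ⊆ Icc a b → ∃ Y, IsLinearizedFlow H h z a' b' Y := by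
  have hA : ContinuousOn (fun t => sgrad.comp (fderiv ℝ (fderiv ℝ (energy H)) (z t))) (Icc a b) :=
    continuousOn_const.clm_comp hO.continuousOn_hessian_energy
  have hB : ContinuousOn (fun t => -(sgrad.comp (pullForm (fderiv ℝ (fderiv ℝ h) (z t).1))))
      (Icc a b) :=
    (continuousOn_const.clm_comp
      (continuous_pullForm.comp_continuousOn hO.continuousOn_hessian)).neg
  obtain ⟨C₁, hC₁⟩ := exists_forall_norm_le_of_continuousOn hA
  obtain ⟨C₂, hC₂⟩ := exists_forall_norm_le_of_continuousOn hB
  set C := max (max C₁ C₂) 1 with hC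
  have hC0 : 0 < C := lt_max_of_lt_right one_pos
  -- This is the length allowed by `exists_propagator_family`. It depends only on bounds over all of
  -- `[a, b]`, hence is uniform in the subinterval.
  refine ⟨1 / (4 * C), by positivity, fun a' b' hab hr hsub => ?_⟩
  obtain ⟨Y, hY, hD⟩ := exists_propagator_family hab (hA.mono hsub) (hB.mono hsub) (C := C)
    (fun t ht => (hC₁ t (hsub ht)).trans ((le_max_left _ _).trans (le_max_left _ _)))
    (fun t ht => (hC₂ t (hsub ht)).trans ((le_max_right _ _).trans (le_max_left _ _)))
    (by rw [le_div_iff₀ (by positivity)] at hr; linarith)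
  refine ⟨Y, fun s hs => (hY s hs).1, fun s hs t ht => ((hY s hs).2 t ht).congr_deriv ?_, hD⟩
  congr 1
  refine ContinuousLinearMap.ext fun w => ?_
  have h1 : generator H h s (z t) w = sgrad (fderiv ℝ (fderiv ℝ (energy H)) (z t) w -
    s • pullForm (fderiv ℝ (fderiv ℝ h) (z t).1) w) := rfl
  have h2 (v v' : Phase) : v + s • -v' = v - s • v' := by rw [smul_neg, sub_eq_add_neg]
  rw [h1, map_sub, map_smul]
  exact h2 _ _

theorem variationForm_self_nonneg (hab : a ≤ b) (Y : ℝ → ℝ → Phase →L[ℝ] Phase)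
    (y : Phase) :
    0 ≤ variationForm h z a b Y 0 y y :=
  intervalIntegral.integral_nonneg hab fun _ ht => second_deriv_nonneg_of_isLocalMin
    ((hO.smooth _ (hO.mem _ ht)).of_le two_le_infty) (hO.isLocalMin ht) _

variable {Y : ℝ → ℝ → Phase →L[ℝ] Phase} (hY : IsLinearizedFlow H h z a b Y)

include hY

omit hO in
theorem hasDeriv_apply {s : ℝ} (hs : s ∈ Icc (0 : ℝ) 1) {t : ℝ} (ht : t ∈ Icc a b) (y : Phase) :
    HasDerivWithinAt (fun t => Y s t y) (sgrad ((fderiv ℝ (fderiv ℝ (energy H)) (z t) -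
      s • pullForm (fderiv ℝ (fderiv ℝ h) (z t).1)) (Y s t y))) (Icc a b) t := by
  have := (hY.hasDeriv s hs t ht).clm_apply (hasDerivWithinAt_const t (Icc a b) y)
  refine this.congr_deriv ?_
  rw [map_zero, add_zero]
  rfl

omit hO in
theorem continuousOn_apply {s : ℝ} (hs : s ∈ Icc (0 : ℝ) 1) (y : Phase) :
    ContinuousOn (fun t => Y s t y) (Icc a b) :=
  fun _ ht => (hasDeriv_apply hY hs ht y).continuousWithinAt

theorem continuousOn_integrand {s : ℝ} (hs : s ∈ Icc (0 : ℝ) 1) (y w : Phase) :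
    ContinuousOn (fun t => fderiv ℝ (fderiv ℝ h) (z t).1 (Y s t y).1 (Y 0 t w).1) (Icc a b) :=
  (hO.continuousOn_hessian.clm_apply (continuousOn_apply hY hs y).fst).clm_apply
    (continuousOn_apply hY ⟨le_rfl, zero_le_one⟩ w).fst

/-- The derivative of the pairing is `s` times the Hessian of `h` on the base components;
integration gives an identity that is exact in `s`. -/
theorem omega_variation (hab : a ≤ b) {s : ℝ} (hs : s ∈ Icc (0 : ℝ) 1) (y w : Phase) :
    omega (Y s b y) (Y 0 b w) = omega y w + s * variationForm h z a b Y s y w := by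
  have h0 : (0 : ℝ) ∈ Icc (0 : ℝ) 1 := ⟨le_rfl, zero_le_one⟩
  have hd (t : ℝ) (ht : t ∈ Icc a b) : HasDerivWithinAt (fun t => omega (Y s t y) (Y 0 t w))
      (s * (fderiv ℝ (fderiv ℝ h) (z t).1 (Y s t y).1 (Y 0 t w).1)) (Icc a b) t := by
    refine hasDerivWithinAt_omega_linearized (S := fderiv ℝ (fderiv ℝ (energy H)) (z t))
      (hO.symm_second_zero ht) (hasDeriv_apply hY hs ht y) ?_
    have := hasDeriv_apply hY h0 ht w
    rwa [zero_smul, sub_zero] at this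
  have hint := intervalIntegral.integral_eq_sub_of_hasDeriv_right_of_le hab
    (fun t ht => (hd t ht).continuousWithinAt)
    (fun t ht => ((hd t (Ioo_subset_Icc_self ht)).Ici_of_Icc ⟨ht.1.le, ht.2⟩).Ioi_of_Ici)
    ((((hO.continuousOn_integrand hY hs y w)).const_smul s).intervalIntegrable_of_Icc hab)
  rw [intervalIntegral.integral_const_mul] at hint
  rw [variationForm, hint, hY.init s hs, hY.init 0 h0]
  simp

/-- The differential of the energy and the Liouville form are first integrals of the linearized
equation. Along the orbit neither depends on `s`, so all the flows preserve the same contact planes.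
-/
theorem contact_invariant {s : ℝ} (hs : s ∈ Icc (0 : ℝ) 1) {y : Phase}
    (h1 : fderiv ℝ (energy H) (z a) y = 0) (h2 : (z a).2 y.1 = 0) {t : ℝ} (ht : t ∈ Icc a b) :
    fderiv ℝ (energy H) (z t) (Y s t y) = 0 ∧ (z t).2 (Y s t y).1 = 0 := by
  have hz (t : ℝ) (ht : t ∈ Icc a b) : HasDerivWithinAt z
      (sgrad (fderiv ℝ (energy (confHam H h s)) (z t))) (Icc a b) t := by
    rw [(hO.fderiv_energy_confHam ht s).1]
    exact hO.hasDeriv t ht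
  have hy (t : ℝ) (ht : t ∈ Icc a b) := hasDeriv_apply hY hs ht y
  have ha : a ∈ Icc a b := ⟨le_rfl, ht.1.trans ht.2⟩
  have hYa : Y s a y = y := by rw [hY.init s hs]; rfl
  have e1 (t : ℝ) (ht : t ∈ Icc a b) : fderiv ℝ (energy (confHam H h s)) (z t) (Y s t y) = 0 := by
    have := eq_of_hasDerivWithinAt_zero (fun t ht => hasDerivWithinAt_fderiv_linearized
      (hO.fderiv_energy_confHam ht s).2 (hO.symm_second hs.1 ht) (hz t ht) (hy t ht)) ht
    rw [this, (hO.fderiv_energy_confHam ha s).1, hYa, h1]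
  -- The Liouville form is conserved only on the kernel of the differential of the energy, so `e1`
  -- is needed first.
  have e2 := eq_of_hasDerivWithinAt_zero (fun t ht => hasDerivWithinAt_liouville_linearized
      (hO.euler_second hs.1 ht) (hz t ht) (hy t ht) (e1 t ht)) ht
  have e3 := e1 t ht
  rw [(hO.fderiv_energy_confHam ht s).1] at e3
  refine ⟨e3, ?_⟩
  rw [e2, hYa, h2]

/-- The limit is joint in `s` and `y`, because a hypothetical fixed vector varies with `s`. -/
theorem tendsto_variationForm (hab : a ≤ b) (y w : Phase) :
    Tendsto (fun p : ℝ × Phase => variationForm h z a b Y p.1 p.2 w)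
      (𝓝[Icc 0 1] 0 ×ˢ 𝓝 y) (𝓝 (variationForm h z a b Y 0 y w)) := by
  have h0 : (0 : ℝ) ∈ Icc (0 : ℝ) 1 := ⟨le_rfl, zero_le_one⟩
  obtain ⟨D, hD⟩ := hY.bound
  obtain ⟨C, hC⟩ := exists_forall_norm_le_of_continuousOn hO.continuousOn_hessian
  obtain ⟨C₀, hC₀⟩ := exists_forall_norm_le_of_continuousOn (f := Y 0)
    (fun t ht => (hY.hasDeriv 0 h0 t ht).continuousWithinAt)
  obtain ⟨C₁, hC₁⟩ := isCompact_Icc.exists_bound_of_continuousOn (continuousOn_apply hY h0 w)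
  rw [tendsto_iff_norm_sub_tendsto_zero]
  have hlim : Tendsto (fun p : ℝ × Phase => C * (p.1 * D * ‖p.2‖ + C₀ * ‖p.2 - y‖) * C₁ * |b - a|)
      (𝓝[Icc 0 1] 0 ×ˢ 𝓝 y) (𝓝 0) := by
    have hc : Continuous (fun p : ℝ × Phase =>
      C * (p.1 * D * ‖p.2‖ + C₀ * ‖p.2 - y‖) * C₁ * |b - a|) := by fun_prop
    have := hc.tendsto (0, y)
    simp only [zero_mul, sub_self, norm_zero, mul_zero, add_zero, nhds_prod_eq] at this
    exact this.mono_left (prod_mono nhdsWithin_le_nhds le_rfl)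
  refine squeeze_zero' (Eventually.of_forall fun _ => norm_nonneg _) ?_ hlim
  have hmem : ∀ᶠ p : ℝ × Phase in 𝓝[Icc 0 1] (0 : ℝ) ×ˢ 𝓝 y, p.1 ∈ Icc (0 : ℝ) 1 :=
    tendsto_fst.eventually self_mem_nhdsWithin
  filter_upwards [hmem] with p hp
  rw [variationForm, variationForm, ← intervalIntegral.integral_sub
    ((hO.continuousOn_integrand hY hp p.2 w).intervalIntegrable_of_Icc hab)
    ((hO.continuousOn_integrand hY h0 y w).intervalIntegrable_of_Icc hab)]
  refine intervalIntegral.norm_integral_le_of_norm_le_const fun t ht => ?_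
  rw [uIoc_of_le hab] at ht
  have ht' := Ioc_subset_Icc_self ht
  set β := fderiv ℝ (fderiv ℝ h) (z t).1
  have e1 : β (Y p.1 t p.2).1 (Y 0 t w).1 - β (Y 0 t y).1 (Y 0 t w).1 =
      β (Y p.1 t p.2 - Y 0 t y).1 (Y 0 t w).1 := by
    rw [Prod.fst_sub, map_sub, sub_apply]
  have e2 : ‖Y p.1 t p.2 - Y 0 t y‖ ≤ p.1 * D * ‖p.2‖ + C₀ * ‖p.2 - y‖ := by
    have : Y p.1 t p.2 - Y 0 t y = (Y p.1 t - Y 0 t) p.2 + Y 0 t (p.2 - y) := by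
      rw [sub_apply, map_sub]; abel
    rw [this]
    refine (norm_add_le _ _).trans (add_le_add ?_ ?_)
    · exact (ContinuousLinearMap.le_opNorm _ _).trans (by gcongr; exact hD _ hp _ ht')
    · exact (ContinuousLinearMap.le_opNorm _ _).trans (by gcongr; exact hC₀ _ ht')
  have hC0 : 0 ≤ C := (norm_nonneg _).trans (hC t ht')
  rw [e1]
  calc ‖β (Y p.1 t p.2 - Y 0 t y).1 (Y 0 t w).1‖
      ≤ ‖β (Y p.1 t p.2 - Y 0 t y).1‖ * ‖(Y 0 t w).1‖ := ContinuousLinearMap.le_opNorm _ _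
    _ ≤ (‖β‖ * ‖(Y p.1 t p.2 - Y 0 t y).1‖) * ‖(Y 0 t w).1‖ := by
        gcongr; exact ContinuousLinearMap.le_opNorm _ _
    _ ≤ (C * (p.1 * D * ‖p.2‖ + C₀ * ‖p.2 - y‖)) * C₁ := by
        gcongr
        · exact mul_nonneg hC0 ((norm_nonneg _).trans e2)
        · exact hC t ht'
        · exact (norm_fst_le _).trans e2
        · exact (norm_fst_le _).trans (hC₁ t ht')

/-- If the second derivative of the conformal factor does not vanish along the orbit, then the
variation of the symplectic form is positive on the contact planes. -/
theorem variationForm_self_pos (hab : a < b)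
    (hne : ∀ t ∈ Icc a b, fderiv ℝ (fderiv ℝ h) (z t).1 ≠ 0) {y : Phase}
    (h1 : fderiv ℝ (energy H) (z a) y = 0) (h2 : (z a).2 y.1 = 0) (hy : y ≠ 0) :
    0 < variationForm h z a b Y 0 y y := by
  have h0 : (0 : ℝ) ∈ Icc (0 : ℝ) 1 := ⟨le_rfl, zero_le_one⟩
  have ha : a ∈ Icc a b := ⟨le_rfl, hab.le⟩
  refine (hO.variationForm_self_nonneg hab.le Y y).lt_of_ne' fun hzero => hy ?_
  have hpsd (t : ℝ) (ht : t ∈ Icc a b) (v : Plane) : 0 ≤ fderiv ℝ (fderiv ℝ h) (z t).1 v v :=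
    second_deriv_nonneg_of_isLocalMin
      ((hO.smooth _ (hO.mem _ ht)).of_le two_le_infty) (hO.isLocalMin ht) _
  have hsymm (t : ℝ) (ht : t ∈ Icc a b) (v w : Plane) :
      fderiv ℝ (fderiv ℝ h) (z t).1 v w = fderiv ℝ (fderiv ℝ h) (z t).1 w v :=
    (((hO.smooth _ (hO.mem _ ht)).of_le two_le_infty).isSymmSndFDerivAt (by simp)) v w
  -- the integrand vanishes
  have hint (t : ℝ) (ht : t ∈ Icc a b) :
      fderiv ℝ (fderiv ℝ h) (z t).1 (Y 0 t y).1 (Y 0 t y).1 = 0 := by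
    by_contra hpos
    have := intervalIntegral.integral_pos hab (hO.continuousOn_integrand hY h0 y y)
      (fun t ht => hpsd t (Ioc_subset_Icc_self ht) _)
      ⟨t, ht, (hpsd t ht _).lt_of_ne' hpos⟩
    exact this.ne' hzero
  -- the base component of the solution vanishes
  have hfst (t : ℝ) (ht : t ∈ Icc a b) : (Y 0 t y).1 = 0 := by
    set β := fderiv ℝ (fderiv ℝ h) (z t).1 with hβ
    set X := (sgrad (fderiv ℝ (energy H) (z t))).1 with hX
    -- The differential of `h` vanishes along the whole orbit, so its derivative in the direction of
    -- the velocity is zero.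
    have hβX (v : Plane) : β v X = 0 := by
      have hd := hasDerivWithinAt_fst_apply (hO.hasDeriv t ht)
      have e1 : HasDerivWithinAt (fun t => fderiv ℝ h (z t).1) (β X) (Icc a b) t :=
        (((hO.smooth _ (hO.mem _ ht)).of_le two_le_infty).hasFDerivAt_fderiv).comp_hasDerivWithinAt
          t hd
      have e2 : HasDerivWithinAt (fun t => fderiv ℝ h (z t).1) 0 (Icc a b) t :=
        (hasDerivWithinAt_const t (Icc a b) (0 : DualPlane)).congr
          (fun r hr => (hO.isLocalMin hr).fderiv_eq_zero) (hO.isLocalMin ht).fderiv_eq_zero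
      have e3 : β X = 0 := ((uniqueDiffOn_Icc hab) t ht).eq_deriv _ e1 e2
      rw [hsymm t ht, e3]
      rfl
    -- A null vector of a semidefinite form lies in its kernel.
    have hβa (v : Plane) : β v (Y 0 t y).1 = 0 := by
      set a₀ := (Y 0 t y).1
      have key (r : ℝ) : 0 ≤ β v v + 2 * r * β v a₀ := by
        have := hpsd t ht (v + r • a₀)
        simp only [map_add, map_smul, add_apply, smul_apply, smul_eq_mul] at this
        have e1 : β a₀ v = β v a₀ := hsymm t ht a₀ v
        have e2 : β a₀ a₀ = 0 := hint t ht
        rw [e1, e2] at this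
        linarith
      by_contra hv
      -- This `r` gives the right hand side of `key` the value `-1`.
      have := key (-(β v v + 1) / (2 * β v a₀))
      field_simp at this
      linarith
    -- The momentum is `1` on the velocity and `0` on the base component of a contact vector. If the
    -- latter is nonzero, the two vectors span the plane, and `β` vanishes on both, contrary to
    -- `hne`.
    have hp1 : (z t).2 X = 1 := by
      rw [hX, apply_sgrad_fst, hO.dual.euler _ (hO.mem t ht), energy, hO.unit t ht]
      norm_num
    have hp0 : (z t).2 (Y 0 t y).1 = 0 := (hO.contact_invariant hY h0 h1 h2 ht).2
    by_contra hne0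
    have hX0 : X ≠ 0 := fun h => by rw [h, map_zero] at hp1; exact zero_ne_one hp1
    have hli : LinearIndependent ℝ ![X, (Y 0 t y).1] := by
      rw [LinearIndependent.pair_iff' hX0]
      intro r hr
      rw [← hr, map_smul, hp1, smul_eq_mul, mul_one] at hp0
      rw [hp0, zero_smul] at hr
      exact hne0 hr.symm
    have hspan := hli.span_eq_top_of_card_eq_finrank' (by simp)
    refine hne t ht (ContinuousLinearMap.ext fun v => ContinuousLinearMap.ext fun w => ?_)
    have hw : w ∈ Submodule.span ℝ (range ![X, (Y 0 t y).1]) := hspan ▸ Submodule.mem_top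
    change β v w = 0
    induction hw using Submodule.span_induction with
    | mem x hx =>
      obtain ⟨i, rfl⟩ := hx
      fin_cases i
      · exact hβX v
      · exact hβa v
    | zero => exact map_zero _
    | add x x' _ _ e1 e2 => rw [map_add, e1, e2, add_zero]
    | smul r x _ e1 => rw [map_smul, e1, smul_zero]
  -- so the fibre component vanishes as well
  have hYa : Y 0 a y = y := by rw [hY.init 0 h0]; rfl
  have hy1 : y.1 = 0 := by rw [← hYa]; exact hfst a ha
  have hder := hasDerivWithinAt_fst_apply (hasDeriv_apply hY h0 ha y)
  have hder0 : HasDerivWithinAt (fun t => (Y 0 t y).1) 0 (Icc a b) a :=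
    (hasDerivWithinAt_const a (Icc a b) (0 : Plane)).congr hfst (hfst a ha)
  have hzero' := ((uniqueDiffOn_Icc hab) a ha).eq_deriv _ hder hder0
  rw [zero_smul, sub_zero, hYa] at hzero'
  have hy2 : y = (0, y.2) := Prod.ext hy1 rfl
  -- The base component of the velocity of `Y 0 t y` at `a` is the fibre Hessian applied to `y.2`.
  have hα : y.2 = 0 := hO.dual.nondegenerate _ (hO.mem a ha) y.2 fun β => by
    rw [← hy2, ← apply_sgrad_fst, hzero', map_zero]
  rw [hy2, hα]
  rfl

end IsCriticalOrbit

section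

variable {M : Type*} [TopologicalSpace M] [ChartedSpace Plane M] [IsManifold (𝓡 2) ∞ M]
  {F : TangentBundle (𝓡 2) M → ℝ}

/-! ### The Reeb flow in charts -/

theorem fderiv_energy_congr {H H' : Phase → ℝ} {O : Set Phase} (hO : IsOpen O) (h : EqOn H H' O)
    {y : Phase} (hy : y ∈ O) : fderiv ℝ (energy H) y = fderiv ℝ (energy H') y := by
  refine Filter.EventuallyEq.fderiv_eq ?_
  filter_upwards [hO.mem_nhds hy] with x hx
  rw [energy, energy, h hx]

theorem energy_const {H : Phase → ℝ} {a b : ℝ} {y : ℝ → Phase}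
    (hd : ∀ t ∈ Icc a b, DifferentiableAt ℝ (energy H) (y t))
    (hy : ∀ t ∈ Icc a b, HasDerivWithinAt y (sgrad (fderiv ℝ (energy H) (y t))) (Icc a b) t)
    {t : ℝ} (ht : t ∈ Icc a b) : energy H (y t) = energy H (y a) := by
  refine eq_of_hasDerivWithinAt_zero (f := fun t => energy H (y t)) (fun t ht => ?_) ht
  refine ((hd t ht).hasFDerivAt.comp_hasDerivWithinAt t (hy t ht)).congr_deriv ?_
  rw [← neg_eq_zero, ← omega_sgrad, omega_self]

/-- The curve `y` in the unit cotangent bundle satisfies the Reeb equation at time `t`. -/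
def IsReebCurveAt (F : TangentBundle (𝓡 2) M → ℝ) (y : ℝ → CotangentBundle M) (A : Set ℝ) (t : ℝ) :
    Prop :=
  y t ∈ unitCotangent F ∧ ∃ R : TangentSpace cotangentModel (y t), IsReebVector F (y t) R ∧
    HasMFDerivWithinAt 𝓘(ℝ, ℝ) cotangentModel y A t ((1 : ℝ →L[ℝ] ℝ).smulRight R)

theorem IsReebCurveAt.congr {y y' : ℝ → CotangentBundle M} {A : Set ℝ} {t : ℝ}
    (h : IsReebCurveAt F y A t) (ht : t ∈ A) (hEq : EqOn y' y A) : IsReebCurveAt F y' A t := by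
  obtain ⟨h1, R, hR, hd⟩ := h
  have hd' := hd.congr_of_eventuallyEq (eventually_of_mem self_mem_nhdsWithin hEq) (hEq ht)
  have key (e : CotangentBundle M) (he : e = y t) : e ∈ unitCotangent F ∧
      IsReebVector F e (R : Phase) := by
    subst he
    exact ⟨h1, hR⟩
  exact ⟨(key _ (hEq ht)).1, R, (key _ (hEq ht)).2, hd'⟩

theorem IsReebCurveAt.mono_of_mem_nhdsWithin {y : ℝ → CotangentBundle M} {A B : Set ℝ} {t : ℝ}
    (h : IsReebCurveAt F y A t) (hA : A ∈ 𝓝[B] t) : IsReebCurveAt F y B t := by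
  obtain ⟨h1, R, hR, hd⟩ := h
  exact ⟨h1, R, hR, hd.mono_of_mem_nhdsWithin hA⟩

/-- Uniqueness of the Reeb vector allows one-sided derivatives to be glued. -/
theorem IsReebCurveAt.union {y : ℝ → CotangentBundle M} {A B : Set ℝ} {t : ℝ}
    (h : IsReebCurveAt F y A t) (h' : IsReebCurveAt F y B t) : IsReebCurveAt F y (A ∪ B) t := by
  obtain ⟨h1, R, hR, hd⟩ := h
  obtain ⟨-, R', hR', hd'⟩ := h'
  rw [← hR.unique hR'] at hd'
  exact ⟨h1, R, hR, hd.union hd'⟩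

/-- Concatenation of Reeb curves. -/
theorem IsReebCurveAt.concat {y₁ y₂ y : ℝ → CotangentBundle M} {a b c : ℝ} (hab : a ≤ b)
    (hbc : b ≤ c) (h1 : ∀ t ∈ Icc a b, IsReebCurveAt F y₁ (Icc a b) t)
    (h2 : ∀ t ∈ Icc b c, IsReebCurveAt F y₂ (Icc b c) t) (e1 : EqOn y y₁ (Icc a b))
    (e2 : EqOn y y₂ (Icc b c)) {t : ℝ} (ht : t ∈ Icc a c) : IsReebCurveAt F y (Icc a c) t := by
  have h1' (t) (ht : t ∈ Icc a b) := (h1 t ht).congr ht e1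
  have h2' (t) (ht : t ∈ Icc b c) := (h2 t ht).congr ht e2
  have hU : Icc a b ∪ Icc b c = Icc a c := Icc_union_Icc_eq_Icc hab hbc
  rcases lt_trichotomy t b with h | h | h
  -- Before the junction `b`, the second interval does not accumulate at `t`.
  · refine (h1' t ⟨ht.1, h.le⟩).mono_of_mem_nhdsWithin ?_
    rw [← hU, nhdsWithin_union, mem_sup]
    refine ⟨self_mem_nhdsWithin, ?_⟩
    rw [(notMem_closure_iff_nhdsWithin_eq_bot).1 (by rw [isClosed_Icc.closure_eq]; exact fun h' => h.not_ge h'.1)]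
    exact mem_bot
  · subst h
    rw [← hU]
    exact (h1' t ⟨ht.1, le_rfl⟩).union (h2' t ⟨le_rfl, ht.2⟩)
  · refine (h2' t ⟨h.le, ht.2⟩).mono_of_mem_nhdsWithin ?_
    rw [← hU, nhdsWithin_union, mem_sup]
    refine ⟨?_, self_mem_nhdsWithin⟩
    rw [(notMem_closure_iff_nhdsWithin_eq_bot).1 (by rw [isClosed_Icc.closure_eq]; exact fun h' => h.not_ge h'.2)]
    exact mem_bot

/-- Integral curves of the Hamiltonian vector field on the unit level are Reeb orbits. -/
theorem isReebOrbit_of_chart {c : M} {O : Set Phase} (hO : IsOpen O)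
    (hsub : O ⊆ (cotChart c).target) (hsm : ContDiffOn ℝ ∞ (dualExpr F c) O)
    (hpos : ∀ y ∈ O, 0 < dualExpr F c y)
    (heuler : ∀ y ∈ O, fderiv ℝ (energy (dualExpr F c)) y (0, y.2) = 2 * energy (dualExpr F c) y)
    {a b : ℝ} {y : ℝ → Phase} (hyO : ∀ t ∈ Icc a b, y t ∈ O)
    (hy : ∀ t ∈ Icc a b,
      HasDerivWithinAt y (sgrad (fderiv ℝ (energy (dualExpr F c)) (y t))) (Icc a b) t)
    (h1 : dualExpr F c (y a) = 1) {t : ℝ} (ht : t ∈ Icc a b) :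
    IsReebCurveAt F (fun r => (cotChart c).symm (y r)) (Icc a b) t := by
  have hd (x : Phase) (hx : x ∈ O) : DifferentiableAt ℝ (dualExpr F c) x :=
    (hsm.contDiffAt (hO.mem_nhds hx)).differentiableAt (by simp)
  -- The energy is conserved and `F*` is positive on `O`, so the unit level is preserved.
  have hunit : dualExpr F c (y t) = 1 := by
    have := energy_const (fun t ht => (hasFDerivAt_energy (hd _ (hyO t ht))).differentiableAt) hy ht
    rw [energy, energy, h1] at this
    have h2 := hpos _ (hyO t ht)
    nlinarith
  set e := (cotChart c).symm (y t) with he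
  have hes : e ∈ (cotChart c).source := (cotChart c).map_target (hsub (hyO t ht))
  have hinv : cotChart c e = y t := (cotChart c).right_inv (hsub (hyO t ht))
  have hR := isReebVector_sgrad (F := F) hes (by rw [hinv]; exact hd _ (hyO t ht)) hunit
    (by rw [hinv]; exact heuler _ (hyO t ht))
  refine ⟨hunit, _, hR, ?_⟩
  have h2 : HasMFDerivAt 𝓘(ℝ, Phase) cotangentModel (cotChart c).symm (y t)
      ((cotDerivEquiv c e hes).symm : Phase →L[ℝ] Phase) := by
    have := hasMFDerivAt_cotChart_symm hes
    rwa [hinv] at this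
  have h3 : HasMFDerivWithinAt 𝓘(ℝ, ℝ) 𝓘(ℝ, Phase) y (Icc a b) t
      ((1 : ℝ →L[ℝ] ℝ).smulRight (sgrad (fderiv ℝ (energy (dualExpr F c)) (cotChart c e)))) := by
    rw [hinv]
    exact (hy t ht).hasFDerivWithinAt.hasMFDerivWithinAt
  have h4 := h2.comp_hasMFDerivWithinAt t h3
  refine h4.congr_mfderiv ?_
  have key (r : ℝ) (X : Phase) :
      (cotDerivEquiv c e hes).symm (r • X) = r • (cotDerivEquiv c e hes).symm X := map_smul _ r X
  exact ContinuousLinearMap.ext fun r => key r _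

theorem tendsto_clm_comp {ι E : Type*} [NormedAddCommGroup E] [NormedSpace ℝ E] {l : Filter ι}
    {A B : ι → E →L[ℝ] E} {A₀ B₀ : E →L[ℝ] E} (hA : Tendsto A l (𝓝 A₀)) (hB : Tendsto B l (𝓝 B₀)) :
    Tendsto (fun i => (A i).comp (B i)) l (𝓝 (A₀.comp B₀)) := by
  have h : Continuous fun p : (E →L[ℝ] E) × (E →L[ℝ] E) => p.1.comp p.2 :=
    continuous_fst.clm_comp continuous_snd
  exact (h.tendsto (A₀, B₀)).comp (hA.prodMk_nhds hB)

theorem tendsto_clm_apply {ι E : Type*} [NormedAddCommGroup E] [NormedSpace ℝ E] {l : Filter ι}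
    {A : ι → E →L[ℝ] E} {v : ι → E} {A₀ : E →L[ℝ] E} {v₀ : E} (hA : Tendsto A l (𝓝 A₀))
    (hv : Tendsto v l (𝓝 v₀)) : Tendsto (fun i => A i (v i)) l (𝓝 (A₀ v₀)) := by
  have h : Continuous fun p : (E →L[ℝ] E) × E => p.1 p.2 := continuous_fst.clm_apply continuous_snd
  exact (h.tendsto (A₀, v₀)).comp (hA.prodMk_nhds hv)

/-! ### Transport along a segment of a geodesic -/

/-- The conformal family `(1 + s f) F`. -/
abbrev family (f : M → ℝ) (F : TangentBundle (𝓡 2) M → ℝ) (s : ℝ) : TangentBundle (𝓡 2) M → ℝ :=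
  conformal (fun x => 1 + s * f x) F

/-- The derivatives `D s` of the Reeb flows of the metrics `(1 + s f) F` along the segment of the
orbit `γ` over `[a, b]`, and the variation `Q` of the symplectic form. -/
structure IsTransport (F : TangentBundle (𝓡 2) M → ℝ) (f : M → ℝ) (γ : ℝ → CotangentBundle M)
    (a b : ℝ) (D : ℝ → Phase →L[ℝ] Phase) (Q : ℝ → Phase → Phase → ℝ) : Prop where
  flow : ∀ s ∈ Icc (0 : ℝ) 1, ∃ φ : ℝ → CotangentBundle M → CotangentBundle M,
    φ b (γ a) = γ b ∧ HasMFDerivAt cotangentModel cotangentModel (φ b) (γ a) (D s) ∧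
    ∀ᶠ e in 𝓝[unitCotangent (family f F s)] (γ a), φ a e = e ∧
      ∀ t ∈ Icc a b, IsReebCurveAt (family f F s) (fun r => φ r e) (Icc a b) t
  mapsTo : ∀ s ∈ Icc (0 : ℝ) 1, ∀ y ∈ contactSpace F (γ a), D s y ∈ contactSpace F (γ b)
  tendsto_deriv : Tendsto D (𝓝[Icc 0 1] 0) (𝓝 (D 0))
  pairing : ∀ s ∈ Icc (0 : ℝ) 1, ∀ y w, omega (D s y) (D 0 w) = omega y w + s * Q s y w
  tendsto_form : ∀ y w,
    Tendsto (fun p : ℝ × Phase => Q p.1 p.2 w) (𝓝[Icc 0 1] 0 ×ˢ 𝓝 y) (𝓝 (Q 0 y w))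
  nonneg : ∀ y, 0 ≤ Q 0 y y

/-- The variation of the symplectic form is positive on the contact plane. -/
def IsPositiveOn (F : TangentBundle (𝓡 2) M → ℝ) (e : CotangentBundle M) (Q : ℝ → Phase → Phase → ℝ) :
    Prop :=
  ∀ y ∈ contactSpace F e, y ≠ 0 → 0 < Q 0 y y

/-- The second form is pulled back by the first transport. At `s = 0` both summands are nonnegative
on the diagonal, so positivity on one segment persists under composition. -/
theorem IsTransport.comp {f : M → ℝ} {γ : ℝ → CotangentBundle M} {a b c : ℝ} (hab : a ≤ b)
    (hbc : b ≤ c) {D₁ D₂ : ℝ → Phase →L[ℝ] Phase} {Q₁ Q₂ : ℝ → Phase → Phase → ℝ}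
    (h₁ : IsTransport F f γ a b D₁ Q₁) (h₂ : IsTransport F f γ b c D₂ Q₂) :
    IsTransport F f γ a c (fun s => (D₂ s).comp (D₁ s))
      (fun s y w => Q₁ s y w + Q₂ s (D₁ s y) (D₁ 0 w)) where
  flow s hs := by
    obtain ⟨φ₁, e₁, d₁, n₁⟩ := h₁.flow s hs
    obtain ⟨φ₂, e₂, d₂, n₂⟩ := h₂.flow s hs
    have hb (e : CotangentBundle M) : (if b < b then φ₁ b e else φ₂ b (φ₁ b e)) = φ₂ b (φ₁ b e) :=
      if_neg (lt_irrefl b)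
    have hc : (fun e => if c < b then φ₁ c e else φ₂ c (φ₁ b e)) = φ₂ c ∘ φ₁ b :=
      funext fun e => if_neg hbc.not_gt
    -- At the junction both branches agree, since `φ₂ b` is the identity on the unit cotangent
    -- bundle near `γ b`.
    refine ⟨fun t e => if t < b then φ₁ t e else φ₂ t (φ₁ b e), ?_, ?_, ?_⟩
    · exact (congrFun hc (γ a)).trans ((congrArg (φ₂ c) e₁).trans e₂)
    · change HasMFDerivAt cotangentModel cotangentModel
        (fun e => if c < b then φ₁ c e else φ₂ c (φ₁ b e)) (γ a) ((D₂ s).comp (D₁ s))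
      rw [hc]
      have d₂' : HasMFDerivAt cotangentModel cotangentModel (φ₂ c) (φ₁ b (γ a)) (D₂ s) := by
        rw [e₁]; exact d₂
      exact HasMFDerivAt.comp (γ a) d₂' d₁
    -- The flow property of `φ₂` is known only on the unit cotangent bundle, so `φ₁ b` must be shown
    -- to map into it.
    · have hmem : ∀ᶠ e in 𝓝[unitCotangent (family f F s)] (γ a),
          φ₁ b e ∈ unitCotangent (family f F s) := by
        filter_upwards [n₁] with e he using (he.2 b ⟨hab, le_rfl⟩).1
      have htend : Tendsto (φ₁ b) (𝓝[unitCotangent (family f F s)] (γ a))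
          (𝓝[unitCotangent (family f F s)] (γ b)) := by
        refine tendsto_nhdsWithin_iff.2 ⟨?_, hmem⟩
        have := d₁.continuousAt.tendsto.mono_left
          (nhdsWithin_le_nhds (s := unitCotangent (family f F s)))
        rwa [e₁] at this
      filter_upwards [n₁, htend.eventually n₂] with e he₁ he₂
      have eq1 : EqOn (fun r => if r < b then φ₁ r e else φ₂ r (φ₁ b e)) (fun r => φ₁ r e)
          (Icc a b) := by
        intro r hr
        rcases hr.2.lt_or_eq with h | rfl
        · exact if_pos h
        · exact (hb e).trans he₂.1
      have eq2 : EqOn (fun r => if r < b then φ₁ r e else φ₂ r (φ₁ b e))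
          (fun r => φ₂ r (φ₁ b e)) (Icc b c) := fun r hr => if_neg hr.1.not_gt
      exact ⟨(eq1 ⟨le_rfl, hab⟩).trans he₁.1,
        fun t ht => IsReebCurveAt.concat hab hbc he₁.2 he₂.2 eq1 eq2 ht⟩
  mapsTo s hs y hy := h₂.mapsTo s hs _ (h₁.mapsTo s hs y hy)
  tendsto_deriv := tendsto_clm_comp h₂.tendsto_deriv h₁.tendsto_deriv
  pairing s hs y w := by
    change omega (D₂ s (D₁ s y)) (D₂ 0 (D₁ 0 w)) = _
    rw [h₂.pairing s hs, h₁.pairing s hs]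
    ring
  tendsto_form y w := by
    refine (h₁.tendsto_form y w).add ?_
    have h3 : Tendsto (fun p : ℝ × Phase => (p.1, D₁ p.1 p.2)) (𝓝[Icc 0 1] 0 ×ˢ 𝓝 y)
        (𝓝[Icc 0 1] 0 ×ˢ 𝓝 (D₁ 0 y)) :=
      tendsto_fst.prodMk (tendsto_clm_apply (h₁.tendsto_deriv.comp tendsto_fst) tendsto_snd)
    exact (h₂.tendsto_form (D₁ 0 y) (D₁ 0 w)).comp h3
  nonneg y := add_nonneg (h₁.nonneg y) (h₂.nonneg _)

end

section

variable {M : Type*} [TopologicalSpace M] [ChartedSpace Plane M] [IsManifold (𝓡 2) ∞ M]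
  {F : TangentBundle (𝓡 2) M → ℝ}

/-! ### Local existence of the transport -/

/-- The orbit of the Reeb flow which corresponds to a curve. -/
def lift (F : TangentBundle (𝓡 2) M → ℝ) (σ : ℝ → M) (t : ℝ) : CotangentBundle M :=
  legendre F (velocity σ t)

/-- Near every time, a closed geodesic is a critical orbit in a chart. -/
theorem IsClosedGeodesic.exists_isCriticalOrbit (hF : IsFinslerMetric F) {σ : ℝ → M} {T : ℝ}
    (hσ : IsClosedGeodesic F σ T) {f : M → ℝ} (hf : ContMDiff (𝓡 2) 𝓘(ℝ, ℝ) ∞ f)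
    (hf0 : ∀ x, 0 ≤ f x) (hfσ : ∀ t, f (σ t) = 0) (t₀ : ℝ) :
    ∃ O : Set Phase, ∃ δ > 0, O ⊆ (cotChart (σ t₀)).target ∧
      IsCriticalOrbit (dualExpr F (σ t₀)) O (baseExpr f (σ t₀))
        (fun t => cotChart (σ t₀) (lift F σ t)) (t₀ - δ) (t₀ + δ) ∧
      (∀ t ∈ Icc (t₀ - δ) (t₀ + δ), lift F σ t ∈ (cotChart (σ t₀)).source) ∧
      ∀ s, 0 ≤ s → EqOn (dualExpr (family f F s) (σ t₀))
        (confHam (dualExpr F (σ t₀)) (baseExpr f (σ t₀)) s) O := by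
  set c := σ t₀
  obtain ⟨O, hO, hdual, hleg, -⟩ := hF.exists_isDualNormOn (mem_extChartAt_source c)
    (hσ.vec_velocity_ne_zero hF t₀)
  have hsub : O ⊆ (cotChart c).target := by
    intro z hz
    obtain ⟨y, w, hy, -, rfl⟩ := hleg z hz
    exact (cotChart c).map_source (mem_cotChart_source.2 hy)
  have hsrc : ∀ᶠ t in 𝓝 t₀, σ t ∈ (extChartAt (𝓡 2) c).source :=
    hσ.smooth.continuous.continuousAt.eventually_mem
      ((isOpen_extChartAt_source c).mem_nhds (mem_extChartAt_source c))
  have hd (t : ℝ) (ht : σ t ∈ (extChartAt (𝓡 2) c).source) := (hσ.hasDerivAt_cotChart hF ht).1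
  have hmem : ∀ᶠ t in 𝓝 t₀, cotChart c (lift F σ t) ∈ O :=
    (hd t₀ (mem_extChartAt_source c)).continuousAt.eventually_mem (hdual.isOpen.mem_nhds hO)
  obtain ⟨δ, hδ, hball⟩ := Metric.nhds_basis_closedBall.eventually_iff.1 (hsrc.and hmem)
  rw [Real.closedBall_eq_Icc] at hball
  have hcs (t) (ht : t ∈ Icc (t₀ - δ) (t₀ + δ)) : lift F σ t ∈ (cotChart c).source :=
    mem_cotChart_source.2 (hball ht).1
  refine ⟨O, δ, hδ, hsub, ?_, hcs, fun s hs z hz => ?_⟩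
  · refine ⟨hdual, fun y hy => contDiffAt_baseExpr hf (mem_cotChart_target.1 (hsub hy)),
      fun y _ => hf0 _, fun t ht => (hball ht).2,
      fun t ht => (hd t (hball ht).1).hasDerivWithinAt, fun t ht => ?_, fun t ht => ?_⟩
    · refine (dualExpr_cotChart F (hcs t ht)).trans ?_
      exact (hF.dualMetric_legendre _).trans (hσ.unit_speed t)
    · exact (congrArg f ((extChartAt (𝓡 2) c).left_inv (hball ht).1)).trans (hfσ t)
  · obtain ⟨y, w, hy, -, rfl⟩ := hleg z hz
    have hu (x : M) : 0 < 1 + s * f x :=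
      zero_lt_one.trans_le (le_add_of_nonneg_right (mul_nonneg hs (hf0 x)))
    have hus : ContMDiff (𝓡 2) 𝓘(ℝ, ℝ) ∞ fun x => 1 + s * f x :=
      contMDiff_const.add (contMDiff_const.mul hf)
    exact hF.dualExpr_conformal hu (hF.conformal hu hus) hy w

theorem tendsto_of_norm_sub_le {W : Type*} [NormedAddCommGroup W] [NormedSpace ℝ W]
    {A : ℝ → W →L[ℝ] W} {D : ℝ} (hA : ∀ s ∈ Icc (0 : ℝ) 1, ‖A s - A 0‖ ≤ s * D) :
    Tendsto A (𝓝[Icc 0 1] 0) (𝓝 (A 0)) := by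
  rw [tendsto_iff_norm_sub_tendsto_zero]
  have h2 : Tendsto (fun s : ℝ => s * D) (𝓝[Icc 0 1] 0) (𝓝 0) := by
    have : Continuous fun s : ℝ => s * D := by fun_prop
    simpa using (this.tendsto 0).mono_left (nhdsWithin_le_nhds (s := Icc (0 : ℝ) 1))
  refine squeeze_zero' (Eventually.of_forall fun _ => norm_nonneg _) ?_ h2
  filter_upwards [self_mem_nhdsWithin] with s hs using hA s hs

theorem tendsto_comp_clm {E : Type*} [NormedAddCommGroup E] [NormedSpace ℝ E] {q : ℝ → E → ℝ}
    {l : Filter ℝ} {r : ℝ} (A : E →L[ℝ] E) {y : E}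
    (h : Tendsto (fun p : ℝ × E => q p.1 p.2) (l ×ˢ 𝓝 (A y)) (𝓝 r)) :
    Tendsto (fun p : ℝ × E => q p.1 (A p.2)) (l ×ˢ 𝓝 y) (𝓝 r) :=
  h.comp (tendsto_fst.prodMk ((A.continuous.tendsto y).comp tendsto_snd))

theorem IsCriticalOrbit.tendsto_variationForm_comp {H : Phase → ℝ} {O : Set Phase} {h : Plane → ℝ}
    {z : ℝ → Phase} {a b : ℝ} (hO : IsCriticalOrbit H O h z a b)
    {Y : ℝ → ℝ → Phase →L[ℝ] Phase} (hY : IsLinearizedFlow H h z a b Y) (hab : a ≤ b)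
    (A : Phase →L[ℝ] Phase) (y w : Phase) :
    Tendsto (fun p : ℝ × Phase => variationForm h z a b Y p.1 (A p.2) w)
      (𝓝[Icc 0 1] 0 ×ˢ 𝓝 y) (𝓝 (variationForm h z a b Y 0 (A y) w)) := 
  tendsto_comp_clm (q := fun s v => variationForm h z a b Y s v w) A
    (hO.tendsto_variationForm hY hab (A y) w)

/-- On the unit level the Reeb flow is the Hamiltonian flow of the energy read in the chart. The
linearization of this field along the orbit is `generator`, so `Y s` is the derivative of the flow.
-/
theorem exists_reebFlow_of_isCriticalOrbit {f : M → ℝ} {γ : ℝ → CotangentBundle M} {c : M}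
    {O : Set Phase} {a b : ℝ} (hab : a ≤ b) (hsub : O ⊆ (cotChart c).target)
    (hO : IsCriticalOrbit (dualExpr F c) O (baseExpr f c) (fun t => cotChart c (γ t)) a b)
    (hsrc : ∀ t ∈ Icc a b, γ t ∈ (cotChart c).source)
    (hconf : ∀ s, 0 ≤ s → EqOn (dualExpr (family f F s) c)
        (confHam (dualExpr F c) (baseExpr f c) s) O)
    {Y : ℝ → ℝ → Phase →L[ℝ] Phase}
    (hY : IsLinearizedFlow (dualExpr F c) (baseExpr f c) (fun t => cotChart c (γ t)) a b Y)
    {s : ℝ} (hs : s ∈ Icc (0 : ℝ) 1) :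
    ∃ φ : ℝ → CotangentBundle M → CotangentBundle M,
    φ b (γ a) = γ b ∧ HasMFDerivAt cotangentModel cotangentModel (φ b) (γ a)
      (((cotDerivEquiv c (γ b) (hsrc b ⟨hab, le_rfl⟩)).symm : Phase →L[ℝ] Phase).comp
        ((Y s b).comp (cotDeriv c (γ a)))) ∧
    ∀ᶠ e in 𝓝[unitCotangent (family f F s)] (γ a), φ a e = e ∧
      ∀ t ∈ Icc a b, IsReebCurveAt (family f F s) (fun r => φ r e) (Icc a b) t := by
  have ha : a ∈ Icc a b := ⟨le_rfl, hab⟩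
  have hb : b ∈ Icc a b := ⟨hab, le_rfl⟩
  have hsm : ContDiffOn ℝ ∞ (dualExpr (family f F s) c) O :=
    (hO.contDiffOn_confHam hs.1).congr (hconf s hs.1)
  have hfd (y) (hy : y ∈ O) : fderiv ℝ (energy (dualExpr (family f F s) c)) y =
      fderiv ℝ (energy (confHam (dualExpr F c) (baseExpr f c) s)) y :=
    fderiv_energy_congr hO.dual.isOpen (hconf s hs.1) hy
  set X : Phase → Phase := fun y => sgrad (fderiv ℝ (energy (dualExpr (family f F s) c)) y)
    with hX
  have hXs : ContDiffOn ℝ 1 X O := by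
    have h1 : ContDiffOn ℝ 1 (fderiv ℝ (energy (dualExpr (family f F s) c))) O :=
      (contDiffOn_energy hsm).fderiv_of_isOpen hO.dual.isOpen 
        (by rw [one_add_one_eq_two]; exact two_le_infty)
    exact sgrad.contDiff.comp_contDiffOn h1
  have hXd (t) (ht : t ∈ Icc a b) : fderiv ℝ X (cotChart c (γ t)) =
      generator (dualExpr F c) (baseExpr f c) s (cotChart c (γ t)) := by
    have h1 := (hO.fderiv_energy_confHam ht s).2
    have h2 : HasFDerivAt (fderiv ℝ (energy (dualExpr (family f F s) c))) _
        (cotChart c (γ t)) := h1.congr_of_eventuallyEq (by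
          filter_upwards [hO.dual.isOpen.mem_nhds (hO.mem t ht)] with y hy using hfd y hy)
    exact (sgrad.hasFDerivAt.comp _ h2).fderiv
  obtain ⟨φ, e1, e2, e3⟩ := exists_flow_near_integralCurve hO.dual.isOpen hXs hab
    (z := fun t => cotChart c (γ t))
    (fun t ht => by
      change HasDerivWithinAt _ (sgrad (fderiv ℝ (energy (dualExpr (family f F s) c))
        (cotChart c (γ t)))) _ _
      rw [hfd _ (hO.mem t ht), (hO.fderiv_energy_confHam ht s).1]
      exact hO.hasDeriv t ht) hO.mem (hY.init s hs)
    (fun t ht => by rw [hXd t ht]; exact hY.hasDeriv s hs t ht)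
  refine ⟨fun t e => (cotChart c).symm (φ t (cotChart c e)), ?_, ?_, ?_⟩
  · exact (congrArg (cotChart c).symm e1).trans ((cotChart c).left_inv (hsrc b hb))
  · have h1 := hasMFDerivAt_cotChart_symm (hsrc b hb)
    rw [← e1] at h1
    have h2 : HasMFDerivAt 𝓘(ℝ, Phase) 𝓘(ℝ, Phase) (φ b) (cotChart c (γ a)) (Y s b) :=
      e2.hasMFDerivAt
    exact HasMFDerivAt.comp (γ a) h1 (HasMFDerivAt.comp (γ a) h2 (hasMFDerivAt_cotChart (hsrc a ha)))
  · have hcont : Tendsto (cotChart c) (𝓝[unitCotangent (family f F s)] (γ a))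
        (𝓝 (cotChart c (γ a))) :=
      ((continuousAt_extChartAt' (hsrc a ha)).tendsto).mono_left nhdsWithin_le_nhds
    have hnear : ∀ᶠ e in 𝓝[unitCotangent (family f F s)] (γ a), e ∈ (cotChart c).source :=
      nhdsWithin_le_nhds (extChartAt_source_mem_nhds' (hsrc a ha))
    filter_upwards [hcont.eventually e3, hnear, self_mem_nhdsWithin] with e he hes heu
    refine ⟨(congrArg (cotChart c).symm he.1).trans ((cotChart c).left_inv hes), fun t ht => ?_⟩
    refine isReebOrbit_of_chart hO.dual.isOpen hsub hsm (fun y hy => ?_) (fun y hy => ?_)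
      (y := fun t => φ t (cotChart c e)) (fun t ht => (he.2 t ht).1)
      (fun t ht => (he.2 t ht).2) ?_ ht
    · rw [hconf s hs.1 hy]; exact hO.confHam_pos hs.1 hy
    · rw [hfd y hy, hO.euler_confHam hs.1 hy, energy, energy, hconf s hs.1 hy]
    · rw [he.1, dualExpr_cotChart _ hes]; exact heu

theorem exists_isTransport_of_isCriticalOrbit {f : M → ℝ} {γ : ℝ → CotangentBundle M} {c : M}
    {O : Set Phase} {a b : ℝ} (hab : a ≤ b) (hsub : O ⊆ (cotChart c).target)
    (hO : IsCriticalOrbit (dualExpr F c) O (baseExpr f c) (fun t => cotChart c (γ t)) a b)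
    (hsrc : ∀ t ∈ Icc a b, γ t ∈ (cotChart c).source)
    (hconf : ∀ s, 0 ≤ s → EqOn (dualExpr (family f F s) c)
        (confHam (dualExpr F c) (baseExpr f c) s) O)
    {Y : ℝ → ℝ → Phase →L[ℝ] Phase}
    (hY : IsLinearizedFlow (dualExpr F c) (baseExpr f c) (fun t => cotChart c (γ t)) a b Y) :
    IsTransport F f γ a b
      (fun s => ((cotDerivEquiv c (γ b) (hsrc b ⟨hab, le_rfl⟩)).symm : Phase →L[ℝ] Phase).comp
        ((Y s b).comp (cotDeriv c (γ a))))
      (fun s y w => variationForm (baseExpr f c) (fun t => cotChart c (γ t)) a b Y s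
        (cotDeriv c (γ a) y) (cotDeriv c (γ a) w)) := by
  have ha : a ∈ Icc a b := ⟨le_rfl, hab⟩
  have hb : b ∈ Icc a b := ⟨hab, le_rfl⟩
  have hinv (v : Phase) :
      cotDeriv c (γ b) ((cotDerivEquiv c (γ b) (hsrc b hb)).symm v) = v := by
    rw [← cotDerivEquiv_apply c (γ b) (hsrc b hb), ContinuousLinearEquiv.apply_symm_apply]
  have homega (v w : Phase) : omega ((cotDerivEquiv c (γ b) (hsrc b hb)).symm v)
      ((cotDerivEquiv c (γ b) (hsrc b hb)).symm w) = omega v w := by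
    rw [← omega_cotDeriv (hsrc b hb), hinv, hinv]
  have hmemC (t) (ht : t ∈ Icc a b) (w : Phase) : w ∈ contactSpace F (γ t) ↔
      fderiv ℝ (energy (dualExpr F c)) (cotChart c (γ t)) (cotDeriv c (γ t) w) = 0 ∧
        (cotChart c (γ t)).2 (cotDeriv c (γ t) w).1 = 0 :=
    mem_contactSpace (hsrc t ht) ((hO.dual.smooth.contDiffAt
      (hO.dual.isOpen.mem_nhds (hO.mem t ht))).differentiableAt (by simp))
      (by rw [hO.unit t ht]; exact one_ne_zero) w
  refine ⟨fun s hs => ?_, fun s hs y hy => ?_, ?_, fun s hs y w => ?_, fun y w => ?_, fun y => ?_⟩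
  · exact exists_reebFlow_of_isCriticalOrbit hab hsub hO hsrc hconf hY hs
  · rw [hmemC b hb]
    have h1 := (hmemC a ha y).1 hy
    have h2 := hO.contact_invariant hY hs h1.1 h1.2 hb
    have h3 := hinv (Y s b (cotDeriv c (γ a) y))
    rw [← h3] at h2
    exact h2
  · have h1 : Tendsto (fun s => Y s b) (𝓝[Icc 0 1] 0) (𝓝 (Y 0 b)) := by
      obtain ⟨D, hD⟩ := hY.bound
      exact tendsto_of_norm_sub_le fun s hs => hD s hs b hb
    exact tendsto_clm_comp tendsto_const_nhds (tendsto_clm_comp h1 tendsto_const_nhds)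
  · change omega ((cotDerivEquiv c (γ b) _).symm (Y s b (cotDeriv c (γ a) y)))
      ((cotDerivEquiv c (γ b) _).symm (Y 0 b (cotDeriv c (γ a) w))) = _
    rw [homega, hO.omega_variation hY hab hs, omega_cotDeriv (hsrc a ha)]
  · exact hO.tendsto_variationForm_comp hY hab (cotDeriv c (γ a)) y (cotDeriv c (γ a) w)
  · exact hO.variationForm_self_nonneg hab Y _

theorem isPositiveOn_variationForm {f : M → ℝ} {γ : ℝ → CotangentBundle M} {c : M}
    {O : Set Phase} {a b : ℝ} (hab : a < b)
    (hO : IsCriticalOrbit (dualExpr F c) O (baseExpr f c) (fun t => cotChart c (γ t)) a b)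
    (hsrc : ∀ t ∈ Icc a b, γ t ∈ (cotChart c).source)
    (hne : ∀ t ∈ Icc a b, fderiv ℝ (fderiv ℝ (baseExpr f c)) (cotChart c (γ t)).1 ≠ 0)
    {Y : ℝ → ℝ → Phase →L[ℝ] Phase}
    (hY : IsLinearizedFlow (dualExpr F c) (baseExpr f c) (fun t => cotChart c (γ t)) a b Y) :
    IsPositiveOn F (γ a) (fun s y w => variationForm (baseExpr f c) (fun t => cotChart c (γ t)) a b
      Y s (cotDeriv c (γ a) y) (cotDeriv c (γ a) w)) := by
  intro y hy hy0
  have ha : a ∈ Icc a b := ⟨le_rfl, hab.le⟩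
  have h1 := (mem_contactSpace (hsrc a ha) ((hO.dual.smooth.contDiffAt
      (hO.dual.isOpen.mem_nhds (hO.mem a ha))).differentiableAt (by simp))
      (by rw [hO.unit a ha]; exact one_ne_zero) y).1 hy
  refine hO.variationForm_self_pos hY hab hne h1.1 h1.2 fun h => hy0 ?_
  rw [← cotDerivEquiv_apply c (γ a) (hsrc a ha)] at h
  exact (cotDerivEquiv c (γ a) (hsrc a ha)).map_eq_zero_iff.1 h

end

section

variable {M : Type*} [TopologicalSpace M] [ChartedSpace Plane M] [IsManifold (𝓡 2) ∞ M]
  {F : TangentBundle (𝓡 2) M → ℝ}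

/-! ### Transport along a closed geodesic -/

section Geodesic

variable (hF : IsFinslerMetric F) {σ : ℝ → M} {T : ℝ} (hσ : IsClosedGeodesic F σ T) {f : M → ℝ}
  (hf : ContMDiff (𝓡 2) 𝓘(ℝ, ℝ) ∞ f) (hf0 : ∀ x, 0 ≤ f x) (hfσ : ∀ t, f (σ t) = 0)

include hF hσ hf hf0 hfσ

theorem exists_isTransport_near (t₀ : ℝ) : ∃ δ > 0, ∀ a b : ℝ, a ≤ b →
    Icc a b ⊆ Icc (t₀ - δ) (t₀ + δ) → ∃ D Q, IsTransport F f (lift F σ) a b D Q ∧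
      (a < b → fderiv ℝ (fderiv ℝ (baseExpr f (σ t₀))) (extChartAt (𝓡 2) (σ t₀) (σ t₀)) ≠ 0 →
        IsPositiveOn F (lift F σ a) Q) := by
  obtain ⟨O, δ₁, hδ₁, hsub, hO, hsrc, hconf⟩ := hσ.exists_isCriticalOrbit hF hf hf0 hfσ t₀
  obtain ⟨r, hr, hlin⟩ := hO.exists_isLinearizedFlow
  have ht₀ : t₀ ∈ Icc (t₀ - δ₁) (t₀ + δ₁) := ⟨by linarith, by linarith⟩
  have hev : ∀ᶠ t in 𝓝 t₀,
      fderiv ℝ (fderiv ℝ (baseExpr f (σ t₀))) (extChartAt (𝓡 2) (σ t₀) (σ t₀)) ≠ 0 →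
      fderiv ℝ (fderiv ℝ (baseExpr f (σ t₀))) (cotChart (σ t₀) (lift F σ t)).1 ≠ 0 := by
    by_cases h : fderiv ℝ (fderiv ℝ (baseExpr f (σ t₀))) (extChartAt (𝓡 2) (σ t₀) (σ t₀)) = 0
    · exact Eventually.of_forall fun t ht => absurd h ht
    · have h1 : ContinuousAt (fun t => fderiv ℝ (fderiv ℝ (baseExpr f (σ t₀)))
          (cotChart (σ t₀) (lift F σ t)).1) t₀ :=
        (hO.continuousOn_hessian t₀ ht₀).continuousAt
          (Icc_mem_nhds (by linarith) (by linarith))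
      filter_upwards [h1.eventually_ne h] with t ht _ using ht
  obtain ⟨δ₂, hδ₂, hne⟩ := Metric.nhds_basis_closedBall.eventually_iff.1 hev
  rw [Real.closedBall_eq_Icc] at hne
  -- The interval must stay in the chart (`δ₁`), keep the Hessian nonzero (`δ₂`), and have length at
  -- most `r` for the linearized flows to exist.
  refine ⟨min δ₁ (min δ₂ (r / 2)), by positivity, fun a b hab hI => ?_⟩
  have hI₁ : Icc a b ⊆ Icc (t₀ - δ₁) (t₀ + δ₁) := hI.trans
    (Icc_subset_Icc (by linarith [min_le_left δ₁ (min δ₂ (r / 2))])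
      (by linarith [min_le_left δ₁ (min δ₂ (r / 2))]))
  have h2 : min δ₁ (min δ₂ (r / 2)) ≤ min δ₂ (r / 2) := min_le_right _ _
  have h3 := min_le_left δ₂ (r / 2)
  have h4 := min_le_right δ₂ (r / 2)
  have hI₂ : Icc a b ⊆ Icc (t₀ - δ₂) (t₀ + δ₂) := hI.trans
    (Icc_subset_Icc (by linarith) (by linarith))
  have ha := (hI ⟨le_rfl, hab⟩).1
  have hb := (hI ⟨hab, le_rfl⟩).2
  obtain ⟨Y, hY⟩ := hlin a b hab (by linarith) hI₁
  exact ⟨_, _, exists_isTransport_of_isCriticalOrbit hab hsub (hO.mono hI₁)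
    (fun t ht => hsrc t (hI₁ ht)) hconf hY, fun hlt hne0 => isPositiveOn_variationForm hlt
    (hO.mono hI₁) (fun t ht => hsrc t (hI₁ ht)) (fun t ht => hne (hI₂ ht) hne0) hY⟩

/-- A subdivision of `[a, b]` finer than the local radii, followed by composition of the pieces. -/
theorem exists_isTransport {a b : ℝ} (hab : a ≤ b) :
    ∃ D Q, IsTransport F f (lift F σ) a b D Q := by
  choose δ hδ hloc using exists_isTransport_near hF hσ hf hf0 hfσ
  obtain ⟨t, ht0, hmono, ⟨m, hm⟩, hcov⟩ := exists_monotone_Icc_subset_open_cover_Icc hab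
    (c := fun t₀ : ℝ => {x : Icc a b | (x : ℝ) ∈ Ioo (t₀ - δ t₀) (t₀ + δ t₀)})
    (fun t₀ => isOpen_Ioo.preimage continuous_subtype_val)
    (fun x _ => mem_iUnion.2 ⟨x, by simp [hδ]⟩)
  have key (n : ℕ) : ∃ D Q, IsTransport F f (lift F σ) a (t n) D Q := by
    induction n with
    | zero =>
      obtain ⟨D, Q, h, -⟩ := hloc a a a le_rfl (fun x hx => by
        have := hδ a
        rw [Icc_self, mem_singleton_iff] at hx
        rw [hx]
        constructor <;> linarith)
      rw [ht0]
      exact ⟨D, Q, h⟩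
    | succ n ih =>
      obtain ⟨D₁, Q₁, h₁⟩ := ih
      obtain ⟨t₀, h₀⟩ := hcov n
      have hle : (t n : ℝ) ≤ t (n + 1) := hmono n.le_succ
      obtain ⟨D₂, Q₂, h₂, -⟩ := hloc t₀ (t n) (t (n + 1)) hle (fun x hx =>
        Ioo_subset_Icc_self (h₀ (a := ⟨x, (t n).2.1.trans hx.1, hx.2.trans (t (n + 1)).2.2⟩)
          ⟨hx.1, hx.2⟩))
      exact ⟨_, _, h₁.comp (t n).2.1 hle h₂⟩
  have := key m
  rwa [hm m le_rfl] at this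

omit hF hσ hf hf0 hfσ in
-- At `s = 0` the pairing identity says that `D 0` is symplectic, hence injective.
theorem IsTransport.ne_zero {γ : ℝ → CotangentBundle M} {a b : ℝ} {D : ℝ → Phase →L[ℝ] Phase}
    {Q : ℝ → Phase → Phase → ℝ} (h : IsTransport F f γ a b D Q) {y : Phase} (hy : y ≠ 0) :
    D 0 y ≠ 0 := fun h0 => hy <| eq_of_omega_eq fun w => by
  have := h.pairing 0 ⟨le_rfl, zero_le_one⟩ y w
  rw [h0, zero_mul, add_zero] at this
  rw [← this]
  simp [omega]

/-- The period is cut at `t₀` and shortly afterwards. The middle segment is positive on the contact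
plane, which the first transport reaches injectively; the outer segments contribute nonnegative
terms. -/
theorem exists_isTransport_isPositiveOn {t₀ : ℝ} (ht₀ : t₀ ∈ Ioo 0 T)
    (hne : fderiv ℝ (fderiv ℝ (baseExpr f (σ t₀))) (extChartAt (𝓡 2) (σ t₀) (σ t₀)) ≠ 0) :
    ∃ D Q, IsTransport F f (lift F σ) 0 T D Q ∧ IsPositiveOn F (lift F σ 0) Q := by
  obtain ⟨δ, hδ, hloc⟩ := exists_isTransport_near hF hσ hf hf0 hfσ t₀
  have hmin : min T (t₀ + δ) ≤ T := min_le_left _ _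
  have hmin' : min T (t₀ + δ) ≤ t₀ + δ := min_le_right _ _
  have hlt : t₀ < min T (t₀ + δ) := lt_min ht₀.2 (by linarith)
  obtain ⟨D₁, Q₁, h₁⟩ := exists_isTransport hF hσ hf hf0 hfσ ht₀.1.le
  obtain ⟨D₂, Q₂, h₂, hp⟩ := hloc t₀ (min T (t₀ + δ)) hlt.le
    (Icc_subset_Icc (by linarith) hmin')
  obtain ⟨D₃, Q₃, h₃⟩ := exists_isTransport hF hσ hf hf0 hfσ hmin
  refine ⟨_, _, (h₁.comp ht₀.1.le hlt.le h₂).comp (ht₀.1.le.trans hlt.le) hmin h₃,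
    fun y hy hy0 => ?_⟩
  have h0 : (0 : ℝ) ∈ Icc (0 : ℝ) 1 := ⟨le_rfl, zero_le_one⟩
  exact add_pos_of_pos_of_nonneg (add_pos_of_nonneg_of_pos (h₁.nonneg y)
    (hp hlt hne _ (h₁.mapsTo 0 h0 y hy) (h₁.ne_zero hy0))) (h₃.nonneg _)

end Geodesic

/-! ### Absence of fixed vectors -/

/-- Near a direction not fixed by `D 0`, continuity excludes fixed vectors. Near a fixed direction
`y`, a fixed vector `y'` of `D s` would give `ω(y', y) = ω(y', y) + s Q s y' y`, whereas `Q s y' y >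
0` by continuity. Compactness of the unit sphere of `ξ` makes this uniform. -/
theorem eventually_no_fixed_vector {D : ℝ → Phase →L[ℝ] Phase} {Q : ℝ → Phase → Phase → ℝ}
    {ξ : Submodule ℝ Phase} (hD : Tendsto D (𝓝[Icc 0 1] 0) (𝓝 (D 0)))
    (hpair : ∀ s ∈ Icc (0 : ℝ) 1, ∀ y w, omega (D s y) (D 0 w) = omega y w + s * Q s y w)
    (hQ : ∀ y w,
      Tendsto (fun p : ℝ × Phase => Q p.1 p.2 w) (𝓝[Icc 0 1] 0 ×ˢ 𝓝 y) (𝓝 (Q 0 y w)))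
    (hpos : ∀ y ∈ ξ, y ≠ 0 → 0 < Q 0 y y) :
    ∀ᶠ s in 𝓝[>] (0 : ℝ), ∀ y ∈ ξ, D s y = y → y = 0 := by
  have hcompact : IsCompact ((ξ : Set Phase) ∩ Metric.sphere 0 1) :=
    (isCompact_sphere (0 : Phase) 1).inter_left ξ.closed_of_finiteDimensional
  have hloc (y : Phase) (hy : y ∈ (ξ : Set Phase) ∩ Metric.sphere 0 1) :
      ∀ᶠ p : ℝ × Phase in 𝓝 (0, y), p.1 ∈ Ioc (0 : ℝ) 1 → D p.1 p.2 ≠ p.2 := by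
    have hy0 : y ≠ 0 := ne_zero_of_mem_unit_sphere ⟨y, hy.2⟩
    have h1 : ∀ᶠ p : ℝ × Phase in 𝓝[Icc 0 1] 0 ×ˢ 𝓝 y,
        p.1 ∈ Ioc (0 : ℝ) 1 → D p.1 p.2 ≠ p.2 := by
      by_cases h : D 0 y = y
      · filter_upwards [(hQ y y).eventually_const_lt (hpos y hy.1 hy0)] with p hp hs heq
        have h2 := hpair p.1 ⟨hs.1.le, hs.2⟩ p.2 y
        rw [heq, h] at h2
        have := mul_pos hs.1 hp
        linarith
      · have h2 : Tendsto (fun p : ℝ × Phase => D p.1 p.2 - p.2) (𝓝[Icc 0 1] 0 ×ˢ 𝓝 y)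
            (𝓝 (D 0 y - y)) :=
          (tendsto_clm_apply (hD.comp tendsto_fst) tendsto_snd).sub tendsto_snd
        filter_upwards [h2.eventually_ne (sub_ne_zero.2 h)] with p hp _ using sub_ne_zero.1 hp
    rw [← nhdsWithin_univ y, ← nhdsWithin_prod_eq, eventually_nhdsWithin_iff] at h1
    filter_upwards [h1] with p hp hs
    exact hp ⟨⟨hs.1.le, hs.2⟩, mem_univ _⟩ hs
  -- The tube lemma gives one neighbourhood of `s = 0` for all unit vectors of `ξ`.
  have hev := hcompact.eventually_forall_of_forall_eventually
    (P := fun s y => s ∈ Ioc (0 : ℝ) 1 → D s y ≠ y) hloc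
  filter_upwards [nhdsWithin_le_nhds hev, Ioc_mem_nhdsGT one_pos] with s hs hs1 y hy heq
  by_contra hy0
  refine hs (‖y‖⁻¹ • y) ⟨ξ.smul_mem _ hy, ?_⟩ hs1 (by rw [map_smul, heq])
  rw [mem_sphere_zero_iff_norm, norm_smul, norm_inv, norm_norm,
    inv_mul_cancel₀ (norm_ne_zero_iff.2 hy0)]

/-! ### Nondegeneracy -/

theorem one_notMem_spectrum_restrict {V : Type*} [AddCommGroup V] [Module ℝ V]
    [FiniteDimensional ℝ V] {ξ : Submodule ℝ V} {D : V →ₗ[ℝ] V} (hmaps : ∀ y ∈ ξ, D y ∈ ξ)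
    (hno : ∀ y ∈ ξ, D y = y → y = 0) : (1 : ℝ) ∉ spectrum ℝ (D.restrict hmaps) := by
  rw [← Module.End.hasEigenvalue_iff_mem_spectrum]
  intro h
  obtain ⟨v, hv⟩ := h.exists_hasEigenvector
  refine hv.2 (Subtype.ext (hno v v.2 ?_))
  have h1 := congrArg Subtype.val hv.apply_eq_smul
  rwa [one_smul] at h1

theorem isNondegenerate_of_flow {σ : ℝ → M} {T : ℝ} {D : Phase →L[ℝ] Phase}
    {φ : ℝ → CotangentBundle M → CotangentBundle M}
    (hφ : IsReebFlowNear F (legendre F (velocity σ 0)) T φ)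
    (hfix : φ T (legendre F (velocity σ 0)) = legendre F (velocity σ 0))
    (hd : HasMFDerivAt cotangentModel cotangentModel (φ T) (legendre F (velocity σ 0)) D)
    (hmaps : ∀ y ∈ contactSpace F (legendre F (velocity σ 0)),
      D y ∈ contactSpace F (legendre F (velocity σ 0)))
    (hno : ∀ y ∈ contactSpace F (legendre F (velocity σ 0)), D y = y → y = 0) :
    IsNondegenerate F σ T := by
  refine ⟨D.toLinearMap.restrict hmaps, ⟨φ, hφ, hfix, hd.mdifferentiableAt, fun w => ?_⟩,
    one_notMem_spectrum_restrict hmaps hno⟩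
  rw [hd.mfderiv]
  rfl

theorem IsClosedGeodesic.periodic_velocity {σ : ℝ → M} {T : ℝ} (hσ : IsClosedGeodesic F σ T) :
    Function.Periodic (velocity σ) T := by
  intro t
  have key (L : ℝ →L[ℝ] Plane) (h : HasMFDerivAt 𝓘(ℝ, ℝ) (𝓡 2) σ (t + T) L) :
      tanMk (σ (t + T)) (L 1) = velocity σ t := by
    have h1 : HasMFDerivAt 𝓘(ℝ, ℝ) 𝓘(ℝ, ℝ) (fun r => r + T) t (ContinuousLinearMap.id ℝ ℝ) :=
      ((hasFDerivAt_id t).add_const T).hasMFDerivAt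
    have h2 : HasMFDerivAt 𝓘(ℝ, ℝ) (𝓡 2) (σ ∘ fun r => r + T) t
        (L.comp (ContinuousLinearMap.id ℝ ℝ)) := HasMFDerivAt.comp t h h1
    have h3 : (σ ∘ fun r => r + T) = σ := funext hσ.periodic
    rw [h3] at h2
    have h4 : velocity σ t = tanMk (σ t) (L 1) := by
      rw [velocity, h2.mfderiv]
      rfl
    rw [h4, hσ.periodic t]
  exact key _ ((hσ.smooth (t + T)).mdifferentiableAt (by simp)).hasMFDerivAt

omit [IsManifold (𝓡 2) ∞ M] in
theorem legendre_conformal {u : M → ℝ} {p : TangentBundle (𝓡 2) M} (hu : u p.1 = 1) :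
    legendre (conformal u F) p = legendre F p := by
  have h : (fun w : Plane => conformal u F (tanMk p.1 w)) = fun w => F (tanMk p.1 w) :=
    funext fun w => (congrArg (· * F (tanMk p.1 w)) hu).trans (one_mul _)
  have h1 : legendreCovec (conformal u F) p.1 (vec p) = legendreCovec F p.1 (vec p) := by
    rw [legendreCovec, legendreCovec, h]
    exact congrArg (· • fderiv ℝ (fun w => F (tanMk p.1 w)) (vec p)) (congrFun h (vec p))
  exact congrArg (cotMk p.1) h1

/-- Along the geodesic the differentials of the two energies coincide, and the Liouville form does
not depend on the metric. -/
theorem contactSpace_family (hF : IsFinslerMetric F) {σ : ℝ → M} {T : ℝ}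
    (hσ : IsClosedGeodesic F σ T) {f : M → ℝ} (hf : ContMDiff (𝓡 2) 𝓘(ℝ, ℝ) ∞ f)
    (hf0 : ∀ x, 0 ≤ f x) (hfσ : ∀ t, f (σ t) = 0) {s : ℝ} (hs : 0 ≤ s) (t : ℝ) :
    contactSpace (family f F s) (lift F σ t) = contactSpace F (lift F σ t) := by
  obtain ⟨O, δ, hδ, -, hO, hsrc, hconf⟩ := hσ.exists_isCriticalOrbit hF hf hf0 hfσ t
  have ht : t ∈ Icc (t - δ) (t + δ) := ⟨by linarith, by linarith⟩
  have hd (H : Phase → ℝ) (hH : ContDiffOn ℝ ∞ H O) :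
      DifferentiableAt ℝ H (cotChart (σ t) (lift F σ t)) :=
    (hH.contDiffAt (hO.dual.isOpen.mem_nhds (hO.mem t ht))).differentiableAt (by simp)
  ext w
  rw [mem_contactSpace (hsrc t ht) (hd _ hO.dual.smooth) (hO.dual.pos _ (hO.mem t ht)).ne',
    mem_contactSpace (hsrc t ht) (hd _ ((hO.contDiffOn_confHam hs).congr (hconf s hs)))
      (by rw [hconf s hs (hO.mem t ht)]; exact (hO.confHam_pos hs (hO.mem t ht)).ne'),
    fderiv_energy_congr hO.dual.isOpen (hconf s hs) (hO.mem t ht),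
    (hO.fderiv_energy_confHam ht s).1]

theorem eventually_isNondegenerate_family (hF : IsFinslerMetric F) {σ : ℝ → M} {T : ℝ}
    (hσ : IsClosedGeodesic F σ T) {f : M → ℝ} (hf : ContMDiff (𝓡 2) 𝓘(ℝ, ℝ) ∞ f)
    (hf0 : ∀ x, 0 ≤ f x) (hfσ : ∀ t, f (σ t) = 0) {t₀ : ℝ} (ht₀ : t₀ ∈ Ioo 0 T)
    (hne : fderiv ℝ (fderiv ℝ (baseExpr f (σ t₀))) (extChartAt (𝓡 2) (σ t₀) (σ t₀)) ≠ 0) :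
    ∀ᶠ s in 𝓝[>] (0 : ℝ), IsNondegenerate (family f F s) σ T := by
  obtain ⟨D, Q, h, hpos⟩ := exists_isTransport_isPositiveOn hF hσ hf hf0 hfσ ht₀ hne
  have hper : lift F σ T = lift F σ 0 := by
    have := hσ.periodic_velocity 0
    rw [zero_add] at this
    exact congrArg (legendre F) this
  filter_upwards [eventually_no_fixed_vector h.tendsto_deriv h.pairing h.tendsto_form hpos,
    Ioc_mem_nhdsGT one_pos] with s hs hs1
  have hs' : s ∈ Icc (0 : ℝ) 1 := ⟨hs1.1.le, hs1.2⟩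
  have hleg : legendre (family f F s) (velocity σ 0) = lift F σ 0 :=
    legendre_conformal (by change 1 + s * f (σ 0) = 1; rw [hfσ, mul_zero, add_zero])
  have hξ := contactSpace_family hF hσ hf hf0 hfσ hs1.1.le 0
  obtain ⟨φ, e1, e2, e3⟩ := h.flow s hs'
  have hmaps := h.mapsTo s hs'
  rw [hper] at e1 hmaps
  rw [← hξ] at hs hmaps
  rw [← hleg] at e1 e2 e3 hs hmaps
  exact isNondegenerate_of_flow e3 e1 e2 hmaps hs

end

/-! ### Immersed curves as local graphs -/

/-- The one-dimensional inverse function theorem, with smoothness on a neighbourhood. -/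
theorem exists_smooth_inverse {g : ℝ → ℝ} {t₀ : ℝ} (hg : ∀ᶠ t in 𝓝 t₀, ContDiffAt ℝ ∞ g t)
    (hd : deriv g t₀ ≠ 0) : ∃ u : ℝ → ℝ, (∀ᶠ t in 𝓝 t₀, u (g t) = t) ∧
      ContinuousAt u (g t₀) ∧ ∀ᶠ a in 𝓝 (g t₀), ContDiffAt ℝ ∞ u a := by
  have hg₀ := hg.self_of_nhds
  have hstrict : HasStrictFDerivAt g
      (ContinuousLinearEquiv.unitsEquivAut ℝ (Units.mk0 _ hd) : ℝ →L[ℝ] ℝ) t₀ :=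
    (hg₀.hasStrictDerivAt (by simp)).hasStrictFDerivAt_equiv hd
  let e := hstrict.toOpenPartialHomeomorph g
  have hes : t₀ ∈ e.source := hstrict.mem_toOpenPartialHomeomorph_source
  have het : g t₀ ∈ e.target := e.map_source hes
  have hinv : e.symm (g t₀) = t₀ := e.left_inv hes
  have hcont : ContinuousAt e.symm (g t₀) := e.continuousAt_symm het
  refine ⟨e.symm, ?_, hcont, ?_⟩
  · filter_upwards [e.open_source.mem_nhds hes] with t ht using e.left_inv ht
  · have hderiv : ∀ᶠ t in 𝓝 t₀, deriv g t ≠ 0 :=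
      ((hg₀.fderiv_right (m := 0) (by simp)).continuousAt.clm_apply
        (continuousAt_const (y := (1 : ℝ)))).eventually_ne hd
    have h1 : ∀ᶠ a in 𝓝 (g t₀), ContDiffAt ℝ ∞ g (e.symm a) ∧ deriv g (e.symm a) ≠ 0 := by
      refine hcont.tendsto.eventually (p := fun t => ContDiffAt ℝ ∞ g t ∧ deriv g t ≠ 0) ?_
      rw [hinv]
      exact hg.and hderiv
    filter_upwards [h1, e.open_target.mem_nhds het] with a ha hat
    exact e.contDiffAt_symm_deriv ha.2 hat (ha.1.differentiableAt (by simp)).hasDerivAt ha.1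

section

variable {M : Type*} [TopologicalSpace M] [ChartedSpace Plane M] [IsManifold (𝓡 2) ∞ M]

theorem eventually_contDiffAt_extChartAt_comp {σ : ℝ → M} (hσ : ContMDiff 𝓘(ℝ, ℝ) (𝓡 2) ∞ σ)
    (t₀ : ℝ) : ∀ᶠ t in 𝓝 t₀, σ t ∈ (extChartAt (𝓡 2) (σ t₀)).source ∧
      ContDiffAt ℝ ∞ (fun t => extChartAt (𝓡 2) (σ t₀) (σ t)) t := by
  have hsrc : ∀ᶠ t in 𝓝 t₀, σ t ∈ (extChartAt (𝓡 2) (σ t₀)).source :=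
    hσ.continuous.continuousAt.eventually_mem
      ((isOpen_extChartAt_source _).mem_nhds (mem_extChartAt_source _))
  filter_upwards [hsrc] with t ht
  refine ⟨ht, ?_⟩
  have h1 : ContMDiffAt (𝓡 2) 𝓘(ℝ, Plane) ∞ (extChartAt (𝓡 2) (σ t₀)) (σ t) :=
    contMDiffAt_extChartAt' (by rwa [extChartAt_source] at ht)
  exact (h1.comp t (hσ t)).contDiffAt

/-- An immersed curve is locally the graph of a smooth function over a coordinate axis. -/
theorem exists_local_graph {σ : ℝ → M} (hσ : ContMDiff 𝓘(ℝ, ℝ) (𝓡 2) ∞ σ) {t₀ : ℝ}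
    (hv : vec (velocity σ t₀) ≠ 0) : ∃ j : Fin 2, ∃ u : ℝ → ℝ,
      (∀ᶠ t in 𝓝 t₀, u (extChartAt (𝓡 2) (σ t₀) (σ t) j) = t) ∧
      ∀ᶠ a in 𝓝 (extChartAt (𝓡 2) (σ t₀) (σ t₀) j),
        ContDiffAt ℝ ∞ (fun a => extChartAt (𝓡 2) (σ t₀) (σ (u a))) a := by
  obtain ⟨j, hj⟩ : ∃ j, vec (velocity σ t₀) j ≠ 0 := by
    by_contra! h
    exact hv (by ext j; exact h j)
  have hc := eventually_contDiffAt_extChartAt_comp hσ t₀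
  have hproj (q : Plane) : ContDiffAt ℝ ∞ (fun q : Plane => q j) q :=
    (coordForm j).contDiff.contDiffAt
  obtain ⟨u, hu, hcont, hus⟩ := exists_smooth_inverse
    (g := fun t => extChartAt (𝓡 2) (σ t₀) (σ t) j) (t₀ := t₀)
    (by filter_upwards [hc] with t ht using (hproj _).comp t ht.2)
    (by
      have h1 := (coordForm j).hasFDerivAt.comp_hasDerivAt t₀ (hasDerivAt_extChartAt_comp hσ t₀)
      have h2 : deriv (fun t => extChartAt (𝓡 2) (σ t₀) (σ t) j) t₀ = vec (velocity σ t₀) j :=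
        h1.deriv
      rw [h2]
      exact hj)
  refine ⟨j, u, hu, ?_⟩
  have h2 : ∀ᶠ a in 𝓝 (extChartAt (𝓡 2) (σ t₀) (σ t₀) j),
      ContDiffAt ℝ ∞ (fun t => extChartAt (𝓡 2) (σ t₀) (σ t)) (u a) := by
    refine hcont.tendsto.eventually
      (p := fun t => ContDiffAt ℝ ∞ (fun t => extChartAt (𝓡 2) (σ t₀) (σ t)) t) ?_
    rw [hu.self_of_nhds]
    exact hc.mono fun t ht => ht.2
  filter_upwards [h2, hus] with a h3 h4 using h3.comp a h4

/-- A smooth nonnegative function which vanishes on a closed set that is, near a point of an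
immersed curve, contained in the curve, and which grows quadratically at this point. -/
theorem exists_factor_of_local [T2Space M] {σ : ℝ → M} (hσ : ContMDiff 𝓘(ℝ, ℝ) (𝓡 2) ∞ σ) {t₀ : ℝ}
    (hv : vec (velocity σ t₀) ≠ 0) {Γ : Set M}
    (hΓ : ∀ I ∈ 𝓝 t₀, ∀ᶠ x in 𝓝 (σ t₀), x ∈ Γ → x ∈ σ '' I) :
    ∃ f : M → ℝ, ContMDiff (𝓡 2) 𝓘(ℝ, ℝ) ∞ f ∧ (∀ x, 0 ≤ f x) ∧ (∀ x ∈ Γ, f x = 0) ∧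
      ∃ n : Plane,
        0 < fderiv ℝ (fderiv ℝ (baseExpr f (σ t₀))) (extChartAt (𝓡 2) (σ t₀) (σ t₀)) n n := by
  obtain ⟨j, u, hu, hus⟩ := exists_local_graph hσ hv
  obtain ⟨m, hm⟩ := exists_ne j
  set p := σ t₀ with hp
  set κ := extChartAt (𝓡 2) p with hκ
  -- The height over the graph, measured along the other coordinate axis `m`.
  set h : Plane → ℝ := fun q => q m - κ (σ (u (q j))) m with hh
  have hproj (i : Fin 2) : ContDiff ℝ ∞ (fun q : Plane => q i) :=
    (coordForm i).contDiff
  have hsm : ∀ᶠ q in 𝓝 (κ p), ContDiffAt ℝ ∞ h q := by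
    have h1 : ContinuousAt (fun q : Plane => q j) (κ p) := (hproj j).continuous.continuousAt
    filter_upwards [h1.eventually hus] with q hq
    have h2 : ContDiffAt ℝ ∞ (fun q : Plane => κ (σ (u (q j)))) q :=
      ContDiffAt.comp (f := fun q : Plane => q j) q hq (hproj j).contDiffAt
    exact (hproj m).contDiffAt.sub ((hproj m).contDiffAt.comp q h2)
  -- On the support of the bump function, `h` must be smooth and every point of `Γ` must lie on the
  -- graph.
  have hN : ∀ᶠ x in 𝓝 p, x ∈ κ.source ∧ ContDiffAt ℝ ∞ h (κ x) ∧
      (x ∈ Γ → x ∈ σ '' {t | u (κ (σ t) j) = t}) :=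
    ((isOpen_extChartAt_source (I := 𝓡 2) p).eventually_mem (mem_extChartAt_source p)).and
      (((continuousAt_extChartAt (I := 𝓡 2) p).eventually hsm).and (hΓ _ hu))
  obtain ⟨χ, -, hχ⟩ := (SmoothBumpFunction.nhds_basis_tsupport (I := 𝓡 2) p).mem_iff.1 hN
  have hzero (t : ℝ) (ht : u (κ (σ t) j) = t) : h (κ (σ t)) = 0 := by
    rw [hh]
    simp only []
    rw [ht, sub_self]
  have hbase : baseExpr (fun x => χ x * h (κ x) ^ 2) p = fun q =>
      χ (κ.symm q) * h (κ (κ.symm q)) ^ 2 := rfl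
  have hfs : ContMDiff (𝓡 2) 𝓘(ℝ, ℝ) ∞ fun x => χ x * h (κ x) ^ 2 := by
    refine contMDiff_of_tsupport fun x hx => ?_
    have hx' := hχ (tsupport_mul_subset_left hx)
    have h1 : ContMDiffAt (𝓡 2) 𝓘(ℝ, Plane) ∞ κ x :=
      contMDiffAt_extChartAt' (by have := hx'.1; rwa [hκ, extChartAt_source] at this)
    exact χ.contMDiff.contMDiffAt.mul ((hx'.2.1.contMDiffAt.comp x h1).pow 2)
  refine ⟨fun x => χ x * h (κ x) ^ 2, hfs, fun x => mul_nonneg χ.nonneg (sq_nonneg _),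
    fun x hx => ?_, EuclideanSpace.single m 1, ?_⟩
  · by_cases hxs : x ∈ tsupport χ
    · obtain ⟨t, ht, rfl⟩ := (hχ hxs).2.2 hx
      simp only [hzero t ht]
      simp
    · simp only [image_eq_zero_of_notMem_tsupport hxs, zero_mul]
  · have hκt : κ p ∈ κ.target := mem_extChartAt_target p
    rw [← (deriv_deriv_line ((contDiffAt_baseExpr hfs hκt).of_le two_le_infty) _).2]
    have hline : Continuous fun r : ℝ => κ p + r • (EuclideanSpace.single m 1 : Plane) := by fun_prop
    have hlim : Tendsto (fun r : ℝ => κ p + r • (EuclideanSpace.single m 1 : Plane)) (𝓝 0)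
        (𝓝 (κ p)) := by simpa using hline.tendsto 0
    -- Where the bump function is `1`, the factor restricted to the `m`-line through the point is
    -- exactly `r²`, with second derivative `2`.
    have h1 : ∀ᶠ r in 𝓝 (0 : ℝ), baseExpr (fun x => χ x * h (κ x) ^ 2) p
        (κ p + r • (EuclideanSpace.single m 1 : Plane)) = r ^ 2 := by
      have h2 : ∀ᶠ q in 𝓝 (κ p), q ∈ κ.target ∧ χ (κ.symm q) = 1 := by
        refine ((isOpen_chartTarget p).eventually_mem hκt).and ?_
        have h3 := continuousAt_extChartAt_symm (I := 𝓡 2) p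
        refine h3.tendsto.eventually (p := fun x => χ x = 1) ?_
        rw [extChartAt_to_inv]
        exact χ.eventuallyEq_one
      filter_upwards [hlim.eventually h2] with r hr
      rw [hbase]
      simp only []
      rw [hr.2, κ.right_inv hr.1, one_mul]
      have h4 : h (κ p) = 0 := hzero t₀ hu.self_of_nhds
      have h5 : h (κ p + r • (EuclideanSpace.single m 1 : Plane)) = r := by
        simp only [hh] at h4 ⊢
        simp only [PiLp.add_apply, PiLp.smul_apply, PiLp.single_apply, smul_eq_mul]
        simp only [hm.symm, if_true, if_false, mul_zero, add_zero, mul_one]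
        linarith
      rw [h5]
    have h6 : deriv (fun r : ℝ => baseExpr (fun x => χ x * h (κ x) ^ 2) p
        (κ p + r • (EuclideanSpace.single m 1 : Plane))) =ᶠ[𝓝 0] deriv fun r : ℝ => r ^ 2 :=
      EventuallyEq.deriv h1
    have h7 : deriv (fun r : ℝ => r ^ 2) = fun r => 2 * r := by
      funext r
      simp
    rw [h6.deriv_eq, h7, deriv_const_mul _ differentiableAt_id, deriv_id'']
    norm_num

end

/-! ### Conformal factors adapted to finitely many closed geodesics -/

/-- If a locally injective curve runs near a time in a set which is embedded in the line, then it
covers a neighbourhood of its point in this set. -/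
theorem eventually_mem_image_of_injOn {X : Type*} [TopologicalSpace X] {K : Set X} {l : X → ℝ}
    (hl : ContinuousOn l K) (hinj : InjOn l K) {σ : ℝ → X} (hσ : Continuous σ) {t₀ : ℝ}
    {I : Set ℝ} (hI : I ∈ 𝓝 t₀) (hIσ : InjOn σ I) (hK : σ ⁻¹' K ∈ 𝓝 t₀) :
    ∀ᶠ x in 𝓝 (σ t₀), x ∈ K → x ∈ σ '' I := by
  obtain ⟨δ, hδ, hsub⟩ := Metric.nhds_basis_closedBall.mem_iff.1 (inter_mem hI hK)
  rw [Real.closedBall_eq_Icc] at hsub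
  have hmaps : MapsTo σ (Icc (t₀ - δ) (t₀ + δ)) K := fun t ht => (hsub ht).2
  have hc : ContinuousOn (l ∘ σ) (Icc (t₀ - δ) (t₀ + δ)) := hl.comp hσ.continuousOn hmaps
  have hi : InjOn (l ∘ σ) (Icc (t₀ - δ) (t₀ + δ)) :=
    hinj.comp (hIσ.mono fun t ht => (hsub ht).1) hmaps
  have ha : t₀ - δ ∈ Icc (t₀ - δ) (t₀ + δ) := ⟨le_rfl, by linarith⟩
  have hb : t₀ + δ ∈ Icc (t₀ - δ) (t₀ + δ) := ⟨by linarith, le_rfl⟩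
  have ht : t₀ ∈ Icc (t₀ - δ) (t₀ + δ) := ⟨by linarith, by linarith⟩
  -- A continuous injective function on an interval is strictly monotone, so it covers a
  -- neighbourhood of its interior value. A point of `K` near `σ t₀` thus shares its `l`-value with
  -- a point of the arc, and coincides with it by injectivity of `l`.
  have himage : (l ∘ σ) '' Icc (t₀ - δ) (t₀ + δ) ∈ 𝓝 (l (σ t₀)) := by
    rcases hc.strictMonoOn_of_injOn_Icc' (by linarith) hi with h | h
    · exact mem_of_superset (Icc_mem_nhds (h ha ht (by linarith)) (h ht hb (by linarith)))
        (intermediate_value_Icc (by linarith) hc)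
    · exact mem_of_superset (Icc_mem_nhds (h ht hb (by linarith)) (h ha ht (by linarith)))
        (intermediate_value_Icc' (by linarith) hc)
  have h1 := hl (σ t₀) (hmaps ht) himage
  rw [mem_map, mem_nhdsWithin_iff_eventually] at h1
  filter_upwards [h1] with x hx hxK
  obtain ⟨s, hs, hsx⟩ := hx hxK
  exact ⟨s, (hsub hs).1, hinj (hmaps hs) hxK hsx⟩

/-- The times at which a curve does not cross the boundary of finitely many closed sets are
dense. -/
theorem exists_notMem_frontier_preimage {X : Type*} [TopologicalSpace X] {𝒦 : Set (Set X)}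
    (h𝒦 : 𝒦.Finite) (hcl : ∀ K ∈ 𝒦, IsClosed K) {σ : ℝ → X} (hσ : Continuous σ) {T : ℝ}
    (hT : 0 < T) : ∃ t ∈ Ioo 0 T, ∀ K ∈ 𝒦, t ∉ frontier (σ ⁻¹' K) := by
  -- Frontiers of closed sets have empty interior, so their complements are open and dense, and
  -- Baire's theorem applies.
  have hd : Dense (⋂ K ∈ 𝒦, (frontier (σ ⁻¹' K))ᶜ) := by
    refine dense_biInter_of_isOpen (fun K _ => isClosed_frontier.isOpen_compl) h𝒦.countable
      fun K hK => ?_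
    rw [← interior_eq_empty_iff_dense_compl]
    exact interior_frontier ((hcl K hK).preimage hσ)
  obtain ⟨t, ht, ht'⟩ := hd.inter_open_nonempty _ isOpen_Ioo (nonempty_Ioo.2 hT)
  exact ⟨t, ht, fun K hK => by simpa using mem_iInter₂.1 ht' K hK⟩

/-- If finitely many closed sets are embedded in the line, then a locally injective curve covers,
near most of its points, a neighbourhood in the union of these sets. -/
theorem eventually_mem_image_of_sUnion {X : Type*} [TopologicalSpace X] {𝒦 : Set (Set X)}
    (h𝒦 : 𝒦.Finite) (hcl : ∀ K ∈ 𝒦, IsClosed K)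
    (hl : ∀ K ∈ 𝒦, ∃ l : X → ℝ, ContinuousOn l K ∧ InjOn l K) {σ : ℝ → X} (hσ : Continuous σ)
    {t₀ : ℝ} (ht₀ : ∀ K ∈ 𝒦, t₀ ∉ frontier (σ ⁻¹' K)) {J : Set ℝ} (hJ : J ∈ 𝓝 t₀)
    (hinj : InjOn σ J) : ∀ I ∈ 𝓝 t₀, ∀ᶠ x in 𝓝 (σ t₀), x ∈ ⋃₀ 𝒦 → x ∈ σ '' I := by
  intro I hI
  have h1 : ∀ K ∈ 𝒦, ∀ᶠ x in 𝓝 (σ t₀), x ∈ K → x ∈ σ '' I := by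
    intro K hK
    -- A time off the frontier is either interior to `σ ⁻¹' K`, where the arc covers `K` near `σ
    -- t₀`, or outside it, where the closed set `K` avoids a neighbourhood of `σ t₀`.
    by_cases hmem : σ t₀ ∈ K
    · obtain ⟨l, hlc, hli⟩ := hl K hK
      have h2 : σ ⁻¹' K ∈ 𝓝 t₀ := by
        by_contra h3
        exact ht₀ K hK ⟨subset_closure hmem, mt mem_interior_iff_mem_nhds.1 h3⟩
      filter_upwards [eventually_mem_image_of_injOn hlc hli hσ (inter_mem hI hJ)
        (hinj.mono inter_subset_right) h2] with x hx hxK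
      exact image_mono inter_subset_left (hx hxK)
    · filter_upwards [(hcl K hK).isOpen_compl.mem_nhds hmem] with x hx hxK using absurd hxK hx
  filter_upwards [(h𝒦.eventually_all).2 h1] with x hx ⟨K, hK, hxK⟩ using hx K hK hxK

theorem fderiv_fderiv_add {V : Type*} [NormedAddCommGroup V] [NormedSpace ℝ V] {f g : V → ℝ}
    {q : V} (hf : ContDiffAt ℝ 2 f q) (hg : ContDiffAt ℝ 2 g q) :
    fderiv ℝ (fderiv ℝ (fun x => f x + g x)) q =
      fderiv ℝ (fderiv ℝ f) q + fderiv ℝ (fderiv ℝ g) q := by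
  have h1 : fderiv ℝ (fun x => f x + g x) =ᶠ[𝓝 q] fun x => fderiv ℝ f x + fderiv ℝ g x := by
    filter_upwards [hf.eventually (by simp), hg.eventually (by simp)] with x hx hx'
    exact fderiv_fun_add (hx.differentiableAt two_ne_zero) (hx'.differentiableAt two_ne_zero)
  rw [h1.fderiv_eq]
  exact fderiv_fun_add
    ((hf.fderiv_right (m := 1) one_add_one_eq_two.le).differentiableAt one_ne_zero)
    ((hg.fderiv_right (m := 1) one_add_one_eq_two.le).differentiableAt one_ne_zero)

section

variable {M : Type*} [TopologicalSpace M] [ChartedSpace Plane M] [IsManifold (𝓡 2) ∞ M]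
  {F : TangentBundle (𝓡 2) M → ℝ}

theorem exists_injOn_of_immersed {σ : ℝ → M} (hσ : ContMDiff 𝓘(ℝ, ℝ) (𝓡 2) ∞ σ) {t₀ : ℝ}
    (hv : vec (velocity σ t₀) ≠ 0) : ∃ J ∈ 𝓝 t₀, InjOn σ J := by
  obtain ⟨j, u, hu, -⟩ := exists_local_graph hσ hv
  refine ⟨_, hu, fun s hs t ht hst => ?_⟩
  rw [mem_ofPred_eq] at hs ht
  rw [← hs, ← ht, hst]

/-- A short arc is compact, hence closed in a Hausdorff surface, and the coordinate over which it is
a graph embeds it in the line. -/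
theorem exists_embedded_piece [T2Space M] {σ : ℝ → M} (hσ : ContMDiff 𝓘(ℝ, ℝ) (𝓡 2) ∞ σ) {t₀ : ℝ}
    (hv : vec (velocity σ t₀) ≠ 0) : ∃ K : Set M, IsClosed K ∧
      (∃ l : M → ℝ, ContinuousOn l K ∧ InjOn l K) ∧ σ ⁻¹' K ∈ 𝓝 t₀ := by
  obtain ⟨j, u, hu, -⟩ := exists_local_graph hσ hv
  have hs : ∀ᶠ t in 𝓝 t₀, σ t ∈ (extChartAt (𝓡 2) (σ t₀)).source :=
    hσ.continuous.continuousAt.eventually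
      ((isOpen_extChartAt_source (I := 𝓡 2) (σ t₀)).eventually_mem (mem_extChartAt_source _))
  obtain ⟨δ, hδ, hsub⟩ := Metric.nhds_basis_closedBall.mem_iff.1 (hu.and hs)
  refine ⟨σ '' Metric.closedBall t₀ δ,
    ((isCompact_closedBall t₀ δ).image hσ.continuous).isClosed,
    ⟨fun x => extChartAt (𝓡 2) (σ t₀) x j, ?_, ?_⟩,
    mem_of_superset (Metric.closedBall_mem_nhds t₀ hδ) (subset_preimage_image _ _)⟩
  · refine (coordForm j).continuous.comp_continuousOn
      ((continuousOn_extChartAt (I := 𝓡 2) (σ t₀)).mono ?_)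
    rintro _ ⟨t, ht, rfl⟩
    exact (hsub ht).2
  · rintro _ ⟨s, hs, rfl⟩ _ ⟨t, ht, rfl⟩ hst
    have h1 : u (extChartAt (𝓡 2) (σ t₀) (σ s) j) = s := (hsub hs).1
    have h2 : u (extChartAt (𝓡 2) (σ t₀) (σ t) j) = t := (hsub ht).1
    simp only [] at hst
    rw [← h1, ← h2, hst]

theorem exists_finite_embedded_cover [T2Space M] {σ : ℝ → M}
    (hσ : ContMDiff 𝓘(ℝ, ℝ) (𝓡 2) ∞ σ) (hv : ∀ t, vec (velocity σ t) ≠ 0) {T : ℝ} (hT : 0 < T)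
    (hper : Function.Periodic σ T) : ∃ 𝒦 : Set (Set M), 𝒦.Finite ∧ (∀ K ∈ 𝒦, IsClosed K) ∧
      (∀ K ∈ 𝒦, ∃ l : M → ℝ, ContinuousOn l K ∧ InjOn l K) ∧ range σ ⊆ ⋃₀ 𝒦 := by
  choose K hcl hl hK using fun t => exists_embedded_piece hσ (hv t)
  obtain ⟨s, -, hs⟩ := (isCompact_Icc (a := 0) (b := T)).elim_nhds_subcover
    (fun t => σ ⁻¹' K t) fun t _ => hK t
  refine ⟨K '' s, s.finite_toSet.image K, ?_, ?_, ?_⟩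
  · rintro _ ⟨t, -, rfl⟩
    exact hcl t
  · rintro _ ⟨t, -, rfl⟩
    exact hl t
  · rintro _ ⟨t, rfl⟩
    obtain ⟨r, hr, hrt⟩ := hper.exists_mem_Ico₀ hT t
    obtain ⟨a, ha, hra⟩ := mem_iUnion₂.1 (hs (Ico_subset_Icc_self hr))
    exact ⟨K a, mem_image_of_mem K ha, by rw [hrt]; exact hra⟩

/-- A smooth nonnegative function which vanishes on finitely many closed geodesics and has a
nonzero Hessian at a point of each of them. -/
theorem exists_factor [T2Space M] (hF : IsFinslerMetric F) {k : ℕ} {σ : Fin k → ℝ → M}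
    {T : Fin k → ℝ} (hσ : ∀ i, IsClosedGeodesic F (σ i) (T i)) :
    ∃ f : M → ℝ, ContMDiff (𝓡 2) 𝓘(ℝ, ℝ) ∞ f ∧ (∀ x, 0 ≤ f x) ∧ (∀ i t, f (σ i t) = 0) ∧
      ∀ i, ∃ t₀ ∈ Ioo 0 (T i), fderiv ℝ (fderiv ℝ (baseExpr f (σ i t₀)))
        (extChartAt (𝓡 2) (σ i t₀) (σ i t₀)) ≠ 0 := by
  choose 𝒦 hfin hcl hl hcov using fun i => exists_finite_embedded_cover (hσ i).smooth
    ((hσ i).vec_velocity_ne_zero hF) (hσ i).length_pos (hσ i).periodic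
  have hfin' : (⋃ i, 𝒦 i).Finite := finite_iUnion hfin
  have hcl' : ∀ K ∈ ⋃ i, 𝒦 i, IsClosed K := fun K hK => by
    obtain ⟨i, hi⟩ := mem_iUnion.1 hK
    exact hcl i K hi
  have hl' : ∀ K ∈ ⋃ i, 𝒦 i, ∃ l : M → ℝ, ContinuousOn l K ∧ InjOn l K := fun K hK => by
    obtain ⟨i, hi⟩ := mem_iUnion.1 hK
    exact hl i K hi
  choose t ht htK using fun i => exists_notMem_frontier_preimage hfin' hcl'
    (hσ i).smooth.continuous (hσ i).length_pos
  choose J hJ hinj using fun i => exists_injOn_of_immersed (hσ i).smooth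
    ((hσ i).vec_velocity_ne_zero hF (t i))
  choose f hfs hf0 hfΓ n hn using fun i => exists_factor_of_local (hσ i).smooth
    ((hσ i).vec_velocity_ne_zero hF (t i)) (eventually_mem_image_of_sUnion hfin' hcl' hl'
      (hσ i).smooth.continuous (htK i) (hJ i) (hinj i))
  have hfσ (i j : Fin k) (r : ℝ) : f i (σ j r) = 0 := by
    obtain ⟨K, hK, hr⟩ := hcov j (mem_range_self r)
    exact hfΓ i _ ⟨K, mem_iUnion.2 ⟨j, hK⟩, hr⟩
  have hsum (s : Finset (Fin k)) : ContMDiff (𝓡 2) 𝓘(ℝ, ℝ) ∞ fun x => ∑ j ∈ s, f j x :=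
    contMDiff_finsetSum fun j _ => hfs j
  refine ⟨fun x => ∑ j, f j x, hsum _, fun x => Finset.sum_nonneg fun j _ => hf0 j x,
    fun i r => Finset.sum_eq_zero fun j _ => hfσ j i r, fun i => ⟨t i, ht i, fun hzero => ?_⟩⟩
  set p := σ i (t i) with hp
  have hpt := mem_extChartAt_target (I := 𝓡 2) p
  have hsplit : baseExpr (fun x => ∑ j, f j x) p = fun q =>
      baseExpr (f i) p q + baseExpr (fun x => ∑ j ∈ Finset.univ.erase i, f j x) p q := by
    funext q
    exact (Finset.add_sum_erase _ _ (Finset.mem_univ i)).symm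
  have hsm := (contDiffAt_baseExpr (hsum (Finset.univ.erase i)) hpt).of_le two_le_infty
  rw [hsplit, fderiv_fderiv_add ((contDiffAt_baseExpr (hfs i) hpt).of_le two_le_infty) hsm]
    at hzero
  -- The other summands vanish at this point and are nonnegative, so their Hessian is semidefinite
  -- and cannot cancel the positive value of `f i` on `n i`.
  have hmin : IsLocalMin (baseExpr (fun x => ∑ j ∈ Finset.univ.erase i, f j x) p)
      (extChartAt (𝓡 2) p p) := Eventually.of_forall fun q => by
    have h0 : baseExpr (fun x => ∑ j ∈ Finset.univ.erase i, f j x) p (extChartAt (𝓡 2) p p)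
        = 0 := by
      rw [baseExpr, extChartAt_to_inv]
      exact Finset.sum_eq_zero fun j _ => hfσ j i (t i)
    rw [h0]
    exact Finset.sum_nonneg fun j _ => hf0 j _
  have h1 := second_deriv_nonneg_of_isLocalMin hsm hmin (n i)
  have h2 := DFunLike.congr_fun (DFunLike.congr_fun hzero (n i)) (n i)
  have h3 := hn i
  simp only [add_apply, zero_apply] at h2
  linarith

end

end

end FinslerSurface

/-! ### Choice of the conformal parameter -/

theorem mainTheorem6 {S : Type*} [TopologicalSpace S] [T2Space S] [CompactSpace S]
    [ChartedSpace (EuclideanSpace ℝ (Fin 2)) S] [IsManifold (𝓡 2) ∞ S]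
    (F : TangentBundle (𝓡 2) S → ℝ) (hF : FinslerSurface.IsFinslerMetric F)
    (k : ℕ) (σ : Fin k → ℝ → S) (T : Fin k → ℝ)
    (hσ : ∀ i, FinslerSurface.IsClosedGeodesic F (σ i) (T i))
    (F₀ : TangentBundle (𝓡 2) S → ℝ) (hF₀ : FinslerSurface.IsFinslerMetric F₀)
    (A : FinslerSurface.ChartCover S) (ε : ℝ) (hε : 0 < ε) :
    ∃ F' : TangentBundle (𝓡 2) S → ℝ,
      FinslerSurface.IsFinslerMetric F' ∧
      FinslerSurface.cInftyDist A F₀ F F' < ENNReal.ofReal ε ∧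
      (∀ i, FinslerSurface.IsClosedGeodesic F' (σ i) (T i) ∧
        FinslerSurface.IsNondegenerate F' (σ i) (T i)) ∧
      (FinslerSurface.IsSymmetric F → FinslerSurface.IsSymmetric F') ∧
      (FinslerSurface.IsRiemannian F → FinslerSurface.IsRiemannian F') := by
  obtain ⟨f, hf, hf0, hfσ, hne⟩ := FinslerSurface.exists_factor hF hσ
  choose t₀ ht₀ hne using hne
  have hnear := ((FinslerSurface.tendsto_cInftyDist_conformal hF hF₀ A hf).mono_left
    (nhdsWithin_le_nhds (s := Ioi 0))).eventually_lt_const (u := ENNReal.ofReal ε) (ENNReal.ofReal_pos.2 hε)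
  -- Each nondegeneracy condition holds for all sufficiently small `s > 0`; as there are finitely
  -- many, they hold together and along with the distance bound.
  have hnondeg := eventually_all.2 fun i => FinslerSurface.eventually_isNondegenerate_family hF
    (hσ i) hf hf0 (hfσ i) (ht₀ i) (hne i)
  obtain ⟨s, ⟨hs, hdist⟩, hsn⟩ := ((eventually_mem_nhdsWithin.and hnear).and hnondeg).exists
  have hs0 : 0 < s := hs
  have hone (x : S) : 1 ≤ 1 + s * f x := le_add_of_nonneg_right (mul_nonneg hs0.le (hf0 x))
  have hpos (x : S) : 0 < 1 + s * f x := zero_lt_one.trans_le (hone x)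
  have hsmooth : ContMDiff (𝓡 2) 𝓘(ℝ, ℝ) ∞ fun x => 1 + s * f x :=
    contMDiff_const.add (contMDiff_const.mul hf)
  refine ⟨FinslerSurface.family f F s, hF.conformal hpos hsmooth, hdist, fun i => ⟨?_, hsn i⟩,
    fun h => h.conformal _, fun h => h.conformal hpos hsmooth⟩
  exact (hσ i).conformal hF hsmooth hone fun t => by simp [hfσ i t]
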